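/- **Language.** Work over a language of arithmetic consisting of $0$, $S$, $=$ and further function and relation symbols with fixed standard interpretations on $\mathbb N$, together with a unary predicate $I$ (we write $t\in I$). A formula is *simple* if it contains no closed terms. The language is closed under adding, for each quantifier-free simple formula $\phi(x,y_1,\dots,y_n)$, an $n$-ary Skolem function $c_{\exists x\phi}$; $\phi$ may itself contain Skolem functions. All formulas are quantifier-free; $\exists x\,\phi(x,\vec t)$ abbreviates $\phi(c_{\exists x\phi}(\vec t),\vec t)$ and $\forall x\,\phi(x,\vec t)$ abbreviates $\phi(c_{\exists x\neg\phi}(\vec t),\vec t)$. Fix a simple formula $B(x,y,X)$ without Skolem functions in which $X$ occurs, and occurs only positively; $A(y,X)$ is $\forall x\,B(x,y,X)$. Fix a finite list $\mathrm{Cr}$ of closed critical formulas, each of one of the forms *Pred* $\neg s=0\to\exists x\,s=Sx$; *Epsilon* $\phi(t,\vec s)\to\exists x\,\phi(x,\vec s)$; *Induction* $\phi(0,\vec s)\wedge\neg\phi(t,\vec s)\to\exists x(\phi(x,\vec s)\wedge\neg\phi(Sx,\vec s))$; *Inductive definition* $A(t,I)\to t\in I$; *Closure* $\forall x(A(x,\phi)\to\phi(x,\vec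 s))\to\forall x(x\in I\to\phi(x,\vec s))$ (with $\phi$ simple). **Substitutions.** A canonical expression is a formula $n\in I$ or a term $c_{\exists x\phi}(\vec a)$ with numerals $n,\vec a$. Put $c_n=c_{\exists x\neg B(x,y,I)}(n)$ and $\Omega=\omega_1$. Let the simple rank $rk_s$ be the nesting depth of Skolem functions (so $rk_s(c_{\exists x\phi})=rk_s(\phi)+1$). Ranks: $rk(n\in I)=rk(c_n)=\Omega$; otherwise $rk(c_{\exists x\phi}(\vec a))$ is $\Omega+rk_s(c_{\exists x\phi})+1$ if $I$ occurs in $\phi$ (at any depth), and $rk_s(c_{\exists x\phi})$ if not. An $\epsilon$-substitution is a partial function $S$ on canonical expressions; the value of a term is $?$ or a positive numeral, the value of a formula is $?$ or $\top$. The reduction $|\cdot|_S$ replaces canonical expressions in $\mathrm{dom}(S)$ by their values ($?$ being read as $0$, respectively $\bot$) and evaluates function symbols of arithmetic on numerals, repeatedly. $S\vDash\phi$ means that $|\phi|_S$ is a true sentence of arithmetic; $S$ decides $\phi$ if $S\vDash\phi$ or $S\vDash\neg\phi$; $\overline S$ extends $S$ by the value $?$ elsewhere. Let $F(e,?)=\top$,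 $F(c_{\exists x\phi}(\vec a),u)=\phi(u,\vec a)\wedge\bigwedge_{v<u}\neg\phi(v,\vec a)$, $F(n\in I,\top)=A(n,I)$. $S$ is correct if $\overline S\vDash F(e,u)$ for all $(e,u)\in S$. $S$ is computationally inconsistent if $S\vDash\neg F(e,u)$ for some $(e,u)\in S$, or if $(c_n,u),(n\in I,\top)\in S$ for some $n$ and some $u\ne{?}$. $S^-_{=\Omega}$ consists of the pairs $(c_m,u)$, $u\neq{?}$, and $(m\in I,?)$ in $S$; $S^+_{=\Omega}$ of the pairs $(c_m,?)$ and $(m\in I,\top)$ in $S$. $S_{<r}$, $S_{\le r}$ denote restriction to expressions of that rank. **Sequents.** A sequent $\Theta=(S,P,V,\mathcal F)$ consists of an $\epsilon$-substitution $S$; an enumeration $P$ without repetitions of the formulas with $(n\in I,\top)\in S$; a function $V$ on the members of $P$ whose values are finite $\epsilon$-substitutions $W$ with $W=W^-_{=\Omega}$; and a function $\mathcal F$ into $\{t,f\}$ whose domain is the set of $e\in\mathrm{dom}(S)$ with $S(e)={?}$ or $rk(e)=\Omega$. $\emptyset$ is the empty sequent. $P=\langle n_1\in I,\dots,n_k\in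 I\rangle$ is admissible if $\overline{\{(n_j\in I,\top):j<i\}}\vDash B(0,n_i,I)$ for each $i$. **$H$-step.** To an unsatisfied critical formula (one with $S\vDash\neg Cr$) is assigned a pair $(e,v)$; write $\vec a=|\vec s|_S$. *Pred*: $e=c_{\exists x\,y=Sx}(|s|_S)$, $v=|s|_S-1$. *Epsilon*: $e=c_{\exists x\phi}(\vec a)$, $v=|t|_S$. *Induction*: $e=c_{\exists x(\phi(x)\wedge\neg\phi(Sx))}(\vec a)$ and $v$ is the least $m<|t|_S$ with $\phi(m,\vec s)\wedge\neg\phi(Sm,\vec s)$ true. *Inductive definition*: $e$ is $|t|_S\in I$, $v=\top$. *Closure*: let $n\in I$ be the first member of $P$ with $S\vDash\neg\phi(n,\vec s)$; if $S\vDash\neg A(n,\phi)$ then $e=c_n$, $v=S(c_{\exists z\neg B(z,x,\phi)}(n,\vec a))$; if $S\vDash A(n,\phi)$ then $e=c_{\exists x\neg(A(x,\phi)\to\phi(x))}(\vec a)$, $v=n$. The $H$-step applies to $\Theta$ if $S$ is correct, $S\vDash\neg Cr$ for some $Cr\in\mathrm{Cr}$, and all calculations take place in $S$, i.e.: $S$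 decides all critical formulas; the pairs of all unsatisfied ones are computed in $S$, and $(e(\Theta),v(\Theta))$ is the pair whose $e$ has least rank, of the first such critical formula; $S$ decides $F(e',u)$ for all $(e',u)\in S$ with $e'$ a term, and $F(e(\Theta),v(\Theta))$; $(e(\Theta),?)\in S$; if $e(\Theta)=c_n$ then $n\in I\in\mathrm{dom}(S)$; if $e(\Theta)$ is $n\in I$ then $c_n\in\mathrm{dom}(S)$; if $e(\Theta)$ is a term of rank $\Omega$ and $(c_n,?)\in S$ then $n\in I\in\mathrm{dom}(S)$. Then, with $e=e(\Theta)$, $v=v(\Theta)$, $H(\Theta)=(S',P',V',\mathcal F')$ is: - if $rk(e)\ne\Omega$: $S'$ is $S_{\le rk(e)}$ with the value of $e$ changed to $v$; $P'=V'=\emptyset$ if $rk(e)<\Omega$, and $P'=P$, $V'=V$ if $rk(e)>\Omega$; - if $e$ is $n\in I$: $S'=S_{<\Omega}\cup S^+_{=\Omega}\cup\{(e,\top)\}$, $P'=P^\frown\langle e\rangle$, $V'=V\cup\{(e,S^-_{=\Omega})\}$; - if $e=c_n$: $P'$ is the longest initial segment of $P$ not containing $n\in I$, $V'=V\restriction P'$,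 and $S'$ consists of $(c_n,v)$, $S_{<\Omega}$, the pairs $(m\in I,\top)$ and those $(c_m,?)\in S$ with $m\in I$ in $P'$, and $V(n\in I)$ if $n\in I$ is in $P$, respectively $S^-_{=\Omega}$ if it is not. $\mathcal F'$ agrees with $\mathcal F$ on $\mathrm{dom}(S)$ and is $t$ on new expressions. An expression $e'\in\mathrm{dom}(S)$ is active at $\Theta$ if $rk(e')=rk(e(\Theta))$ and $e'\notin\mathrm{dom}(S')$ or $S'(e')\ne S(e')$. **Rules.** $(e,u,i),\Theta$ is $\Theta$ with $(e,u)$ added to $S$ and $(e,i)$ to $\mathcal F$ (no $i$ is given when $u\neq{?}$ and $rk(e)\ne\Omega$); it presupposes $e\notin\mathrm{dom}(S)$. Below, $u$ ranges over positive numerals. Axioms: *AxF*: $S$ is computationally inconsistent; *AxS*: $S\vDash Cr$ for all $Cr\in\mathrm{Cr}$; *AxH*: the $H$-step applies to $\Theta$ and some active $e'$ has $\mathcal F(e')=f$. Inferences with conclusion $\Theta$ and main expression $e$: - $Cut$ ($e$ a term): premises $(e,?,f),\Theta$ and, for all $u$, $(e,u),\Theta$ (if $rk(e)\ne\Omega$),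 respectively $(e,u,f),\Theta$ (if $rk(e)=\Omega$); - $CutFr$ ($e$ a term): the same with first premise $(e,?,t),\Theta$; - $Cut$ ($e$ a formula $n\in I$): premises $(e,?,f),\Theta$ and, for all $P_e$ proper for $e,\Theta$ and all $V_e$, the sequent $(e,\top,f,P_e,V_e),\Theta$, which is obtained by adding $(m\in I,\top)$ to $S$ and $(m\in I,f)$ to $\mathcal F$ for all $m\in I$ in $P_e$, appending $P_e$ to $P$, and adding $V_e$ to $V$. Here $P_e$ is *proper* if it is a sequence of distinct formulas $m\in I$ with last element $e$, none of them in $P$ or in $\mathrm{dom}(S)$, such that $P^\frown P_e$ is admissible and $(c_m,u)\notin S$ for $m\in I$ in $P_e$ and $u\ne{?}$; $V_e$ is a function on the members of $P_e$ with values as required for $V$; - $Fr$: premise $(e,?,t),\Theta$; - $H$: premise $H(\Theta)$, provided the $H$-step applies to $\Theta$ with $e=e(\Theta)$, $(e,?)\in S$, $\mathcal F(e)=t$, and $\mathcal F(e')=t$ for all active $e'$. A *deduction* from a set $\mathcal S$ of sequents is a well-founded tree built from elements of $\mathcal S$, axioms and inferences; a *derivation* is a deduction from $\emptyset$. For an ordinal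 $r$, a deduction is an *$r$-deduction* if its $Cut$s have main expressions of rank $<r$, it has no $CutFr$, and its $Fr$ and $H$ inferences have rank $\ge r$. It is an *$r^+$-deduction* if all $Cut$s have rank $<r$, all $CutFr$s rank $=r$, all $Fr$s rank $>r$, and all $H$s rank $\ge r$. An *$r$-path* for $\Theta$ is a sequence $\Theta_0=\emptyset,\dots,\Theta_n=\Theta$ that is a path in some $r$-deduction. *Pruning* a deduction replaces each $CutFr$ inference by the $Fr$ inference with the same main expression, keeping only the subdeduction of $(e,?,t),\Theta$. **Theorem (predicative cut reduction).** Let $r\ne\Omega$ be an ordinal. If $\Theta$ has an $(r+1)$-derivation and $\Theta$ has an $(r+1)$-path, then there is an $r^+$-derivation $d'$ of $\Theta$, and pruning $d'$ yields an $r$-derivation of $\Theta$. -/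

import Mathlib

noncomputable section

namespace EpsID1


/-! ## The Skolemized quantifier-free language -/

mutual
/-- Terms with free variables among `Fin k`. The symbols of arithmetic are `0`, `S` and the function
symbols of `L`; `skolem φ ts` is `c_{∃x φ(x,y₁,…,yₙ)}(t₁,…,tₙ)`, where variable `0` of `φ` is `x` and
variable `i + 1` is `yᵢ`. -/
inductive Tm (L : FirstOrder.Language.{0, 0}) : ℕ → Type
  | var {k : ℕ} (i : Fin k) : Tm L k
  | zero {k : ℕ} : Tm L k
  | succ {k : ℕ} (t : Tm L k) : Tm L k
  | func {k n : ℕ} (f : L.Functions n) (ts : Fin n → Tm L k) : Tm L k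
  | skolem {k n : ℕ} (φ : Fm L (n + 1)) (ts : Fin n → Tm L k) : Tm L k

/-- Quantifier-free formulas with free variables among `Fin k`; `mem t` is `t ∈ I`. -/
inductive Fm (L : FirstOrder.Language.{0, 0}) : ℕ → Type
  | tru {k : ℕ} : Fm L k
  | fls {k : ℕ} : Fm L k
  | eq {k : ℕ} (s t : Tm L k) : Fm L k
  | rel {k n : ℕ} (R : L.Relations n) (ts : Fin n → Tm L k) : Fm L k
  | mem {k : ℕ} (t : Tm L k) : Fm L k
  | neg {k : ℕ} (φ : Fm L k) : Fm L k
  | and {k : ℕ} (φ ψ : Fm L k) : Fm L k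
  | or {k : ℕ} (φ ψ : Fm L k) : Fm L k
end

variable {L : FirstOrder.Language.{0, 0}}

/-- `φ → ψ`, as an abbreviation. -/
def Fm.imp {k : ℕ} (φ ψ : Fm L k) : Fm L k := .or (.neg φ) ψ

/-- The numeral `S ⋯ S 0`. -/
def Tm.num {k : ℕ} : ℕ → Tm L k
  | 0 => .zero
  | n + 1 => .succ (Tm.num n)

/-- The number denoted by a term that is a numeral; `none` if the term is not a numeral. -/
def Tm.numVal {k : ℕ} : Tm L k → Option ℕ
  | .zero => some 0
  | .succ t => t.numVal.map (· + 1)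
  | .var _ => none
  | .func _ _ => none
  | .skolem _ _ => none

/-- Simultaneous substitution of terms for the free variables. -/
def Tm.subst {k m : ℕ} (σ : Fin k → Tm L m) : Tm L k → Tm L m
  | .var i => σ i
  | .zero => .zero
  | .succ t => .succ (t.subst σ)
  | .func f ts => .func f (fun i => (ts i).subst σ)
  | .skolem φ ts => .skolem φ (fun i => (ts i).subst σ)

/-- Simultaneous substitution of terms for the free variables. -/
def Fm.subst {k m : ℕ} (σ : Fin k → Tm L m) : Fm L k → Fm L m
  | .tru => .tru
  | .fls => .fls
  | .eq s t => .eq (s.subst σ) (t.subst σ)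
  | .rel R ts => .rel R (fun i => (ts i).subst σ)
  | .mem t => .mem (t.subst σ)
  | .neg φ => .neg (φ.subst σ)
  | .and φ ψ => .and (φ.subst σ) (ψ.subst σ)
  | .or φ ψ => .or (φ.subst σ) (ψ.subst σ)

/-- Replace every atom `t ∈ X` (written `mem t`) by the formula `ψ t`. -/
def Fm.replaceMem {k : ℕ} (ψ : Tm L k → Fm L k) : Fm L k → Fm L k
  | .tru => .tru
  | .fls => .fls
  | .eq s t => .eq s t
  | .rel R ts => .rel R ts
  | .mem t => ψ t
  | .neg φ => .neg (φ.replaceMem ψ)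
  | .and φ χ => .and (φ.replaceMem ψ) (χ.replaceMem ψ)
  | .or φ χ => .or (φ.replaceMem ψ) (χ.replaceMem ψ)

/-- The term contains no Skolem function. -/
def Tm.SkolemFree {k : ℕ} : Tm L k → Prop
  | .var _ => True
  | .zero => True
  | .succ t => t.SkolemFree
  | .func _ ts => ∀ i, (ts i).SkolemFree
  | .skolem _ _ => False

/-- The formula contains no Skolem function, i.e. it is a quantifier-free formula of the language of
`ID₁` (in which `I` may occur). -/
def Fm.SkolemFree {k : ℕ} : Fm L k → Prop
  | .tru => True
  | .fls => True
  | .eq s t => s.SkolemFree ∧ t.SkolemFree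
  | .rel _ ts => ∀ i, (ts i).SkolemFree
  | .mem t => t.SkolemFree
  | .neg φ => φ.SkolemFree
  | .and φ ψ => φ.SkolemFree ∧ ψ.SkolemFree
  | .or φ ψ => φ.SkolemFree ∧ ψ.SkolemFree

/-- The formula is in the language of Peano arithmetic: no Skolem function and no `I`. -/
def Fm.IsArith {k : ℕ} : Fm L k → Prop
  | .tru => True
  | .fls => True
  | .eq s t => s.SkolemFree ∧ t.SkolemFree
  | .rel _ ts => ∀ i, (ts i).SkolemFree
  | .mem _ => False
  | .neg φ => φ.IsArith
  | .and φ ψ => φ.IsArith ∧ ψ.IsArith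
  | .or φ ψ => φ.IsArith ∧ ψ.IsArith

/-- The term and all its subterms are not closed. -/
def Tm.NoClosed {k : ℕ} : Tm L k → Prop
  | .var _ => True
  | .zero => False
  | .succ t => t.NoClosed
  | .func (n := n) _ ts => 0 < n ∧ ∀ i, (ts i).NoClosed
  | .skolem (n := n) _ ts => 0 < n ∧ ∀ i, (ts i).NoClosed

/-- The formula contains no closed terms. -/
def Fm.Simple {k : ℕ} : Fm L k → Prop
  | .tru => True
  | .fls => True
  | .eq s t => s.NoClosed ∧ t.NoClosed
  | .rel _ ts => ∀ i, (ts i).NoClosed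
  | .mem t => t.NoClosed
  | .neg φ => φ.Simple
  | .and φ ψ => φ.Simple ∧ ψ.Simple
  | .or φ ψ => φ.Simple ∧ ψ.Simple

mutual
/-- The term belongs to the Skolemized language: every Skolem function `c_{∃x φ}` in it, at any depth,
has a simple `φ`. -/
def Tm.InLang {k : ℕ} : Tm L k → Prop
  | .var _ => True
  | .zero => True
  | .succ t => t.InLang
  | .func _ ts => ∀ i, (ts i).InLang
  | .skolem φ ts => φ.Simple ∧ φ.InLang ∧ ∀ i, (ts i).InLang

/-- The formula belongs to the Skolemized language. -/
def Fm.InLang {k : ℕ} : Fm L k → Prop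
  | .tru => True
  | .fls => True
  | .eq s t => s.InLang ∧ t.InLang
  | .rel _ ts => ∀ i, (ts i).InLang
  | .mem t => t.InLang
  | .neg φ => φ.InLang
  | .and φ ψ => φ.InLang ∧ ψ.InLang
  | .or φ ψ => φ.InLang ∧ ψ.InLang
end

mutual
/-- `I` occurs in the term (inside a Skolem function). -/
def Tm.HasI {k : ℕ} : Tm L k → Prop
  | .var _ => False
  | .zero => False
  | .succ t => t.HasI
  | .func _ ts => ∃ i, (ts i).HasI
  | .skolem φ ts => φ.HasI ∨ ∃ i, (ts i).HasI

/-- `I` occurs in the formula, possibly inside a Skolem function. -/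
def Fm.HasI {k : ℕ} : Fm L k → Prop
  | .tru => False
  | .fls => False
  | .eq s t => s.HasI ∨ t.HasI
  | .rel _ ts => ∃ i, (ts i).HasI
  | .mem _ => True
  | .neg φ => φ.HasI
  | .and φ ψ => φ.HasI ∨ ψ.HasI
  | .or φ ψ => φ.HasI ∨ ψ.HasI
end

mutual
/-- The simple rank: the least stage of the language hierarchy in which the term appears. -/
def Tm.simpleRank {k : ℕ} : Tm L k → ℕ
  | .var _ => 0
  | .zero => 0
  | .succ t => t.simpleRank
  | .func _ ts => Finset.univ.sup fun i => (ts i).simpleRank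
  | .skolem φ ts => max (φ.simpleRank + 1) (Finset.univ.sup fun i => (ts i).simpleRank)

/-- The simple rank: the least stage of the language hierarchy in which the formula appears. -/
def Fm.simpleRank {k : ℕ} : Fm L k → ℕ
  | .tru => 0
  | .fls => 0
  | .eq s t => max s.simpleRank t.simpleRank
  | .rel _ ts => Finset.univ.sup fun i => (ts i).simpleRank
  | .mem t => t.simpleRank
  | .neg φ => φ.simpleRank
  | .and φ ψ => max φ.simpleRank ψ.simpleRank
  | .or φ ψ => max φ.simpleRank ψ.simpleRank
end

/-- All occurrences of `X` (written `mem`) in the formula are positive (`b = true`),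
respectively negative (`b = false`). -/
def Fm.OnlySign {k : ℕ} (b : Bool) : Fm L k → Prop
  | .tru => True
  | .fls => True
  | .eq _ _ => True
  | .rel _ _ => True
  | .mem _ => b = true
  | .neg φ => φ.OnlySign (!b)
  | .and φ ψ => φ.OnlySign b ∧ ψ.OnlySign b
  | .or φ ψ => φ.OnlySign b ∧ ψ.OnlySign b

/-- `φ(s, t₁, …, tₙ)`. -/
def Fm.inst {n k : ℕ} (φ : Fm L (n + 1)) (s : Tm L k) (ts : Fin n → Tm L k) : Fm L k :=
  φ.subst (Fin.cons s ts)

/-- `∃x φ(x, t⃗)`, an abbreviation for `φ(c_{∃x φ}(t⃗), t⃗)`. -/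
def Fm.ex {n k : ℕ} (φ : Fm L (n + 1)) (ts : Fin n → Tm L k) : Fm L k :=
  φ.inst (.skolem φ ts) ts

/-- `∀x φ(x, t⃗)`, an abbreviation for `φ(c_{∃x ¬φ}(t⃗), t⃗)`. -/
def Fm.all {n k : ℕ} (φ : Fm L (n + 1)) (ts : Fin n → Tm L k) : Fm L k :=
  φ.inst (.skolem φ.neg ts) ts

/-- `B(z, x, φ(·, y⃗))` in the variables `z, x, y⃗`, for `B(z, x, X)` and `φ(x, y⃗)`. -/
def instB (B : Fm L 2) {n : ℕ} (φ : Fm L (n + 1)) : Fm L (n + 2) :=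
  (B.subst ![.var 0, .var 1]).replaceMem fun t => φ.inst t fun i => .var i.succ.succ

/-- `A(t, I) = ∀x B(x, t, I)`. -/
def formA {k : ℕ} (B : Fm L 2) (t : Tm L k) : Fm L k := Fm.all (n := 1) B fun _ => t

/-- `A(t, φ(·, s⃗)) = ∀z B(z, t, φ(·, s⃗))`. -/
def formAOf {n k : ℕ} (B : Fm L 2) (φ : Fm L (n + 1)) (t : Tm L k) (ts : Fin n → Tm L k) : Fm L k :=
  Fm.all (n := n + 1) (instB B φ) (Fin.cons t ts)

/-! ## Critical formulas -/

/-- Closed critical formulas, with the data of the axiom they are instances of. -/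
inductive Crit (L : FirstOrder.Language.{0, 0}) : Type
  | pred (s : Tm L 0)
  | epsilon {n : ℕ} (φ : Fm L (n + 1)) (t : Tm L 0) (ts : Fin n → Tm L 0)
  | induction {n : ℕ} (φ : Fm L (n + 1)) (t : Tm L 0) (ts : Fin n → Tm L 0)
  | inductiveDef (t : Tm L 0)
  | closure {n : ℕ} (φ : Fm L (n + 1)) (ts : Fin n → Tm L 0)

/-- `y = S x`. -/
def predFm : Fm L (1 + 1) := .eq (.var 1) (.succ (.var 0))

/-- `φ(x, y⃗) ∧ ¬ φ(S x, y⃗)`. -/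
def indFm {n : ℕ} (φ : Fm L (n + 1)) : Fm L (n + 1) :=
  .and φ (.neg (φ.inst (.succ (.var 0)) fun i => .var i.succ))

/-- `A(x, φ(·, y⃗)) → φ(x, y⃗)`. -/
def progFm (B : Fm L 2) {n : ℕ} (φ : Fm L (n + 1)) : Fm L (n + 1) :=
  (formAOf B φ (.var 0) fun i => .var i.succ).imp φ

/-- `x ∈ I → φ(x, y⃗)`. -/
def inclFm {n : ℕ} (φ : Fm L (n + 1)) : Fm L (n + 1) := (Fm.mem (.var 0)).imp φ

/-- The critical formula itself. -/
def Crit.fm (B : Fm L 2) : Crit L → Fm L 0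
  | .pred s => (Fm.neg (.eq s .zero)).imp (predFm.ex fun _ => s)
  | .epsilon φ t ts => (φ.inst t ts).imp (φ.ex ts)
  | .induction φ t ts =>
      (Fm.and (φ.inst .zero ts) (.neg (φ.inst t ts))).imp ((indFm φ).ex ts)
  | .inductiveDef t => (formA B t).imp (.mem t)
  | .closure φ ts => ((progFm B φ).all ts).imp ((inclFm φ).all ts)

/-- The critical formula belongs to the Skolemized language. -/
def Crit.InLang : Crit L → Prop
  | .pred s => s.InLang
  | .epsilon φ t ts => φ.Simple ∧ φ.InLang ∧ t.InLang ∧ ∀ i, (ts i).InLang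
  | .induction φ t ts => φ.Simple ∧ φ.InLang ∧ t.InLang ∧ ∀ i, (ts i).InLang
  | .inductiveDef t => t.InLang
  | .closure φ ts => φ.Simple ∧ φ.InLang ∧ ∀ i, (ts i).InLang

/-! ## Canonical expressions and `ε`-substitutions -/

/-- `term φ a` is `c_{∃x φ}(a₁, …, aₙ)` with numerals `aᵢ`; `mem n` is the formula `n ∈ I`. -/
inductive CExpr (L : FirstOrder.Language.{0, 0}) : Type
  | term {n : ℕ} (φ : Fm L (n + 1)) (a : Fin n → ℕ)
  | mem (n : ℕ)

/-- The canonical expression belongs to the Skolemized language. -/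
def CExpr.InLang : CExpr L → Prop
  | .term φ _ => φ.Simple ∧ φ.InLang
  | .mem _ => True

def CExpr.IsTerm : CExpr L → Prop
  | .term _ _ => True
  | .mem _ => False

/-- `c_n`, i.e. `c_{∃x ¬B(x,y,I)}(n)`. -/
def cTerm (B : Fm L 2) (n : ℕ) : CExpr L := .term (n := 1) B.neg fun _ => n

/-- The ordinal `Ω`. -/
def Om : Ordinal.{0} := Ordinal.omega 1

open Classical in
/-- The rank of a canonical expression. -/
def rk (B : Fm L 2) : CExpr L → Ordinal.{0}
  | .term (n := n) φ _ =>
      if (⟨n, φ⟩ : Σ m, Fm L (m + 1)) = ⟨1, B.neg⟩ then Om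
      else if φ.HasI then Om + ((φ.simpleRank + 1 : ℕ) : Ordinal) + 1
      else ((φ.simpleRank + 1 : ℕ) : Ordinal)
  | .mem _ => Om

/-- Values: the default symbol `?`, numerals, and `⊤`. -/
inductive Val : Type
  | unk
  | num (k : ℕ)
  | top

/-- Terms take `?` or a positive numeral as value, formulas take `?` or `⊤`. -/
def Val.Fits : Val → CExpr L → Prop
  | .unk, _ => True
  | .num k, .term _ _ => 0 < k
  | .top, .mem _ => True
  | _, _ => False

/-- Partial functions from canonical expressions to values. -/
abbrev Subst (L : FirstOrder.Language.{0, 0}) : Type := CExpr L → Option Val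

/-- The partial function is an `ε`-substitution. -/
def IsSubst (S : Subst L) : Prop := ∀ e u, S e = some u → e.InLang ∧ u.Fits e

/-- The standard extension: everything outside the domain gets the value `?`. -/
def Subst.ext (S : Subst L) : Subst L := fun e => some ((S e).getD .unk)

section Eval

variable [L.Structure ℕ]

open Classical in
/-- The reduction `|t|_S`. -/
def Tm.reduce (S : Subst L) {k : ℕ} : Tm L k → Tm L k
  | .var i => .var i
  | .zero => .zero
  | .succ t => .succ (t.reduce S)
  | .func f ts =>
      if ∀ i, ((ts i).reduce S).numVal.isSome then
        .num (FirstOrder.Language.Structure.funMap f fun i => (((ts i).reduce S).numVal.getD 0 : ℕ))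
      else .func f fun i => (ts i).reduce S
  | .skolem φ ts =>
      if ∀ i, ((ts i).reduce S).numVal.isSome then
        match S (.term φ fun i => ((ts i).reduce S).numVal.getD 0) with
        | some .unk => .zero
        | some (.num m) => .num m
        | _ => .skolem φ fun i => (ts i).reduce S
      else .skolem φ fun i => (ts i).reduce S

/-- `|t|_S` is the numeral of `n`. -/
def Tm.HasVal (S : Subst L) (t : Tm L 0) (n : ℕ) : Prop := (t.reduce S).numVal = some n

/-- The reduction `|φ|_S`. -/
def Fm.reduce (S : Subst L) {k : ℕ} : Fm L k → Fm L k
  | .tru => .tru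
  | .fls => .fls
  | .eq s t => .eq (s.reduce S) (t.reduce S)
  | .rel R ts => .rel R fun i => (ts i).reduce S
  | .mem t =>
      match (t.reduce S).numVal with
      | some n =>
          match S (.mem n) with
          | some .top => .tru
          | some .unk => .fls
          | _ => .mem (t.reduce S)
      | none => .mem (t.reduce S)
  | .neg φ => .neg (φ.reduce S)
  | .and φ ψ => .and (φ.reduce S) (ψ.reduce S)
  | .or φ ψ => .or (φ.reduce S) (ψ.reduce S)

/-- Value of a term of arithmetic in the standard model (only used for Skolem-free terms). -/
def Tm.value {k : ℕ} (ρ : Fin k → ℕ) : Tm L k → ℕ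
  | .var i => ρ i
  | .zero => 0
  | .succ t => t.value ρ + 1
  | .func f ts => FirstOrder.Language.Structure.funMap f fun i => (ts i).value ρ
  | .skolem _ _ => 0

/-- Truth of a formula of arithmetic in the standard model (only used for arithmetical formulas). -/
def Fm.Holds {k : ℕ} (ρ : Fin k → ℕ) : Fm L k → Prop
  | .tru => True
  | .fls => False
  | .eq s t => s.value ρ = t.value ρ
  | .rel R ts => FirstOrder.Language.Structure.RelMap R fun i => ((ts i).value ρ : ℕ)
  | .mem _ => False
  | .neg φ => ¬ φ.Holds ρ
  | .and φ ψ => φ.Holds ρ ∧ ψ.Holds ρ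
  | .or φ ψ => φ.Holds ρ ∨ ψ.Holds ρ

/-- `S ⊨ φ`: the reduction `|φ|_S` is a true sentence of arithmetic. -/
def Models (S : Subst L) (φ : Fm L 0) : Prop :=
  (φ.reduce S).IsArith ∧ (φ.reduce S).Holds Fin.elim0

/-- `S` decides `φ`. -/
def Decides (S : Subst L) (φ : Fm L 0) : Prop := Models S φ ∨ Models S φ.neg

/-- `φ(u, a⃗)` with numerals. -/
def instNum {n : ℕ} (φ : Fm L (n + 1)) (u : ℕ) (a : Fin n → ℕ) : Fm L 0 :=
  φ.inst (.num u) fun i => .num (a i)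

/-- The formula `F(e, u)`. -/
def justif (B : Fm L 2) : CExpr L → Val → Fm L 0
  | .term φ a, .num u =>
      .and (instNum φ u a)
        ((List.range u).foldr (fun v χ => .and (.neg (instNum φ v a)) χ) .tru)
  | .mem n, .top => formA B (.num n)
  | _, _ => .tru

/-- `S` is correct. -/
def Correct (B : Fm L 2) (S : Subst L) : Prop :=
  ∀ e u, S e = some u → Models S.ext (justif B e u)

/-- `S` is computationally inconsistent. -/
def CompInconsistent (B : Fm L 2) (S : Subst L) : Prop :=
  (∃ e u, S e = some u ∧ Models S (justif B e u).neg) ∨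
    ∃ n u, S (cTerm B n) = some (.num u) ∧ S (.mem n) = some .top

open Classical in
/-- The substitution `{(m ∈ I, ⊤) | m ∈ P}`. -/
def substOfList (P : List ℕ) : Subst L
  | .mem m => if m ∈ P then some .top else none
  | .term _ _ => none

/-- A sequence of formulas `n ∈ I` (given by the numbers `n`) is admissible. -/
def Admissible (B : Fm L 2) (P : List ℕ) : Prop :=
  ∀ P₁ n P₂, P = P₁ ++ n :: P₂ →
    Models (substOfList P₁).ext (B.subst ![.zero, .num n])

end Eval

open Classical in
/-- The negative rank `Ω` part `S⁻_{=Ω}`: the pairs `(c_m, u)` with `u ≠ ?` and `(m ∈ I, ?)`. -/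
def negPart (B : Fm L 2) (S : Subst L) : Subst L := fun e =>
  match e, S e with
  | .term φ a, some (.num u) => if rk B (.term φ a) = Om then some (.num u) else none
  | .mem _, some .unk => some .unk
  | _, _ => none

open Classical in
/-- The positive rank `Ω` part `S⁺_{=Ω}`: the pairs `(c_m, ?)` and `(m ∈ I, ⊤)`. -/
def posPart (B : Fm L 2) (S : Subst L) : Subst L := fun e =>
  match e, S e with
  | .term φ a, some .unk => if rk B (.term φ a) = Om then some .unk else none
  | .mem _, some .top => some .top
  | _, _ => none

/-! ## Sequents -/

/-- The data `(S, P, V, F)` of a sequent. The list `P` and the domain of `V` contain `n` for the formula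
`n ∈ I`; in `F`, `true` is `t` and `false` is `f`. -/
structure Sequent (L : FirstOrder.Language.{0, 0}) : Type where
  S : Subst L
  P : List ℕ
  V : ℕ → Option (Subst L)
  F : CExpr L → Option Bool

/-- A possible value of the function `V`: a finite `ε`-substitution consisting of negative
rank `Ω` pairs. -/
def IsHistVal (B : Fm L 2) (W : Subst L) : Prop :=
  IsSubst W ∧ {e | W e ≠ none}.Finite ∧ negPart B W = W

/-- The data form a sequent. -/
structure Sequent.IsSequent (B : Fm L 2) (Θ : Sequent L) : Prop where
  isSubst : IsSubst Θ.S
  nodup : Θ.P.Nodup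
  mem_P : ∀ n, n ∈ Θ.P ↔ Θ.S (.mem n) = some .top
  dom_V : ∀ n, (Θ.V n).isSome ↔ n ∈ Θ.P
  val_V : ∀ n W, Θ.V n = some W → IsHistVal B W
  dom_F : ∀ e, (Θ.F e).isSome ↔ Θ.S e = some .unk ∨ ((Θ.S e).isSome ∧ rk B e = Om)

/-- The empty sequent. -/
def Sequent.empty : Sequent L := ⟨fun _ => none, [], fun _ => none, fun _ => none⟩

open Classical in
/-- `(e, ?, i), Θ`. -/
def Sequent.addUnk (e : CExpr L) (i : Bool) (Θ : Sequent L) : Sequent L :=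
  { Θ with S := Function.update Θ.S e (some .unk), F := Function.update Θ.F e (some i) }

open Classical in
/-- `(e, u), Θ`. -/
def Sequent.addNum (e : CExpr L) (u : ℕ) (Θ : Sequent L) : Sequent L :=
  { Θ with S := Function.update Θ.S e (some (.num u)) }

open Classical in
/-- `(e, u, i), Θ`. -/
def Sequent.addNumF (e : CExpr L) (u : ℕ) (i : Bool) (Θ : Sequent L) : Sequent L :=
  { Θ with S := Function.update Θ.S e (some (.num u)), F := Function.update Θ.F e (some i) }

open Classical in
/-- `(e, ⊤, i, Pₑ, Vₑ), Θ`; here `e` is the last element of `Pₑ`. -/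
def Sequent.addForms (Pe : List ℕ) (Ve : ℕ → Option (Subst L)) (i : Bool) (Θ : Sequent L) :
    Sequent L where
  S := fun x => match x with
    | .mem m => if m ∈ Pe then some .top else Θ.S (.mem m)
    | .term φ a => Θ.S (.term φ a)
  P := Θ.P ++ Pe
  V := fun m => if m ∈ Pe then Ve m else Θ.V m
  F := fun x => match x with
    | .mem m => if m ∈ Pe then some i else Θ.F (.mem m)
    | .term φ a => Θ.F (.term φ a)

/-! ## The `H`-step -/

open Classical in
/-- The substitution part of `H(Θ)`, when `e` is the `H`-expression and `v` the `H`-value. -/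
def hSubst (B : Fm L 2) (Θ : Sequent L) (e : CExpr L) (v : Val) : Subst L := fun x =>
  if x = e then some v
  else if rk B e ≠ Om then (if rk B x ≤ rk B e then Θ.S x else none)
  else if rk B x < Om then Θ.S x
  else match e with
    | .mem _ => posPart B Θ.S x
    | .term (n := k) _ a =>
        if h : k = 1 then
          let n := a ⟨0, by omega⟩
          let P' := Θ.P.takeWhile (· ≠ n)
          if ∃ m ∈ P', x = .mem m then some .top
          else if ∃ m ∈ P', x = cTerm B m ∧ Θ.S x = some .unk then some .unk
          else if n ∈ Θ.P then (Θ.V n).bind (fun W => W x)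
          else negPart B Θ.S x
        else none

open Classical in
/-- The sequence part of `H(Θ)`. -/
def hSeq (B : Fm L 2) (Θ : Sequent L) (e : CExpr L) : List ℕ :=
  if rk B e < Om then []
  else if Om < rk B e then Θ.P
  else match e with
    | .mem n => Θ.P ++ [n]
    | .term (n := k) _ a => if h : k = 1 then Θ.P.takeWhile (· ≠ a ⟨0, by omega⟩) else []

open Classical in
/-- The history part of `H(Θ)`. -/
def hHist (B : Fm L 2) (Θ : Sequent L) (e : CExpr L) : ℕ → Option (Subst L) := fun m =>
  if e = .mem m then some (negPart B Θ.S)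
  else if m ∈ hSeq B Θ e then Θ.V m
  else none

open Classical in
/-- `H(Θ)`, when `e` is the `H`-expression and `v` the `H`-value. -/
def hStep (B : Fm L 2) (Θ : Sequent L) (e : CExpr L) (v : Val) : Sequent L where
  S := hSubst B Θ e v
  P := hSeq B Θ e
  V := hHist B Θ e
  F := fun x =>
    if hSubst B Θ e v x = some .unk ∨ ((hSubst B Θ e v x).isSome ∧ rk B x = Om) then
      (if (Θ.S x).isSome then Θ.F x else some true)
    else none

/-- `x` is active at `Θ`, when `e` is the `H`-expression and `v` the `H`-value. -/
def Active (B : Fm L 2) (Θ : Sequent L) (e : CExpr L) (v : Val) (x : CExpr L) : Prop :=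
  (Θ.S x).isSome ∧ rk B x = rk B e ∧ hSubst B Θ e v x ≠ Θ.S x

section Deductions

variable [L.Structure ℕ]

/-- `(e, v)` is the pair proposed by an unsatisfied critical formula, every value used for it being
computed in `S`. -/
inductive CritPair (B : Fm L 2) (S : Subst L) (P : List ℕ) : Crit L → CExpr L → Val → Prop
  | pred {s : Tm L 0} {k : ℕ} (hs : s.HasVal S k) :
      CritPair B S P (.pred s) (.term predFm fun _ => k) (.num (k - 1))
  | epsilon {n : ℕ} {φ : Fm L (n + 1)} {t : Tm L 0} {ts : Fin n → Tm L 0} {k : ℕ} {a : Fin n → ℕ}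
      (ht : t.HasVal S k) (hts : ∀ i, (ts i).HasVal S (a i)) :
      CritPair B S P (.epsilon φ t ts) (.term φ a) (.num k)
  | induction {n : ℕ} {φ : Fm L (n + 1)} {t : Tm L 0} {ts : Fin n → Tm L 0} {k m : ℕ}
      {a : Fin n → ℕ} (ht : t.HasVal S k) (hts : ∀ i, (ts i).HasVal S (a i)) (hm : m < k)
      (hφ : Models S ((indFm φ).inst (.num m) ts))
      (hmin : ∀ j < m, Models S ((indFm φ).inst (.num j) ts).neg) :
      CritPair B S P (.induction φ t ts) (.term (indFm φ) a) (.num m)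
  | inductiveDef {t : Tm L 0} {n : ℕ} (ht : t.HasVal S n) :
      CritPair B S P (.inductiveDef t) (.mem n) .top
  /-- `n ∈ I` is the first formula of `P` for which `φ` fails, and `A(n, φ)` fails. -/
  | closureNeg {k : ℕ} {φ : Fm L (k + 1)} {ts : Fin k → Tm L 0} {a : Fin k → ℕ} {n v : ℕ}
      {P₁ P₂ : List ℕ} (hts : ∀ i, (ts i).HasVal S (a i)) (hP : P = P₁ ++ n :: P₂)
      (hn : Models S (φ.inst (.num n) ts).neg) (hP₁ : ∀ m ∈ P₁, Models S (φ.inst (.num m) ts))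
      (hA : Models S (formAOf B φ (.num n) ts).neg)
      (hv : S (.term (n := k + 1) (instB B φ).neg (Fin.cons n a)) = some (.num v)) :
      CritPair B S P (.closure φ ts) (cTerm B n) (.num v)
  /-- `n ∈ I` is the first formula of `P` for which `φ` fails, and `A(n, φ)` holds. -/
  | closurePos {k : ℕ} {φ : Fm L (k + 1)} {ts : Fin k → Tm L 0} {a : Fin k → ℕ} {n : ℕ}
      {P₁ P₂ : List ℕ} (hts : ∀ i, (ts i).HasVal S (a i)) (hP : P = P₁ ++ n :: P₂)
      (hn : Models S (φ.inst (.num n) ts).neg) (hP₁ : ∀ m ∈ P₁, Models S (φ.inst (.num m) ts))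
      (hA : Models S (formAOf B φ (.num n) ts)) :
      CritPair B S P (.closure φ ts) (.term (progFm B φ).neg a) (.num n)

/-- `(e, v)` is the pair of the critical formula selected for `(S, P)`: among the unsatisfied critical
formulas it has an expression of least rank, and it comes first among those. -/
def Selected (B : Fm L 2) (Cr : List (Crit L)) (S : Subst L) (P : List ℕ) (e : CExpr L) (v : Val) :
    Prop :=
  ∃ i : Fin Cr.length, Models S ((Cr.get i).fm B).neg ∧ CritPair B S P (Cr.get i) e v ∧
    ∀ (j : Fin Cr.length) (e' : CExpr L) (v' : Val), Models S ((Cr.get j).fm B).neg →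
      CritPair B S P (Cr.get j) e' v' → rk B e < rk B e' ∨ (rk B e = rk B e' ∧ i ≤ j)

/-- The `H`-step applies to `Θ`, with `H`-expression `e` and `H`-value `v`: `S` is correct and
nonsolving, and all the calculations in the computation of `H(Θ)` take place in `S`. -/
structure HApplies (B : Fm L 2) (Cr : List (Crit L)) (Θ : Sequent L) (e : CExpr L) (v : Val) :
    Prop where
  correct : Correct B Θ.S
  /-- `S` evaluates all critical formulas. -/
  decides_crit : ∀ c ∈ Cr, Decides Θ.S (c.fm B)
  /-- The pairs of all unsatisfied critical formulas are computed in `S`. -/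
  computes : ∀ c ∈ Cr, Models Θ.S (c.fm B).neg → ∃ e' v', CritPair B Θ.S Θ.P c e' v'
  /-- In particular some critical formula is unsatisfied. -/
  selected : Selected B Cr Θ.S Θ.P e v
  /-- The conditions `F(e', u)` on the values of terms in `S`, and on the new pair, are evaluated
  in `S`. -/
  decides_justif : ∀ e' u, e'.IsTerm → Θ.S e' = some u → Decides Θ.S (justif B e' u)
  decides_new : Decides Θ.S (justif B e v)
  /-- The value to be changed is present in `S`. -/
  unk : Θ.S e = some .unk
  mem_dom : ∀ n, e = cTerm B n → (Θ.S (.mem n)).isSome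
  cTerm_dom : ∀ n, e = .mem n → (Θ.S (cTerm B n)).isSome
  mem_dom_of_unk : e.IsTerm → rk B e = Om →
    ∀ n, Θ.S (cTerm B n) = some .unk → (Θ.S (.mem n)).isSome

/-- `AxF`. -/
def AxF (B : Fm L 2) (Θ : Sequent L) : Prop := CompInconsistent B Θ.S

/-- `AxS`: `S` is solving, every critical formula being evaluated in `S`. -/
def AxS (B : Fm L 2) (Cr : List (Crit L)) (Θ : Sequent L) : Prop := ∀ c ∈ Cr, Models Θ.S (c.fm B)

/-- `AxH_{e,v}`. -/
def AxH (B : Fm L 2) (Cr : List (Crit L)) (e : CExpr L) (v : Val) (Θ : Sequent L) : Prop :=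
  HApplies B Cr Θ e v ∧ ∃ x, Active B Θ e v x ∧ Θ.F x = some false

/-- `Θ` is an axiom. -/
def IsAxiom (B : Fm L 2) (Cr : List (Crit L)) (Θ : Sequent L) : Prop :=
  AxF B Θ ∨ AxS B Cr Θ ∨ ∃ e v, AxH B Cr e v Θ

/-- `Pₑ` is proper for `n ∈ I` and `Θ`. -/
structure Proper (B : Fm L 2) (n : ℕ) (Θ : Sequent L) (Pe : List ℕ) : Prop where
  nodup : Pe.Nodup
  unk : ∀ m ∈ Pe, ∀ u, Θ.S (cTerm B m) = some u → u = .unk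
  admissible : Admissible B (Θ.P ++ Pe)
  last : Pe.getLast? = some n
  disjoint : ∀ m ∈ Pe, m ∉ Θ.P
  /-- No formula of `Pₑ` has a value in `Θ` yet. -/
  fresh : ∀ m ∈ Pe, Θ.S (.mem m) = none

/-- `Vₑ` is a history with domain `Pₑ`. -/
def IsHist (B : Fm L 2) (Pe : List ℕ) (Ve : ℕ → Option (Subst L)) : Prop :=
  (∀ m, (Ve m).isSome ↔ m ∈ Pe) ∧ ∀ m W, Ve m = some W → IsHistVal B W

/-- The inference rules, with their main expressions. -/
inductive Rule (L : FirstOrder.Language.{0, 0}) : Type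
  | cut (e : CExpr L)
  | cutFr (e : CExpr L)
  | cutTerm (e : CExpr L)
  | cutFrTerm (e : CExpr L)
  | cutForm (n : ℕ)
  | fr (e : CExpr L)
  | h (e : CExpr L) (v : Val)

/-- The names `Cut`, `CutFr`, `Fr`, `H`. -/
inductive RuleName : Type
  | Cut
  | CutFr
  | Fr
  | H

/-- The rules `Cut`, `Cut^{Ω,term}`, `Cut^{Ω,form}` count as `Cut`, and `CutFr`, `CutFr^{Ω,term}`
as `CutFr`. -/
def Rule.name : Rule L → RuleName
  | .cut _ => .Cut
  | .cutFr _ => .CutFr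
  | .cutTerm _ => .Cut
  | .cutFrTerm _ => .CutFr
  | .cutForm _ => .Cut
  | .fr _ => .Fr
  | .h _ _ => .H

/-- The main expression. -/
def Rule.main : Rule L → CExpr L
  | .cut e => e
  | .cutFr e => e
  | .cutTerm e => e
  | .cutFrTerm e => e
  | .cutForm n => .mem n
  | .fr e => e
  | .h e _ => e

/-- `Θ` is a possible conclusion of the rule. -/
def Rule.Applies (B : Fm L 2) (Cr : List (Crit L)) : Rule L → Sequent L → Prop
  | .cut e, Θ => e.IsTerm ∧ e.InLang ∧ rk B e ≠ Om ∧ Θ.S e = none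
  | .cutFr e, Θ => e.IsTerm ∧ e.InLang ∧ rk B e ≠ Om ∧ Θ.S e = none
  | .cutTerm e, Θ => e.IsTerm ∧ e.InLang ∧ rk B e = Om ∧ Θ.S e = none
  | .cutFrTerm e, Θ => e.IsTerm ∧ e.InLang ∧ rk B e = Om ∧ Θ.S e = none
  | .cutForm n, Θ => Θ.S (.mem n) = none
  | .fr e, Θ => e.InLang ∧ Θ.S e = none
  | .h e v, Θ => HApplies B Cr Θ e v ∧ Θ.F e = some true ∧
      ∀ x, Active B Θ e v x → Θ.F x = some true

/-- The premises of the rule with conclusion `Θ`. -/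
def Rule.premises (B : Fm L 2) : Rule L → Sequent L → Set (Sequent L)
  | .cut e, Θ => {Θ' | Θ' = Θ.addUnk e false ∨ ∃ u, 0 < u ∧ Θ' = Θ.addNum e u}
  | .cutFr e, Θ => {Θ' | Θ' = Θ.addUnk e true ∨ ∃ u, 0 < u ∧ Θ' = Θ.addNum e u}
  | .cutTerm e, Θ => {Θ' | Θ' = Θ.addUnk e false ∨ ∃ u, 0 < u ∧ Θ' = Θ.addNumF e u false}
  | .cutFrTerm e, Θ => {Θ' | Θ' = Θ.addUnk e true ∨ ∃ u, 0 < u ∧ Θ' = Θ.addNumF e u false}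
  | .cutForm n, Θ => {Θ' | Θ' = Θ.addUnk (.mem n) false ∨
      ∃ Pe Ve, Proper B n Θ Pe ∧ IsHist B Pe Ve ∧ Θ' = Θ.addForms Pe Ve false}
  | .fr e, Θ => {Θ.addUnk e true}
  | .h e v, Θ => {hStep B Θ e v}

/-- Deductions of a sequent from a set `𝒮` of sequents: well-founded trees built from elements of
`𝒮`, axioms and inferences. -/
inductive Deduction (B : Fm L 2) (Cr : List (Crit L)) (𝒮 : Set (Sequent L)) : Sequent L → Type
  | leaf (Θ : Sequent L) (hΘ : Θ.IsSequent B) (h : Θ ∈ 𝒮) : Deduction B Cr 𝒮 Θ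
  | ax (Θ : Sequent L) (hΘ : Θ.IsSequent B) (h : IsAxiom B Cr Θ) : Deduction B Cr 𝒮 Θ
  | infer (Θ : Sequent L) (hΘ : Θ.IsSequent B) (R : Rule L) (h : R.Applies B Cr Θ)
      (ds : ∀ Θ', Θ' ∈ R.premises B Θ → Deduction B Cr 𝒮 Θ') : Deduction B Cr 𝒮 Θ

/-- A derivation is a deduction from the empty set. -/
abbrev Derivation (B : Fm L 2) (Cr : List (Crit L)) (Θ : Sequent L) : Type := Deduction B Cr ∅ Θ

variable {B : Fm L 2} {Cr : List (Crit L)} {𝒮 : Set (Sequent L)}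

/-- The set of rules applied in the deduction. -/
def Deduction.rules {Θ : Sequent L} : Deduction B Cr 𝒮 Θ → Set (Rule L)
  | .leaf _ _ _ => ∅
  | .ax _ _ _ => ∅
  | .infer Θ _ R _ ds => {R} ∪ ⋃ (Θ') (h : Θ' ∈ R.premises B Θ), (ds Θ' h).rules

/-- `d` is an `r`-deduction: `Cut(d) < r`, `CutFr(d) < 0`, `Fr(d) ≥ r` and `H(d) ≥ r`. -/
def Deduction.IsR {Θ : Sequent L} (d : Deduction B Cr 𝒮 Θ) (r : Ordinal.{0}) : Prop :=
  ∀ R ∈ d.rules, match R.name with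
    | .Cut => rk B R.main < r
    | .CutFr => rk B R.main < 0
    | .Fr => r ≤ rk B R.main
    | .H => r ≤ rk B R.main

/-- `d` is an `r⁺`-deduction: `Cut(d) < r`, `CutFr(d) = r`, `Fr(d) > r` and `H(d) ≥ r`. -/
def Deduction.IsRPlus {Θ : Sequent L} (d : Deduction B Cr 𝒮 Θ) (r : Ordinal.{0}) : Prop :=
  ∀ R ∈ d.rules, match R.name with
    | .Cut => rk B R.main < r
    | .CutFr => rk B R.main = r
    | .Fr => r < rk B R.main
    | .H => r ≤ rk B R.main

/-- The list of sequents is a path in the deduction, from its root upwards. -/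
def Deduction.IsPath {Θ : Sequent L} : Deduction B Cr 𝒮 Θ → List (Sequent L) → Prop
  | .leaf Θ _ _, l => l = [Θ]
  | .ax Θ _ _, l => l = [Θ]
  | .infer Θ _ R _ ds, l => l = [Θ] ∨
      ∃ (Θ' : Sequent L) (h : Θ' ∈ R.premises B Θ) (l' : List (Sequent L)),
        l = Θ :: l' ∧ (ds Θ' h).IsPath l'

/-- An `r`-path: a sequence of sequents starting with the empty one that is a path in some
`r`-deduction. -/
def IsRPath (B : Fm L 2) (Cr : List (Crit L)) (r : Ordinal.{0}) (l : List (Sequent L)) : Prop :=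
  ∃ (𝒮 : Set (Sequent L)) (d : Deduction B Cr 𝒮 Sequent.empty), d.IsR r ∧ d.IsPath l

/-- `Θ` has an `r`-path: some `r`-path ends in `Θ`. -/
def HasRPath (B : Fm L 2) (Cr : List (Crit L)) (r : Ordinal.{0}) (Θ : Sequent L) : Prop :=
  ∃ l, IsRPath B Cr r l ∧ l.getLast? = some Θ

/-- Replace a `CutFr` rule by `Fr`. -/
def Rule.prune : Rule L → Rule L
  | .cutFr e => .fr e
  | .cutFrTerm e => .fr e
  | R => R

theorem Rule.Applies.prune {R : Rule L} {Θ : Sequent L} (h : R.Applies B Cr Θ) :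
    R.prune.Applies B Cr Θ := by
  cases R with
  | cutFr e => exact ⟨h.2.1, h.2.2.2⟩
  | cutFrTerm e => exact ⟨h.2.1, h.2.2.2⟩
  | _ => exact h

theorem Rule.premises_prune {R : Rule L} {Θ Θ' : Sequent L} (h : Θ' ∈ R.prune.premises B Θ) :
    Θ' ∈ R.premises B Θ := by
  cases R with
  | cutFr e => exact Or.inl h
  | cutFrTerm e => exact Or.inl h
  | _ => exact h

/-- Prune every `CutFr` inference to an `Fr` inference, keeping only the branch of `(e, ?, t)`. -/
def Deduction.prune {Θ : Sequent L} : Deduction B Cr 𝒮 Θ → Deduction B Cr 𝒮 Θ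
  | .leaf Θ hΘ h => .leaf Θ hΘ h
  | .ax Θ hΘ h => .ax Θ hΘ h
  | .infer Θ hΘ R h ds =>
      .infer Θ hΘ R.prune h.prune fun Θ' h' => (ds Θ' (Rule.premises_prune h')).prune

end Deductions

end EpsID1

end

open EpsID1

noncomputable section

namespace EpsID1

variable {L : FirstOrder.Language.{0, 0}}

/-! ## Evaluation -/

-- Let `r ≠ Ω`. An `(r+1)`-derivation breaks the bounds of an `r⁺`-derivation only through its
-- `Cut`s of rank exactly `r`. By induction the matter reduces to one such cut on a term `e`, with
-- `r⁺`-derivations of `(e, ?, f), Θ` and of all `(e, u), Θ` at hand. The cut is to become a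
-- `CutFr`, which asks for a derivation of `(e, ?, t), Θ`; this is `Der.unfreeze`. In the derivation
-- of `(e, ?, f), Θ` the flag of `e` is switched to `t` throughout. All axioms and inferences
-- survive, except an `AxH` at a sequent `Ξ` whose `H`-expression is `e`. As `rk e ≠ Ω`, the
-- expression `e` is the only active one there, so with flag `t` the rule `H` applies instead, and
-- its premise `K = H(Ξ)` has to be derived.
--
-- `K` has no expression of rank above `r`, contains the part of `Θ` of rank `≤ r`, and gives `e` a
-- positive value `v`. It is derived from the premise `(e, v), Θ` of the original cut. By
-- `Der.weaken`, justified values of rank `≤ r` may be added, which yields `combine B r K Θ`, that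
-- is, `Θ` with its part of rank `≤ r` replaced by `K`. By `Reach.der_kernel` one can then descend
-- the `(r+1)`-path of `Θ`: its `Cut`s have rank `≤ r` and are overwritten by `K`, while its `Fr`
-- and `H` steps have rank `> r` and are repeated as inferences over the low part `K`. At the empty
-- sequent only `K` is left.
--
-- Both moves need that an `H`-step applicable to a sequent stays applicable after low values have
-- been added (`HApplies.wk`). Completed calculations persist in extensions, and the pair of a
-- critical formula is unique, so the same pair is selected. Correctness of the new values has two
-- sources. For terms it is part of the relation `Wk`, and it outlives `H`-steps of rank `≥ r`
-- because `F(x, u)` is evaluated below rank `r` (`reduce_justif_congr`, which uses `r ≠ Ω`). For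
-- formulas `n ∈ I` it follows from admissibility of `P` and positivity of `B`
-- (`Admissible.models_formA`).

/-- Inclusion of partial functions. -/
def Subst.Le (S S' : Subst L) : Prop := ∀ e u, S e = some u → S' e = some u

theorem Subst.le_ext (S : Subst L) : S.Le S.ext := fun e u h => by simp [Subst.ext, h]

theorem Subst.Le.ne_none {S S' : Subst L} (h : S.Le S') {e : CExpr L} (he : (S e).isSome) :
    (S' e).isSome := by
  obtain ⟨u, hu⟩ := Option.isSome_iff_exists.1 he
  simp [h e u hu]

@[simp] theorem Tm.numVal_num {k : ℕ} (n : ℕ) : (Tm.num n : Tm L k).numVal = some n := by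
  induction n with
  | zero => rfl
  | succ n ih => simp [Tm.num, Tm.numVal, ih]

theorem Tm.eq_num_of_numVal {k : ℕ} : ∀ {t : Tm L k} {n : ℕ}, t.numVal = some n → t = .num n
  | .zero, n, h => by
      simp only [Tm.numVal, Option.some.injEq] at h
      subst h; rfl
  | .succ t, n, h => by
      simp only [Tm.numVal, Option.map_eq_some_iff] at h
      obtain ⟨m, hm, rfl⟩ := h
      rw [Tm.eq_num_of_numVal hm]; rfl
  | .var _, _, h => by simp [Tm.numVal] at h
  | .func _ _, _, h => by simp [Tm.numVal] at h
  | .skolem _ _, _, h => by simp [Tm.numVal] at h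

theorem Tm.subst_subst {k m l : ℕ} (σ : Fin k → Tm L m) (τ : Fin m → Tm L l) :
    ∀ t : Tm L k, (t.subst σ).subst τ = t.subst fun i => (σ i).subst τ
  | .var _ => rfl
  | .zero => rfl
  | .succ t => by simp only [Tm.subst, Tm.subst_subst σ τ t]
  | .func f ts => by
      simp only [Tm.subst]
      congr 1; funext i; exact Tm.subst_subst σ τ (ts i)
  | .skolem φ ts => by
      simp only [Tm.subst]
      congr 1; funext i; exact Tm.subst_subst σ τ (ts i)

theorem Fm.subst_subst {k m l : ℕ} (σ : Fin k → Tm L m) (τ : Fin m → Tm L l) :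
    ∀ φ : Fm L k, (φ.subst σ).subst τ = φ.subst fun i => (σ i).subst τ
  | .tru => rfl
  | .fls => rfl
  | .eq s t => by simp only [Fm.subst, Tm.subst_subst]
  | .rel R ts => by simp only [Fm.subst, Tm.subst_subst]
  | .mem t => by simp only [Fm.subst, Tm.subst_subst]
  | .neg φ => by simp only [Fm.subst, Fm.subst_subst σ τ φ]
  | .and φ ψ => by simp only [Fm.subst, Fm.subst_subst σ τ φ, Fm.subst_subst σ τ ψ]
  | .or φ ψ => by simp only [Fm.subst, Fm.subst_subst σ τ φ, Fm.subst_subst σ τ ψ]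

theorem Tm.simpleRank_of_skolemFree {k : ℕ} : ∀ t : Tm L k, t.SkolemFree → t.simpleRank = 0
  | .var _, _ => by simp [Tm.simpleRank]
  | .zero, _ => by simp [Tm.simpleRank]
  | .succ t, h => by
      simp only [Tm.SkolemFree] at h
      simp [Tm.simpleRank, Tm.simpleRank_of_skolemFree t h]
  | .func f ts, h => by
      simp only [Tm.SkolemFree] at h
      simp only [Tm.simpleRank]
      exact Nat.le_zero.1 (Finset.sup_le fun i _ => (Tm.simpleRank_of_skolemFree _ (h i)).le)
  | .skolem _ _, h => by simp [Tm.SkolemFree] at h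

theorem Fm.simpleRank_of_skolemFree {k : ℕ} : ∀ φ : Fm L k, φ.SkolemFree → φ.simpleRank = 0
  | .tru, _ => by simp [Fm.simpleRank]
  | .fls, _ => by simp [Fm.simpleRank]
  | .eq s t, h => by
      simp [Fm.simpleRank, Tm.simpleRank_of_skolemFree _ h.1, Tm.simpleRank_of_skolemFree _ h.2]
  | .rel R ts, h => by
      simp only [Fm.simpleRank]
      exact Nat.le_zero.1 (Finset.sup_le fun i _ => (Tm.simpleRank_of_skolemFree _ (h i)).le)
  | .mem t, h => by
      simp only [Fm.SkolemFree] at h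
      simp [Fm.simpleRank, Tm.simpleRank_of_skolemFree _ h]
  | .neg φ, h => by
      simp only [Fm.SkolemFree] at h
      simp [Fm.simpleRank, Fm.simpleRank_of_skolemFree φ h]
  | .and φ ψ, h => by
      simp [Fm.simpleRank, Fm.simpleRank_of_skolemFree φ h.1, Fm.simpleRank_of_skolemFree ψ h.2]
  | .or φ ψ, h => by
      simp [Fm.simpleRank, Fm.simpleRank_of_skolemFree φ h.1, Fm.simpleRank_of_skolemFree ψ h.2]

section Eval

variable [L.Structure ℕ]

@[simp] theorem Tm.reduce_num (S : Subst L) {k : ℕ} (n : ℕ) :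
    (Tm.num n : Tm L k).reduce S = .num n := by
  induction n with
  | zero => rfl
  | succ n ih => simp [Tm.num, Tm.reduce, ih]

/-- A reduction that ends in a numeral has only consulted values present in `S`, and an extension
returns the same values. -/
theorem Tm.reduce_mono {S S' : Subst L} (hS : S.Le S') {k : ℕ} :
    ∀ t : Tm L k, (t.reduce S).numVal.isSome → t.reduce S' = t.reduce S
  | .var _, _ => rfl
  | .zero, _ => rfl
  | .succ t, h => by
      simp only [Tm.reduce, Tm.numVal, Option.isSome_map] at h ⊢
      rw [Tm.reduce_mono hS t h]
  | .func f ts, h => by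
      by_cases hts : ∀ i, ((ts i).reduce S).numVal.isSome
      · have := fun i => Tm.reduce_mono hS (ts i) (hts i)
        simp only [Tm.reduce, this]
      · simp [Tm.reduce, hts, Tm.numVal] at h
  | .skolem φ ts, h => by
      by_cases hts : ∀ i, ((ts i).reduce S).numVal.isSome
      · have := fun i => Tm.reduce_mono hS (ts i) (hts i)
        simp only [Tm.reduce, this]
        simp only [Tm.reduce, if_pos hts] at h ⊢
        cases hv : S (.term φ fun i => ((ts i).reduce S).numVal.getD 0) with
        | none => simp [hv, Tm.numVal] at h
        | some u => rw [hS _ _ hv]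
      · simp [Tm.reduce, hts, Tm.numVal] at h

/-- Function symbols with numeral arguments are always evaluated, so without variables only Skolem
functions can block a reduction. This turns `IsArith` into the hypothesis of `Tm.reduce_mono`. -/
theorem Tm.reduce_isSome_of_skolemFree {S : Subst L} {k : ℕ} (hk : Fin k → False) :
    ∀ t : Tm L k, (t.reduce S).SkolemFree → (t.reduce S).numVal.isSome
  | .var i, _ => (hk i).elim
  | .zero, _ => rfl
  | .succ t, h => by
      simp only [Tm.reduce, Tm.SkolemFree] at h
      simpa [Tm.reduce, Tm.numVal] using Tm.reduce_isSome_of_skolemFree hk t h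
  | .func f ts, h => by
      by_cases hts : ∀ i, ((ts i).reduce S).numVal.isSome
      · simp [Tm.reduce, hts]
      · simp only [Tm.reduce, hts, if_false, Tm.SkolemFree] at h
        exact absurd (fun i => Tm.reduce_isSome_of_skolemFree hk (ts i) (h i)) hts
  | .skolem φ ts, h => by
      by_cases hts : ∀ i, ((ts i).reduce S).numVal.isSome
      · simp only [Tm.reduce, if_pos hts] at h ⊢
        revert h
        split <;> simp [Tm.SkolemFree, Tm.numVal]
      · simp [Tm.reduce, hts, Tm.SkolemFree] at h

theorem Fm.reduce_mono {S S' : Subst L} (hS : S.Le S') :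
    ∀ φ : Fm L 0, (φ.reduce S).IsArith → φ.reduce S' = φ.reduce S
  | .tru, _ => rfl
  | .fls, _ => rfl
  | .eq s t, h => by
      simp only [Fm.reduce, Fm.IsArith] at h ⊢
      rw [Tm.reduce_mono hS s (Tm.reduce_isSome_of_skolemFree Fin.elim0 s h.1),
        Tm.reduce_mono hS t (Tm.reduce_isSome_of_skolemFree Fin.elim0 t h.2)]
  | .rel R ts, h => by
      simp only [Fm.reduce, Fm.IsArith] at h ⊢
      congr 1; funext i
      exact Tm.reduce_mono hS _ (Tm.reduce_isSome_of_skolemFree Fin.elim0 _ (h i))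
  | .mem t, h => by
      cases hn : (t.reduce S).numVal with
      | none => simp [Fm.reduce, hn, Fm.IsArith] at h
      | some n =>
        simp only [Fm.reduce, hn, Tm.reduce_mono hS t (by simp [hn])] at h ⊢
        cases hv : S (.mem n) with
        | none => simp [hv, Fm.IsArith] at h
        | some u => rw [hS _ _ hv]
  | .neg φ, h => by
      simp only [Fm.reduce, Fm.IsArith] at h ⊢
      rw [Fm.reduce_mono hS φ h]
  | .and φ ψ, h => by
      simp only [Fm.reduce, Fm.IsArith] at h ⊢
      rw [Fm.reduce_mono hS φ h.1, Fm.reduce_mono hS ψ h.2]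
  | .or φ ψ, h => by
      simp only [Fm.reduce, Fm.IsArith] at h ⊢
      rw [Fm.reduce_mono hS φ h.1, Fm.reduce_mono hS ψ h.2]

theorem Models.mono {S S' : Subst L} (hS : S.Le S') {φ : Fm L 0} (h : Models S φ) :
    Models S' φ := by
  unfold Models
  rwa [Fm.reduce_mono hS φ h.1]

theorem models_neg_iff {S : Subst L} {φ : Fm L 0} :
    Models S φ.neg ↔ (φ.reduce S).IsArith ∧ ¬ (φ.reduce S).Holds Fin.elim0 := Iff.rfl

theorem Models.not_neg {S : Subst L} {φ : Fm L 0} (h : Models S φ) : ¬ Models S φ.neg :=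
  fun h' => (models_neg_iff.1 h').2 h.2

theorem decides_iff {S : Subst L} {φ : Fm L 0} : Decides S φ ↔ (φ.reduce S).IsArith := by
  simp only [Decides, Models]
  tauto

theorem Models.decides {S : Subst L} {φ : Fm L 0} (h : Models S φ) : Decides S φ := Or.inl h

theorem Decides.mono {S S' : Subst L} (hS : S.Le S') {φ : Fm L 0} (h : Decides S φ) :
    Decides S' φ := h.imp (Models.mono hS) (Models.mono hS)

/-- Were `S` to model the negation, so would the extension `S'`. This brings correctness, stated for
`S.ext`, back to `S` itself. -/
theorem Decides.models_of_le {S S' : Subst L} (hS : S.Le S') {φ : Fm L 0} (h : Decides S φ)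
    (h' : Models S' φ) : Models S φ :=
  h.resolve_right fun hn => h'.not_neg (hn.mono hS)

theorem Tm.HasVal.mono {S S' : Subst L} (hS : S.Le S') {t : Tm L 0} {n : ℕ} (h : t.HasVal S n) :
    t.HasVal S' n := by
  unfold Tm.HasVal at h ⊢
  rw [Tm.reduce_mono hS t (by simp [h]), h]

theorem Tm.HasVal.unique {S : Subst L} {t : Tm L 0} {m n : ℕ} (hm : t.HasVal S m)
    (hn : t.HasVal S n) : m = n := Option.some.inj (hm.symm.trans hn)

theorem Tm.HasVal.reduce_eq {S : Subst L} {t : Tm L 0} {n : ℕ} (h : t.HasVal S n) :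
    t.reduce S = .num n := Tm.eq_num_of_numVal h

/-- The reduction of `t(σ)` depends only on the reductions of the terms `σᵢ` and on the values of the
Skolem functions of simple rank at most that of `t`. -/
theorem Tm.reduce_subst_congr {S S' : Subst L} {N : ℕ} {b : Prop}
    (hsk : ∀ (n : ℕ) (ψ : Fm L (n + 1)) (a : Fin n → ℕ), ψ.simpleRank < N → (ψ.HasI → b) →
      S (.term ψ a) = S' (.term ψ a)) {k m : ℕ} {σ σ' : Fin k → Tm L m}
    (hσ : ∀ i, (σ i).reduce S = (σ' i).reduce S') :
    ∀ t : Tm L k, t.simpleRank ≤ N → (t.HasI → b) →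
      (t.subst σ).reduce S = (t.subst σ').reduce S'
  | .var i, _, _ => hσ i
  | .zero, _, _ => rfl
  | .succ t, h, hI => by
      simp only [Tm.simpleRank, Tm.HasI] at h hI
      simp only [Tm.subst, Tm.reduce, Tm.reduce_subst_congr hsk hσ t h hI]
  | .func f ts, h, hI => by
      simp only [Tm.simpleRank, Tm.HasI] at h hI
      have := fun i => Tm.reduce_subst_congr hsk hσ (ts i)
        ((Finset.le_sup (f := fun i => (ts i).simpleRank) (Finset.mem_univ i)).trans h)
        (fun h => hI ⟨i, h⟩)
      simp only [Tm.subst, Tm.reduce, this]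
  | .skolem φ ts, h, hI => by
      simp only [Tm.simpleRank, Tm.HasI, max_le_iff] at h hI
      have := fun i => Tm.reduce_subst_congr hsk hσ (ts i)
        ((Finset.le_sup (f := fun i => (ts i).simpleRank) (Finset.mem_univ i)).trans h.2)
        (fun h => hI (Or.inr ⟨i, h⟩))
      have h2 := fun a => hsk _ φ a h.1 (fun h => hI (Or.inl h))
      simp only [Tm.subst, Tm.reduce, this, h2]

/-- The proposition `b` tells whether `I` is allowed to occur; if it is false, nothing is required
of the formulas `n ∈ I` or of Skolem functions involving `I`, so one lemma serves ranks below and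
above `Ω`. The bound `ψ.simpleRank < N` may be strict because a Skolem function has simple rank
above that of its formula. -/
theorem Fm.reduce_subst_congr {S S' : Subst L} {N : ℕ} {b : Prop}
    (hsk : ∀ (n : ℕ) (ψ : Fm L (n + 1)) (a : Fin n → ℕ), ψ.simpleRank < N → (ψ.HasI → b) →
      S (.term ψ a) = S' (.term ψ a)) (hmem : b → ∀ n, S (.mem n) = S' (.mem n))
    {k m : ℕ} {σ σ' : Fin k → Tm L m} (hσ : ∀ i, (σ i).reduce S = (σ' i).reduce S') :
    ∀ φ : Fm L k, φ.simpleRank ≤ N → (φ.HasI → b) →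
      (φ.subst σ).reduce S = (φ.subst σ').reduce S'
  | .tru, _, _ => rfl
  | .fls, _, _ => rfl
  | .eq s t, h, hI => by
      simp only [Fm.simpleRank, Fm.HasI, max_le_iff] at h hI
      simp only [Fm.subst, Fm.reduce,
        Tm.reduce_subst_congr hsk hσ s h.1 (fun h => hI (Or.inl h)),
        Tm.reduce_subst_congr hsk hσ t h.2 (fun h => hI (Or.inr h))]
  | .rel R ts, h, hI => by
      simp only [Fm.simpleRank, Fm.HasI] at h hI
      have := fun i => Tm.reduce_subst_congr hsk hσ (ts i)
        ((Finset.le_sup (f := fun i => (ts i).simpleRank) (Finset.mem_univ i)).trans h)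
        (fun h => hI ⟨i, h⟩)
      simp only [Fm.subst, Fm.reduce, this]
  | .mem t, h, hI => by
      have hb : b := hI (by simp [Fm.HasI])
      simp only [Fm.simpleRank] at h
      simp only [Fm.subst, Fm.reduce, Tm.reduce_subst_congr hsk hσ t h (fun _ => hb), hmem hb]
  | .neg φ, h, hI => by
      simp only [Fm.simpleRank, Fm.HasI] at h hI
      simp only [Fm.subst, Fm.reduce, Fm.reduce_subst_congr hsk hmem hσ φ h hI]
  | .and φ ψ, h, hI => by
      simp only [Fm.simpleRank, Fm.HasI, max_le_iff] at h hI
      simp only [Fm.subst, Fm.reduce,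
        Fm.reduce_subst_congr hsk hmem hσ φ h.1 (fun h => hI (Or.inl h)),
        Fm.reduce_subst_congr hsk hmem hσ ψ h.2 (fun h => hI (Or.inr h))]
  | .or φ ψ, h, hI => by
      simp only [Fm.simpleRank, Fm.HasI, max_le_iff] at h hI
      simp only [Fm.subst, Fm.reduce,
        Fm.reduce_subst_congr hsk hmem hσ φ h.1 (fun h => hI (Or.inl h)),
        Fm.reduce_subst_congr hsk hmem hσ ψ h.2 (fun h => hI (Or.inr h))]

theorem Fm.reduce_inst_congr {S : Subst L} {n : ℕ} (φ : Fm L (n + 1)) {s s' : Tm L 0}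
    {ts ts' : Fin n → Tm L 0} (hs : s.reduce S = s'.reduce S)
    (hts : ∀ i, (ts i).reduce S = (ts' i).reduce S) :
    (φ.inst s ts).reduce S = (φ.inst s' ts').reduce S :=
  Fm.reduce_subst_congr (b := True) (fun _ _ _ _ _ => rfl) (fun _ _ => rfl)
    (Fin.cases hs hts) φ le_rfl (fun _ => trivial)

theorem Models.inst_congr {S : Subst L} {n : ℕ} {φ : Fm L (n + 1)} {s s' : Tm L 0}
    {ts ts' : Fin n → Tm L 0} (h : Models S (φ.inst s ts)) (hs : s.reduce S = s'.reduce S)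
    (hts : ∀ i, (ts i).reduce S = (ts' i).reduce S) : Models S (φ.inst s' ts') := by
  unfold Models at h ⊢
  rwa [← Fm.reduce_inst_congr φ hs hts]

theorem Tm.reduce_skolem {S : Subst L} {n : ℕ} {φ : Fm L (n + 1)} {ts : Fin n → Tm L 0}
    {a : Fin n → ℕ} (hts : ∀ i, (ts i).HasVal S (a i)) (hS : S (.term φ a) = some .unk) :
    (Tm.skolem φ ts).reduce S = .zero := by
  have h : ∀ i, ((ts i).reduce S).numVal = some (a i) := hts
  simp [Tm.reduce, h, hS]

/-- Truth of a formula that is positive in `I` is monotone. -/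
theorem Fm.reduce_pos {S S' : Subst L} (hS : ∀ n, S (.mem n) = some .top ∨ S (.mem n) = some .unk)
    (hS' : ∀ n, S' (.mem n) = some .top ∨ S' (.mem n) = some .unk)
    (hSS : ∀ n, S (.mem n) = some .top → S' (.mem n) = some .top) {k : ℕ}
    {σ σ' : Fin k → Tm L 0} (hσ : ∀ i, ∃ n, (σ i).HasVal S n ∧ (σ' i).HasVal S' n) :
    ∀ φ : Fm L k, φ.SkolemFree →
      ((φ.subst σ).reduce S).IsArith ∧ ((φ.subst σ').reduce S').IsArith ∧
      (φ.OnlySign true → ((φ.subst σ).reduce S).Holds Fin.elim0 →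
        ((φ.subst σ').reduce S').Holds Fin.elim0) ∧
      (φ.OnlySign false → ((φ.subst σ').reduce S').Holds Fin.elim0 →
        ((φ.subst σ).reduce S).Holds Fin.elim0) := by
  have ht : ∀ t : Tm L k, t.SkolemFree →
      ∃ n, (t.subst σ).reduce S = .num n ∧ (t.subst σ').reduce S' = .num n := by
    intro t
    induction t using Tm.rec (motive_2 := fun _ _ => True) with
    | var i => exact fun _ => (hσ i).imp fun n h => ⟨h.1.reduce_eq, h.2.reduce_eq⟩
    | zero => exact fun _ => ⟨0, rfl, rfl⟩
    | succ t ih =>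
      intro h
      obtain ⟨n, h1, h2⟩ := ih hσ h
      exact ⟨n + 1, by simp [Tm.subst, Tm.reduce, h1, Tm.num], by
        simp [Tm.subst, Tm.reduce, h2, Tm.num]⟩
    | func f ts ih =>
      intro h
      simp only [Tm.SkolemFree] at h
      choose n h1 h2 using fun i => ih i hσ (h i)
      exact ⟨_, by simp [Tm.subst, Tm.reduce, h1]; rfl, by simp [Tm.subst, Tm.reduce, h2]⟩
    | skolem => intro h; simp [Tm.SkolemFree] at h
    | _ => trivial
  have hnum : ∀ n : ℕ, (Tm.num n : Tm L 0).SkolemFree := fun n => by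
    induction n with
    | zero => simp [Tm.num, Tm.SkolemFree]
    | succ n ih => simpa [Tm.num, Tm.SkolemFree]
  intro φ
  induction φ using Fm.rec (motive_1 := fun _ _ => True) with
  | tru => simp [Fm.subst, Fm.reduce, Fm.IsArith]
  | fls => simp [Fm.subst, Fm.reduce, Fm.IsArith]
  | eq s t =>
    intro h
    obtain ⟨m, hm1, hm2⟩ := ht s h.1
    obtain ⟨n, hn1, hn2⟩ := ht t h.2
    simp [Fm.subst, Fm.reduce, hm1, hm2, hn1, hn2, Fm.IsArith, hnum]
  | rel R ts =>
    intro h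
    simp only [Fm.SkolemFree] at h
    choose n h1 h2 using fun i => ht (ts i) (h i)
    simp [Fm.subst, Fm.reduce, h1, h2, Fm.IsArith, hnum]
  | mem t =>
    intro h
    obtain ⟨n, h1, h2⟩ := ht t h
    rcases hS n with hn | hn
    · simp [Fm.subst, Fm.reduce, h1, h2, hn, hSS n hn, Fm.IsArith, Fm.Holds, Fm.OnlySign]
    · rcases hS' n with hn' | hn' <;>
      simp [Fm.subst, Fm.reduce, h1, h2, hn, hn', Fm.IsArith, Fm.Holds, Fm.OnlySign]
  -- Negation exchanges the two monotonicity statements, which is why they are proved together.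
  | neg φ ih =>
    intro h
    obtain ⟨h1, h2, h3, h4⟩ := ih hσ ht h
    exact ⟨h1, h2, fun hs => mt (h4 hs), fun hs => mt (h3 hs)⟩
  | and φ ψ ihφ ihψ =>
    intro h
    obtain ⟨h1, h2, h3, h4⟩ := ihφ hσ ht h.1
    obtain ⟨k1, k2, k3, k4⟩ := ihψ hσ ht h.2
    exact ⟨⟨h1, k1⟩, ⟨h2, k2⟩, fun hs => And.imp (h3 hs.1) (k3 hs.2),
      fun hs => And.imp (h4 hs.1) (k4 hs.2)⟩
  | or φ ψ ihφ ihψ =>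
    intro h
    obtain ⟨h1, h2, h3, h4⟩ := ihφ hσ ht h.1
    obtain ⟨k1, k2, k3, k4⟩ := ihψ hσ ht h.2
    exact ⟨⟨h1, k1⟩, ⟨h2, k2⟩, fun hs => Or.imp (h3 hs.1) (k3 hs.2),
      fun hs => Or.imp (h4 hs.1) (k4 hs.2)⟩
  | _ => trivial

end Eval

/-! ## Ranks -/

@[simp] theorem rk_mem (B : Fm L 2) (n : ℕ) : rk B (.mem n) = Om := rfl

@[simp] theorem rk_cTerm (B : Fm L 2) (n : ℕ) : rk B (cTerm B n) = Om := by simp [rk, cTerm]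

open Classical in
theorem rk_term (B : Fm L 2) {n : ℕ} (φ : Fm L (n + 1)) (a : Fin n → ℕ) :
    rk B (.term φ a) = if (⟨n, φ⟩ : Σ m, Fm L (m + 1)) = ⟨1, B.neg⟩ then Om
      else if φ.HasI then Om + ((φ.simpleRank + 1 : ℕ) : Ordinal) + 1
      else ((φ.simpleRank + 1 : ℕ) : Ordinal) := by
  unfold rk
  rfl

theorem natCast_lt_Om (n : ℕ) : (n : Ordinal.{0}) < Om :=
  (Ordinal.natCast_lt_omega0 n).trans (by
    rw [← Ordinal.omega_zero]; exact Ordinal.omega_lt_omega.2 zero_lt_one)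

theorem Om_lt_add (n : ℕ) : Om < Om + ((n + 1 : ℕ) : Ordinal) + 1 :=
  (le_add_of_nonneg_right (by simp)).trans_lt (lt_add_of_pos_right _ (by simp))

/-- The other clauses of `rk` give a term a finite rank or one strictly above `Ω`. -/
theorem eq_cTerm_of_rk {B : Fm L 2} {e : CExpr L} (he : e.IsTerm) (hr : rk B e = Om) :
    ∃ n, e = cTerm B n := by
  cases e with
  | mem n => exact he.elim
  | @term n φ a =>
    rw [rk_term] at hr
    split_ifs at hr with h1 h2
    · cases h1
      refine ⟨a 0, ?_⟩
      unfold cTerm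
      congr 1
      funext i
      rw [Subsingleton.elim i 0]
    · exact absurd hr (Om_lt_add _).ne'
    · exact absurd hr (natCast_lt_Om _).ne

theorem isTerm_of_rk_ne {B : Fm L 2} {e : CExpr L} (he : rk B e ≠ Om) : e.IsTerm := by
  cases e with
  | mem n => exact absurd rfl he
  | term φ a => trivial

theorem Val.Fits.term_cases {u : Val} {e : CExpr L} (h : u.Fits e) (he : e.IsTerm) :
    u = .unk ∨ ∃ k, 0 < k ∧ u = .num k := by
  cases e with
  | mem n => exact he.elim
  | term φ a =>
    cases u with
    | unk => exact Or.inl rfl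
    | num k => exact Or.inr ⟨k, h, rfl⟩
    | top => exact h.elim

theorem Val.Fits.mem_cases {u : Val} {n : ℕ} (h : u.Fits (.mem n : CExpr L)) :
    u = .unk ∨ u = .top := by
  cases u with
  | unk => exact Or.inl rfl
  | num k => exact h.elim
  | top => exact Or.inr rfl

/-- The canonical terms met in the evaluation of `φ` have smaller rank than `c_{∃x φ}`. -/
theorem rk_lt_of_simpleRank_lt {B : Fm L 2} (hB : B.SkolemFree) (hBI : B.HasI) {m n : ℕ}
    {ψ : Fm L (m + 1)} {φ : Fm L (n + 1)} (h : ψ.simpleRank < φ.simpleRank)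
    (hI : ψ.HasI → φ.HasI) (b : Fin m → ℕ) (a : Fin n → ℕ) :
    rk B (.term ψ b) < rk B (.term φ a) := by
  -- `¬B` is Skolem-free and has simple rank `0`, whereas the simple rank of `φ` is positive; so the
  -- larger term is not a `c_n`.
  have h1 : ¬ (⟨n, φ⟩ : Σ m, Fm L (m + 1)) = ⟨1, B.neg⟩ := by
    intro h1
    cases h1
    simp [Fm.simpleRank, Fm.simpleRank_of_skolemFree B hB] at h
  rw [rk_term, rk_term, if_neg h1]
  split_ifs with h2 h3 h4 h5
  · exact Om_lt_add _
  · cases h2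
    exact absurd (hI hBI) h3
  · rw [add_assoc, add_assoc]
    exact (add_lt_add_iff_left Om).2 (by exact_mod_cast Nat.add_lt_add_right h 2)
  · exact absurd (hI h4) h5
  · exact (natCast_lt_Om _).trans (Om_lt_add _)
  · exact_mod_cast Nat.succ_lt_succ h

/-- Evaluating `F(c_n, u)` looks at formulas `m ∈ I`, which have the same rank `Ω` as `c_n`. Because
`r ≠ Ω`, they still lie strictly below `r`. -/
theorem Om_lt_of_hasI {B : Fm L 2} {r : Ordinal.{0}} (hr : r ≠ Om) {n : ℕ} {φ : Fm L (n + 1)}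
    {a : Fin n → ℕ} (hI : φ.HasI) (h : rk B (.term φ a) ≤ r) : Om < r := by
  rw [rk_term] at h
  split_ifs at h
  · exact lt_of_le_of_ne h hr.symm
  · exact (Om_lt_add _).trans_le h

section

variable [L.Structure ℕ]

/-- `F(e, u)` is evaluated using expressions of smaller rank only, or of rank `Ω` for `e = cₙ`. -/
theorem reduce_justif_congr {B : Fm L 2} (hB : B.SkolemFree) (hBI : B.HasI) {r : Ordinal.{0}}
    (hr : r ≠ Om) {S S' : Subst L} (hS : ∀ x, rk B x < r → S x = S' x) {e : CExpr L}
    (he : e.IsTerm) (her : rk B e ≤ r) (u : Val) :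
    (justif B e u).reduce S = (justif B e u).reduce S' := by
  cases e with
  | mem n => exact he.elim
  | @term n φ a =>
    have key : ∀ k, (instNum φ k a).reduce S = (instNum φ k a).reduce S' := by
      intro k
      refine Fm.reduce_subst_congr (N := φ.simpleRank) (b := φ.HasI) ?_ ?_ ?_ φ le_rfl id
      · intro m ψ b h hI
        exact hS _ ((rk_lt_of_simpleRank_lt hB hBI h hI b a).trans_le her)
      · intro hI m
        exact hS _ (Om_lt_of_hasI hr hI her)
      · exact Fin.cases (by simp) (by simp)
    cases u with
    | unk => rfl
    | top => rfl
    | num k =>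
      have h2 : ∀ l : List ℕ,
          (l.foldr (fun v χ => Fm.and (.neg (instNum φ v a)) χ) .tru).reduce S =
          (l.foldr (fun v χ => Fm.and (.neg (instNum φ v a)) χ) .tru).reduce S' := by
        intro l
        induction l with
        | nil => rfl
        | cons v l ih => simp only [List.foldr, Fm.reduce, key, ih]
      simp only [justif, Fm.reduce, key, h2]

theorem models_justif_congr {B : Fm L 2} (hB : B.SkolemFree) (hBI : B.HasI) {r : Ordinal.{0}}
    (hr : r ≠ Om) {S S' : Subst L} (hS : ∀ x, rk B x < r → S x = S' x) {e : CExpr L}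
    (he : e.IsTerm) (her : rk B e ≤ r) {u : Val} (h : Models S (justif B e u)) :
    Models S' (justif B e u) := by
  unfold Models at h ⊢
  rwa [← reduce_justif_congr hB hBI hr hS he her]

/-- `A(n, I)` is evaluated using expressions of rank `Ω` only. -/
theorem models_formA_congr {B : Fm L 2} (hB : B.SkolemFree) {S S' : Subst L}
    (hS : ∀ x, rk B x = Om → S x = S' x) {n : ℕ} (h : Models S (formA B (.num n))) :
    Models S' (formA B (.num n)) := by
  have : (formA B (.num n)).reduce S = (formA B (.num n : Tm L 0)).reduce S' := by
    refine Fm.reduce_subst_congr (N := 0) (b := True) (by simp) (fun _ m => hS _ rfl) ?_ B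
      (Fm.simpleRank_of_skolemFree B hB).le (fun _ => trivial)
    refine Fin.cases ?_ (by simp)
    have h2 := hS (cTerm B n) (by simp)
    simp only [cTerm] at h2
    simp [Tm.reduce, h2]
  unfold Models at h ⊢
  rwa [← this]

theorem CompInconsistent.mono {B : Fm L 2} {S S' : Subst L} (hS : S.Le S')
    (h : CompInconsistent B S) : CompInconsistent B S' := by
  rcases h with ⟨e, u, he, h⟩ | ⟨n, u, h1, h2⟩
  · exact Or.inl ⟨e, u, hS _ _ he, h.mono hS⟩
  · exact Or.inr ⟨n, u, hS _ _ h1, hS _ _ h2⟩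

/-- If the true formulas `n ∈ I` are listed by an admissible sequence, then they are correct, unless
`S` is computationally inconsistent. -/
theorem Admissible.models_formA {B : Fm L 2} (hB : B.SkolemFree) (hBpos : B.OnlySign true)
    {S : Subst L} {P : List ℕ} (hP : Admissible B P) (hS : IsSubst S)
    (hSP : ∀ n, n ∈ P ↔ S (.mem n) = some .top) (hF : ¬ CompInconsistent B S) {n : ℕ}
    (hn : S (.mem n) = some .top) : Models S.ext (formA B (.num n)) := by
  obtain ⟨P₁, P₂, hP12⟩ := List.append_of_mem ((hSP n).2 hn)
  have hA := hP P₁ n P₂ hP12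
  have hmemP : ∀ m, (substOfList P₁ : Subst L).ext (.mem m) = some .top ↔ m ∈ P₁ := by
    intro m
    by_cases h : m ∈ P₁ <;> simp [Subst.ext, substOfList, h]
  -- A positive value of `c_n` next to `(n ∈ I, ⊤)` is a computational inconsistency. So `c_n` has
  -- the default value `0`, and `A(n, I)` reduces like `B(0, n, I)`, the formula in the definition
  -- of `Admissible`.
  have hc : (Tm.skolem B.neg fun _ => .num n : Tm L 0).HasVal S.ext 0 := by
    have h0 : S.ext (cTerm B n) = some .unk := by
      unfold Subst.ext
      cases hu : S (cTerm B n) with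
      | none => rfl
      | some u =>
        rcases (hS _ _ hu).2.term_cases trivial with rfl | ⟨k, -, rfl⟩
        · rfl
        · exact absurd (Or.inr ⟨n, k, hu, hn⟩) hF
    unfold Tm.HasVal
    rw [Tm.reduce_skolem (a := fun _ => n) (fun _ => by simp [Tm.HasVal]) h0]
    rfl
  -- Admissibility gives `B(0, n, I)` with `I` read as `P₁`; positivity carries it to the larger set
  -- of formulas true in `S`.
  have key := Fm.reduce_pos (S := (substOfList P₁ : Subst L).ext) (S' := S.ext) (k := 2)
    (σ := ![.zero, .num n]) (σ' := Fin.cons (.skolem B.neg fun _ => .num n) fun _ => .num n)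
    (fun m => by by_cases h : m ∈ P₁ <;> simp [Subst.ext, substOfList, h])
    (fun m => by
      unfold Subst.ext
      cases hu : S (.mem m) with
      | none => exact Or.inr rfl
      | some u => rcases (hS _ _ hu).2.mem_cases with rfl | rfl <;> simp)
    (fun m hm => S.le_ext _ _ ((hSP m).1 (hP12 ▸ List.mem_append_left _ ((hmemP m).1 hm))))
    (Fin.cases ⟨0, rfl, hc⟩ fun i => ⟨n, by
      rw [Subsingleton.elim i 0]; simp [Tm.HasVal], by simp [Tm.HasVal]⟩) B hB
  exact ⟨key.2.1, key.2.2.1 hBpos hA.2⟩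

/-! ## The pair of a critical formula -/

variable {B : Fm L 2} {Cr : List (Crit L)}

/-- The closure clauses inspect `P` only up to its first failing member, so appending formulas at
the end of `P` is harmless. -/
theorem CritPair.mono {S S' : Subst L} {P P' : List ℕ} (hS : S.Le S') (hP : P <+: P')
    {c : Crit L} {e : CExpr L} {v : Val} (h : CritPair B S P c e v) : CritPair B S' P' c e v := by
  obtain ⟨Q, rfl⟩ := hP
  cases h with
  | pred hs => exact .pred (hs.mono hS)
  | epsilon ht hts => exact .epsilon (ht.mono hS) fun i => (hts i).mono hS
  | induction ht hts hm hφ hmin =>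
    exact .induction (ht.mono hS) (fun i => (hts i).mono hS) hm (hφ.mono hS)
      fun j hj => (hmin j hj).mono hS
  | inductiveDef ht => exact .inductiveDef (ht.mono hS)
  | closureNeg hts hP hn hP₁ hA hv =>
    exact .closureNeg (fun i => (hts i).mono hS) (by rw [hP, List.append_assoc, List.cons_append]) (hn.mono hS)
      (fun m hm => (hP₁ m hm).mono hS) (hA.mono hS) (hS _ _ hv)
  | closurePos hts hP hn hP₁ hA =>
    exact .closurePos (fun i => (hts i).mono hS) (by rw [hP, List.append_assoc, List.cons_append]) (hn.mono hS)
      (fun m hm => (hP₁ m hm).mono hS) (hA.mono hS)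

theorem eq_of_first_fail {p : ℕ → Prop} {P₁ P₂ P₁' P₂' : List ℕ} {n n' : ℕ}
    (h : P₁ ++ n :: P₂ = P₁' ++ n' :: P₂') (hn : ¬ p n) (hn' : ¬ p n') (h₁ : ∀ m ∈ P₁, p m)
    (h₁' : ∀ m ∈ P₁', p m) : n = n' := by
  rcases List.append_eq_append_iff.1 h with ⟨l, h2, h3⟩ | ⟨l, h2, h3⟩
  · cases l with
    | nil => simp at h3; exact h3.1
    | cons x l =>
      simp only [List.cons_append, List.cons.injEq] at h3
      exact absurd (h₁' n (by rw [h2]; simp [h3.1])) hn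
  · cases l with
    | nil => simp at h3; exact h3.1.symm
    | cons x l =>
      simp only [List.cons_append, List.cons.injEq] at h3
      exact absurd (h₁ n' (by rw [h2]; simp [h3.1])) hn'

/-- Needed for the selection: a pair found in an extension must be the one already computed in the
smaller substitution. For closure formulas the first failing member is unique, and `A(n, φ)` cannot
both hold and fail. -/
theorem CritPair.unique {S : Subst L} {P : List ℕ} {c : Crit L} {e e' : CExpr L} {v v' : Val}
    (h : CritPair B S P c e v) (h' : CritPair B S P c e' v') : e = e' ∧ v = v' := by
  have hvec : ∀ {n : ℕ} {ts : Fin n → Tm L 0} {a a' : Fin n → ℕ},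
      (∀ i, (ts i).HasVal S (a i)) → (∀ i, (ts i).HasVal S (a' i)) → a = a' :=
    fun h h' => funext fun i => (h i).unique (h' i)
  cases h with
  | pred hs =>
    cases h' with
    | pred hs' => cases hs.unique hs'; exact ⟨rfl, rfl⟩
  | epsilon ht hts =>
    cases h' with
    | epsilon ht' hts' => cases ht.unique ht'; cases hvec hts hts'; exact ⟨rfl, rfl⟩
  | @induction _ _ _ _ _ m _ ht hts hm hφ hmin =>
    cases h' with
    | @induction _ _ _ _ _ m' _ ht' hts' hm' hφ' hmin' =>
      cases hvec hts hts'
      rcases lt_trichotomy m m' with h | h | h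
      · exact absurd (hmin' m h) hφ.not_neg
      · cases h; exact ⟨rfl, rfl⟩
      · exact absurd (hmin m' h) hφ'.not_neg
  | inductiveDef ht =>
    cases h' with
    | inductiveDef ht' => cases ht.unique ht'; exact ⟨rfl, rfl⟩
  | closureNeg hts hP hn hP₁ hA hv =>
    cases h' with
    | closureNeg hts' hP' hn' hP₁' hA' hv' =>
      cases hvec hts hts'
      cases eq_of_first_fail (hP.symm.trans hP') (fun h => h.not_neg hn) (fun h => h.not_neg hn')
        hP₁ hP₁'
      cases hv.symm.trans hv'
      exact ⟨rfl, rfl⟩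
    | closurePos hts' hP' hn' hP₁' hA' =>
      cases eq_of_first_fail (hP.symm.trans hP') (fun h => h.not_neg hn) (fun h => h.not_neg hn')
        hP₁ hP₁'
      exact absurd hA hA'.not_neg
  | closurePos hts hP hn hP₁ hA =>
    cases h' with
    | closureNeg hts' hP' hn' hP₁' hA' hv' =>
      cases eq_of_first_fail (hP.symm.trans hP') (fun h => h.not_neg hn) (fun h => h.not_neg hn')
        hP₁ hP₁'
      exact absurd hA' hA.not_neg
    | closurePos hts' hP' hn' hP₁' hA' =>
      cases hvec hts hts'
      cases eq_of_first_fail (hP.symm.trans hP') (fun h => h.not_neg hn) (fun h => h.not_neg hn')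
        hP₁ hP₁'
      exact ⟨rfl, rfl⟩

omit [L.Structure ℕ] in
theorem formAOf_subst {n k m : ℕ} (φ : Fm L (n + 1)) (t : Tm L k) (ts : Fin n → Tm L k)
    (σ : Fin k → Tm L m) :
    (formAOf B φ t ts).subst σ = formAOf B φ (t.subst σ) fun i => (ts i).subst σ := by
  have h : ∀ i : Fin (n + 1), (Fin.cons (α := fun _ => Tm L k) t ts i).subst σ =
      Fin.cons (α := fun _ => Tm L m) (t.subst σ) (fun i => (ts i).subst σ) i :=
    Fin.cases rfl fun _ => rfl
  unfold formAOf Fm.all Fm.inst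
  rw [Fm.subst_subst]
  congr 1
  funext i
  refine Fin.cases ?_ h i
  simp only [Fin.cons_zero, Tm.subst, h]

omit [L.Structure ℕ] in
theorem progFm_inst {n : ℕ} (φ : Fm L (n + 1)) (s : Tm L 0) (ts : Fin n → Tm L 0) :
    (progFm B φ).inst s ts = (formAOf B φ s ts).imp (φ.inst s ts) := by
  have := formAOf_subst (B := B) φ (.var 0) (fun i => .var i.succ)
    (Fin.cons s ts : Fin (n + 1) → Tm L 0)
  simp only [Tm.subst, Fin.cons_zero, Fin.cons_succ] at this
  simp only [progFm, Fm.inst, Fm.imp, Fm.subst, this]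

theorem models_neg_imp {S : Subst L} {φ ψ : Fm L 0} (h : Models S (φ.imp ψ).neg) :
    Models S φ ∧ Models S ψ.neg := by
  obtain ⟨⟨h1, h2⟩, h3⟩ := h
  obtain ⟨h3, h4⟩ := not_or.1 h3
  exact ⟨⟨h1, not_not.1 h3⟩, h2, h4⟩

/-- The proposed value is a proper one. -/
theorem CritPair.fits {S : Subst L} {P : List ℕ} {c : Crit L} {e : CExpr L} {v : Val}
    (hS : IsSubst S) (hc : Models S (c.fm B).neg) (he : S e = some .unk)
    (h : CritPair B S P c e v) : v.Fits e ∧ v ≠ .unk := by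
  cases h with
  | @pred s k hs =>
    refine ⟨?_, by simp⟩
    obtain ⟨h1, h2⟩ := models_neg_imp hc
    have hz := Tm.reduce_skolem (ts := fun _ => s) (fun _ => hs) he
    have hs' := hs.reduce_eq
    have h1' := h1.2
    have h2' := h2.2
    have hval : ∀ n : ℕ, (Tm.num n : Tm L 0).value Fin.elim0 = n := fun n => by
      induction n with
      | zero => rfl
      | succ n ih => simp [Tm.num, Tm.value, ih]
    -- With the default `0` for the Skolem term the conclusion reads `k = S 0`. It fails while `k ≠
    -- 0`, so `k ≥ 2` and `k - 1` is positive.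
    have hk : ((predFm : Fm L (1 + 1)).ex fun _ => s).reduce S =
        .eq (.num k) (.succ .zero) := by
      rw [← hs', ← hz]; rfl
    rw [Fm.reduce, hk] at h2'
    simp only [Fm.reduce, Fm.Holds, hs', Tm.reduce, hval, Tm.value] at h1' h2'
    show 0 < k - 1
    omega
  | @epsilon n φ t ts k a ht hts =>
    obtain ⟨h1, h2⟩ := models_neg_imp hc
    refine ⟨Nat.pos_of_ne_zero ?_, by simp⟩
    -- The Skolem term still has its default `0`; a proposed value `0` would make premise and
    -- conclusion of the critical formula reduce to the same sentence.
    rintro rfl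
    exact (h1.inst_congr (ht.reduce_eq.trans (Tm.reduce_skolem hts he).symm)
      fun _ => rfl).not_neg h2
  | @induction n φ t ts k m a ht hts hm hφ hmin =>
    obtain ⟨h1, h2⟩ := models_neg_imp hc
    refine ⟨Nat.pos_of_ne_zero ?_, by simp⟩
    rintro rfl
    exact (hφ.inst_congr (Tm.reduce_skolem hts he).symm fun _ => rfl).not_neg h2
  | inductiveDef ht => exact ⟨trivial, by simp⟩
  | closureNeg hts hP hn hP₁ hA hv => exact ⟨(hS _ _ hv).2, by simp⟩
  | @closurePos k φ ts a n P₁ P₂ hts hP hn hP₁ hA =>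
    obtain ⟨h1, h2⟩ := models_neg_imp hc
    refine ⟨Nat.pos_of_ne_zero ?_, by simp⟩
    -- The premise of the closure formula asserts progressivity at the default `0`, which is refuted
    -- by `A(0, φ)` and the failure of `φ(0)`.
    rintro rfl
    have h3 : Models S ((progFm B φ).inst (.num 0) ts) :=
      h1.inst_congr (Tm.reduce_skolem hts he) fun _ => rfl
    rw [progFm_inst] at h3
    have h4 := hn.2
    rcases h3.2 with h | h
    · exact h hA.2
    · exact h4 h

theorem HApplies.fits {Θ : Sequent L} {e : CExpr L} {v : Val} (h : HApplies B Cr Θ e v)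
    (hΘ : IsSubst Θ.S) : v.Fits e ∧ v ≠ .unk := by
  obtain ⟨i, h1, h2, -⟩ := h.selected
  exact h2.fits hΘ h1 h.unk

end

/-! ## The `H`-step -/

section HStep

variable {B : Fm L 2} {Θ Θ' : Sequent L} {e x : CExpr L} {v : Val} {r s : Ordinal.{0}}

@[simp] theorem hSubst_self : hSubst B Θ e v e = some v := by simp [hSubst]

theorem hSubst_of_rk_ne (he : rk B e ≠ Om) (hx : x ≠ e) :
    hSubst B Θ e v x = open Classical in if rk B x ≤ rk B e then Θ.S x else none := by
  rw [hSubst.eq_def, if_neg hx, if_pos he]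

theorem hSubst_of_rk_lt (h : rk B x < rk B e) : hSubst B Θ e v x = Θ.S x := by
  have hx : x ≠ e := by rintro rfl; exact lt_irrefl _ h
  by_cases he : rk B e = Om
  · rw [hSubst.eq_def, if_neg hx, if_neg (not_not.2 he), if_pos (he ▸ h)]
  · rw [hSubst_of_rk_ne he hx, if_pos h.le]

/-- Only an `H`-step of rank `Ω` rearranges several values of its own rank. At any other rank just
the value of `e` changes. -/
theorem hSubst_of_rk_le (hr : r ≠ Om) (he : r ≤ rk B e) (hx : rk B x ≤ r) (hxe : x ≠ e) :
    hSubst B Θ e v x = Θ.S x := by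
  rcases (hx.trans he).lt_or_eq with h | h
  · exact hSubst_of_rk_lt h
  · rw [hSubst_of_rk_ne ((le_antisymm (h ▸ hx) he) ▸ hr) hxe, if_pos h.le]

/-- An `H`-step of rank `Ω` is governed by `P`, `V` and values of rank `Ω`, all compared when `r <
Ω`. At any other rank a value other than that of `e` is either copied or erased. -/
theorem hSubst_congr (hr : r ≠ Om) (he : r ≤ rk B e) (hS : ∀ x, r < rk B x → Θ'.S x = Θ.S x)
    (hP : r < Om → Θ'.P = Θ.P) (hV : r < Om → Θ'.V = Θ.V) (hx : r < rk B x) :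
    hSubst B Θ' e v x = hSubst B Θ e v x := by
  by_cases h : rk B e = Om
  · have hlt : r < Om := lt_of_le_of_ne (h ▸ he) hr
    unfold hSubst posPart negPart
    rw [hS x hx, hP hlt, hV hlt]
  · simp only [hSubst, if_pos h, hS x hx]

theorem hSeq_of_lt (h : rk B e < Om) : hSeq B Θ e = [] := by rw [hSeq.eq_def, if_pos h]

theorem hSeq_of_gt (h : Om < rk B e) : hSeq B Θ e = Θ.P := by
  rw [hSeq.eq_def, if_neg h.le.not_gt, if_pos h]

theorem hSeq_congr (h : Θ'.P = Θ.P) : hSeq B Θ' e = hSeq B Θ e := by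
  unfold hSeq
  rw [h]

theorem hSeq_mem (n : ℕ) : hSeq B Θ (.mem n) = Θ.P ++ [n] := by
  rw [hSeq.eq_def, rk_mem, if_neg (lt_irrefl _), if_neg (lt_irrefl _)]

theorem hSeq_cTerm (n : ℕ) : hSeq B Θ (cTerm B n) = Θ.P.takeWhile (· ≠ n) := by
  rw [hSeq.eq_def, rk_cTerm, if_neg (lt_irrefl _), if_neg (lt_irrefl _)]
  simp [cTerm]

theorem hHist_of_gt (hΘ : Θ.IsSequent B) (h : Om < rk B e) : hHist B Θ e = Θ.V := by
  funext m
  rw [hHist, if_neg (by rintro rfl; exact lt_irrefl _ h), hSeq_of_gt h]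
  split_ifs with hm
  · rfl
  · have := mt (hΘ.dom_V m).1 hm
    exact (by simpa using this : Θ.V m = none).symm

theorem negPart_mem (S : Subst L) (n : ℕ) :
    negPart B S (.mem n) = match S (.mem n) with
      | some .unk => some .unk
      | _ => none := by
  unfold negPart
  rcases S (.mem n) with - | (- | - | -) <;> rfl

open Classical in
theorem negPart_term (S : Subst L) {n : ℕ} (φ : Fm L (n + 1)) (a : Fin n → ℕ) :
    negPart B S (.term φ a) = if rk B (.term φ a) = Om then
      match S (.term φ a) with
      | some (.num u) => some (.num u)
      | _ => none
    else none := by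
  unfold negPart
  by_cases h : rk B (.term φ a) = Om <;>
    rcases S (.term φ a) with - | (- | - | -) <;> simp [h]

theorem negPart_congr (h : ∀ x, rk B x = Om → Θ'.S x = Θ.S x) :
    negPart B Θ'.S = negPart B Θ.S := by
  funext x
  cases x with
  | mem n => rw [negPart_mem, negPart_mem, h (.mem n) rfl]
  | term φ a =>
    rw [negPart_term, negPart_term]
    split_ifs with hx
    · rw [h _ hx]
    · rfl

theorem hHist_congr (hS : ∀ x, rk B x = Om → Θ'.S x = Θ.S x) (hP : Θ'.P = Θ.P)
    (hV : Θ'.V = Θ.V) : hHist B Θ' e = hHist B Θ e := by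
  funext m
  simp only [hHist, negPart_congr hS, hSeq_congr hP, hV]

theorem hStep_F_of_eq (hΘ : Θ.IsSequent B) (h : hSubst B Θ e v x = Θ.S x) :
    (hStep B Θ e v).F x = Θ.F x := by
  have hF := hΘ.dom_F x
  unfold hStep
  dsimp only
  rw [h]
  by_cases h1 : Θ.S x = some .unk ∨ ((Θ.S x).isSome ∧ rk B x = Om)
  · have h2 : (Θ.S x).isSome := h1.elim (fun h => by simp [h]) fun h => h.1
    rw [if_pos h1, if_pos h2]
  · rw [if_neg h1]
    rw [← hF] at h1
    exact (by simpa using h1 : Θ.F x = none).symm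

theorem hStep_F_self (he : rk B e ≠ Om) (hv : v ≠ .unk) : (hStep B Θ e v).F e = none := by
  simp [hStep, he, hv]

/-- Where the values of `H(Θ)` come from. -/
theorem hSubst_cases {u : Val} (h : hSubst B Θ e v x = some u) :
    (x = e ∧ u = v) ∨ Θ.S x = some u ∨ (∃ m ∈ Θ.P, x = .mem m ∧ u = .top) ∨
      ∃ m W, Θ.V m = some W ∧ W x = some u := by
  unfold hSubst at h
  split_ifs at h with h1 h2 h3 h4
  · exact Or.inl ⟨h1, (Option.some.inj h).symm⟩
  · exact Or.inr (Or.inl h)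
  · exact Or.inr (Or.inl h)
  · cases e with
    | mem n =>
      right; left
      simp only [posPart] at h
      split at h
      · split_ifs at h; simp_all
      · simp_all
      · simp at h
    | @term k φ a =>
      simp only at h
      split_ifs at h with h5 h6 h7 h8
      · obtain ⟨m, hm, rfl⟩ := h6
        exact Or.inr (Or.inr (Or.inl ⟨m, (List.takeWhile_sublist _).mem hm, rfl,
          (Option.some.inj h).symm⟩))
      · obtain ⟨m, hm, -, h7⟩ := h7
        exact Or.inr (Or.inl (h7.trans h))
      · obtain ⟨W, hW, h9⟩ := Option.bind_eq_some_iff.1 h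
        exact Or.inr (Or.inr (Or.inr ⟨_, W, hW, h9⟩))
      · right; left
        simp only [negPart] at h
        split at h
        · split_ifs at h; simp_all
        · simp_all
        · simp at h

theorem mem_hSeq_iff (hΘ : Θ.IsSequent B) (hv : v.Fits e) (hunk : Θ.S e = some .unk)
    (hvu : v ≠ .unk) (n : ℕ) :
    n ∈ hSeq B Θ e ↔ hSubst B Θ e v (.mem n) = some .top := by
  rcases lt_trichotomy (rk B e) Om with h | h | h
  · rw [hSeq_of_lt h, hSubst_of_rk_ne h.ne (by rintro rfl; exact lt_irrefl _ h),
      if_neg (by simpa using h)]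
    simp
  · cases e with
    | mem m =>
      have hvt : v = .top := hv.mem_cases.resolve_left hvu
      rw [hSeq_mem, List.mem_append, hΘ.mem_P, List.mem_singleton]
      by_cases hnm : n = m
      · subst hnm; simp [hvt]
      · have hne : (CExpr.mem n : CExpr L) ≠ .mem m := by simpa using hnm
        rw [hSubst.eq_def, if_neg hne]
        simp only [rk_mem, ne_eq, not_true_eq_false, if_false, lt_irrefl, posPart, hnm, or_false]
        rcases hs : Θ.S (.mem n) with - | (- | - | -) <;> simp
    | @term k φ a =>
      obtain ⟨m, hm⟩ := eq_cTerm_of_rk (B := B) (e := .term φ a) trivial h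
      rw [hm, hSeq_cTerm]
      have hneg : ∀ S : Subst L, negPart B S (.mem n) ≠ some .top := by
        intro S
        simp only [negPart]
        rcases hs : S (.mem n) with - | (- | - | -) <;> simp
      rw [hSubst.eq_def, if_neg (by simp [cTerm]), rk_cTerm]
      simp only [ne_eq, not_true_eq_false, if_false, rk_mem, lt_irrefl, cTerm, dif_pos,
        CExpr.mem.injEq, exists_eq_right', reduceCtorEq, false_and, and_false, exists_false]
      split_ifs with h1 h2
      · exact iff_of_true h1 rfl
      · simp only [h1, false_iff]
        intro h3
        -- Restored histories are negative parts, so they contribute no pair `(n ∈ I, ⊤)`.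
        obtain ⟨W, hW, h4⟩ := Option.bind_eq_some_iff.1 h3
        rw [← (hΘ.val_V _ _ hW).2.2] at h4
        exact hneg _ h4
      · exact iff_of_false h1 (hneg _)
  · rw [hSeq_of_gt h, hSubst_of_rk_lt (by simpa using h), hΘ.mem_P]

/-- The finiteness hypothesis concerns the case where `n ∈ I` becomes true: the negative part of `S`
is then stored as a history value, and these have to be finite. -/
theorem hStep_isSequent (hΘ : Θ.IsSequent B) (hv : v.Fits e) (hunk : Θ.S e = some .unk)
    (hvu : v ≠ .unk) (hfin : ∀ n, e = .mem n → {x | negPart B Θ.S x ≠ none}.Finite) :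
    (hStep B Θ e v).IsSequent B where
  isSubst x u h := by
    rcases hSubst_cases h with ⟨rfl, rfl⟩ | h | ⟨m, hm, rfl, rfl⟩ | ⟨m, W, hW, h⟩
    · exact ⟨(hΘ.isSubst _ _ hunk).1, hv⟩
    · exact hΘ.isSubst _ _ h
    · exact ⟨trivial, trivial⟩
    · exact (hΘ.val_V _ _ hW).1 _ _ h
  nodup := by
    show (hSeq B Θ e).Nodup
    rcases lt_trichotomy (rk B e) Om with h | h | h
    · rw [hSeq_of_lt h]; exact List.nodup_nil
    · cases e with
      | mem m =>
        rw [hSeq_mem]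
        refine hΘ.nodup.append (List.nodup_singleton _) ?_
        simp [hΘ.mem_P, hunk]
      | term φ a =>
        obtain ⟨m, hm⟩ := eq_cTerm_of_rk (B := B) (e := .term φ a) trivial h
        rw [hm, hSeq_cTerm]
        exact hΘ.nodup.sublist (List.takeWhile_sublist _)
    · rw [hSeq_of_gt h]; exact hΘ.nodup
  mem_P n := mem_hSeq_iff hΘ hv hunk hvu n
  dom_V n := by
    show (hHist B Θ e n).isSome ↔ n ∈ hSeq B Θ e
    have hsub : n ∈ hSeq B Θ e → (e = .mem n) ∨ n ∈ Θ.P := by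
      intro hn
      rcases hSubst_cases ((mem_hSeq_iff hΘ hv hunk hvu n).1 hn) with
        ⟨h, -⟩ | h | ⟨m, hm, h, -⟩ | ⟨m, W, hW, h⟩
      · exact Or.inl h.symm
      · exact Or.inr ((hΘ.mem_P n).2 h)
      · cases h; exact Or.inr hm
      · have h2 := (hΘ.val_V _ _ hW).2.2
        rw [← h2] at h
        simp only [negPart] at h
        split at h <;> simp_all
    rw [hHist]
    split_ifs with h1 h2
    · subst h1
      simp [hSeq_mem]
    · simp only [h2, iff_true]
      exact (hΘ.dom_V n).2 ((hsub h2).resolve_left h1)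
    · simp [h2]
  val_V n W h := by
    change hHist B Θ e n = some W at h
    rw [hHist] at h
    split_ifs at h with h1 h2
    · cases h
      refine ⟨fun x u hx => ?_, hfin n h1, ?_⟩
      · apply hΘ.isSubst
        simp only [negPart] at hx
        split at hx
        · split_ifs at hx; simp_all
        · simp_all
        · simp at hx
      · funext x
        cases x with
        | mem m =>
          simp only [negPart]
          rcases hs : Θ.S (.mem m) with - | (- | - | -) <;> simp
        | term φ a =>
          rw [negPart_term, negPart_term]
          rcases hs : Θ.S (.term φ a) with - | (- | - | -) <;> split_ifs <;> rfl
    · exact hΘ.val_V _ _ h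
  dom_F x := by
    have hF := hΘ.dom_F x
    simp only [hStep]
    split_ifs with h1 h2
    · simp only [h1, iff_true]
      rw [hF]
      by_cases hx : rk B x = Om
      · exact Or.inr ⟨h2, hx⟩
      · have h3 : hSubst B Θ e v x = some .unk := h1.resolve_right fun h => hx h.2
        rcases hSubst_cases h3 with ⟨-, h⟩ | h | ⟨m, -, h, -⟩ | ⟨m, W, hW, h⟩
        · exact absurd h.symm hvu
        · exact Or.inl h
        · exact absurd (h ▸ rfl) hx
        · exfalso
          rw [← (hΘ.val_V _ _ hW).2.2] at h
          simp only [negPart] at h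
          split at h <;> simp_all
    · simp [h1]
    · simp [h1]

end HStep

/-! ## Sequents obtained by the other rules -/

section Rules

variable {B : Fm L 2} {Θ : Sequent L} {e : CExpr L}

theorem Sequent.IsSequent.F_eq_none (hΘ : Θ.IsSequent B) (he : Θ.S e = none) : Θ.F e = none := by
  have := mt (hΘ.dom_F e).1 (by simp [he])
  simpa using this

theorem Sequent.IsSequent.notMem (hΘ : Θ.IsSequent B) {n : ℕ} (he : Θ.S (.mem n) = none) :
    n ∉ Θ.P := by simp [hΘ.mem_P, he]

theorem Sequent.IsSequent.empty : (Sequent.empty : Sequent L).IsSequent B where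
  isSubst e u h := by simp [Sequent.empty] at h
  nodup := List.nodup_nil
  mem_P := by simp [Sequent.empty]
  dom_V := by simp [Sequent.empty]
  val_V := by simp [Sequent.empty]
  dom_F := by simp [Sequent.empty]

open Classical in
theorem Sequent.IsSequent.update (hΘ : Θ.IsSequent B) {Θ' : Sequent L} {u : Val}
    (he : Θ.S e = none) (hL : e.InLang) (hu : u.Fits e) (hut : u ≠ .top)
    (hS : Θ'.S = Function.update Θ.S e (some u)) (hP : Θ'.P = Θ.P)
    (hV : Θ'.V = Θ.V)
    (hF : ∀ x, x ≠ e → Θ'.F x = Θ.F x) (hFe : (Θ'.F e).isSome ↔ u = .unk ∨ rk B e = Om) :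
    Θ'.IsSequent B where
  isSubst x w h := by
    rw [hS] at h
    by_cases hx : x = e
    · subst hx
      simp only [Function.update_self, Option.some.injEq] at h
      exact h ▸ ⟨hL, hu⟩
    · rw [Function.update_of_ne hx] at h
      exact hΘ.isSubst _ _ h
  nodup := hP ▸ hΘ.nodup
  mem_P n := by
    rw [hP, hS, hΘ.mem_P]
    by_cases hx : .mem n = e
    · subst hx; simp [he, hut]
    · rw [Function.update_of_ne hx]
  dom_V := hP ▸ hV ▸ hΘ.dom_V
  val_V := hV ▸ hΘ.val_V
  dom_F x := by
    rw [hS]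
    by_cases hx : x = e
    · subst hx; simp [hFe]
    · rw [Function.update_of_ne hx, hF x hx, hΘ.dom_F]

open Classical in
theorem Sequent.IsSequent.addUnk (hΘ : Θ.IsSequent B) (he : Θ.S e = none) (hL : e.InLang)
    (i : Bool) : (Θ.addUnk e i).IsSequent B :=
  hΘ.update (u := .unk) he hL (by cases e <;> trivial) (by simp) rfl rfl rfl
    (fun x hx => Function.update_of_ne hx _ _) (by simp [Sequent.addUnk])

open Classical in
theorem Sequent.IsSequent.addNum (hΘ : Θ.IsSequent B) (he : Θ.S e = none) (hL : e.InLang)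
    (hr : rk B e ≠ Om) {u : ℕ} (hu : 0 < u) : (Θ.addNum e u).IsSequent B :=
  hΘ.update (u := .num u) he hL
    (by cases e with | mem n => exact absurd rfl hr | term φ a => exact hu) (by simp) rfl rfl rfl
    (fun x hx => rfl) (by simp [Sequent.addNum, hr, hΘ.F_eq_none he])

open Classical in
theorem Sequent.IsSequent.addNumF (hΘ : Θ.IsSequent B) (he : Θ.S e = none) (hL : e.InLang)
    (ht : e.IsTerm) (hr : rk B e = Om) {u : ℕ} (hu : 0 < u) (i : Bool) :
    (Θ.addNumF e u i).IsSequent B :=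
  hΘ.update (u := .num u) he hL
    (by cases e with | mem n => exact ht.elim | term φ a => exact hu) (by simp) rfl rfl rfl
    (fun x hx => Function.update_of_ne hx _ _) (by simp [Sequent.addNumF, hr])

theorem Sequent.IsSequent.addForms [L.Structure ℕ] (hΘ : Θ.IsSequent B) {n : ℕ} {Pe : List ℕ}
    {Ve : ℕ → Option (Subst L)} (hP : Proper B n Θ Pe) (hV : IsHist B Pe Ve) (i : Bool) :
    (Θ.addForms Pe Ve i).IsSequent B where
  isSubst x w h := by
    cases x with
    | term φ a => exact hΘ.isSubst _ _ h
    | mem m =>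
      simp only [Sequent.addForms] at h
      split_ifs at h
      · cases h; exact ⟨trivial, trivial⟩
      · exact hΘ.isSubst _ _ h
  nodup := hΘ.nodup.append hP.nodup fun m h1 h2 => hP.disjoint m h2 h1
  mem_P m := by
    by_cases hm : m ∈ Pe <;> simp [Sequent.addForms, hm, hΘ.mem_P]
  dom_V m := by
    by_cases hm : m ∈ Pe <;> simp [Sequent.addForms, hm, hΘ.dom_V, hV.1]
  val_V m W h := by
    simp only [Sequent.addForms] at h
    split_ifs at h
    · exact hV.2 _ _ h
    · exact hΘ.val_V _ _ h
  dom_F x := by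
    cases x with
    | term φ a => exact hΘ.dom_F _
    | mem m =>
      by_cases hm : m ∈ Pe <;> simp [Sequent.addForms, hm, hΘ.dom_F]

end Rules

/-! ## Derivability and reachability -/

section Der

variable [L.Structure ℕ] {B : Fm L 2} {Cr : List (Crit L)} {r s : Ordinal.{0}}

/-- Derivability by rules satisfying `ok`. -/
inductive Der (B : Fm L 2) (Cr : List (Crit L)) (ok : Rule L → Prop) : Sequent L → Prop
  | ax {Θ : Sequent L} (hΘ : Θ.IsSequent B) (h : IsAxiom B Cr Θ) : Der B Cr ok Θ
  | infer {Θ : Sequent L} (hΘ : Θ.IsSequent B) (R : Rule L) (hR : ok R) (h : R.Applies B Cr Θ)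
      (ds : ∀ Θ', Θ' ∈ R.premises B Θ → Der B Cr ok Θ') : Der B Cr ok Θ

theorem Der.isSequent {ok : Rule L → Prop} {Θ : Sequent L} (h : Der B Cr ok Θ) :
    Θ.IsSequent B := by
  cases h <;> assumption

theorem Deduction.isSequent {𝒮 : Set (Sequent L)} {Θ : Sequent L} (d : Deduction B Cr 𝒮 Θ) :
    Θ.IsSequent B := by
  cases d <;> assumption

theorem Deduction.der {ok : Rule L → Prop} {Θ : Sequent L} (d : Derivation B Cr Θ)
    (h : ∀ R ∈ d.rules, ok R) : Der B Cr ok Θ := by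
  induction d with
  | leaf Θ hΘ h' => exact h'.elim
  | ax Θ hΘ h' => exact .ax hΘ h'
  | infer Θ hΘ R hR ds ih =>
    refine .infer hΘ R (h R (Or.inl rfl)) hR fun Θ' h' => ih Θ' h' fun R' hR' => h R' (Or.inr ?_)
    exact Set.mem_iUnion₂.2 ⟨Θ', h', hR'⟩

theorem Der.exists_derivation {ok : Rule L → Prop} {Θ : Sequent L} (h : Der B Cr ok Θ) :
    ∃ d : Derivation B Cr Θ, ∀ R ∈ d.rules, ok R := by
  induction h with
  | ax hΘ h => exact ⟨.ax _ hΘ h, fun R hR => hR.elim⟩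
  | infer hΘ R hR h ds ih =>
    choose d hd using ih
    refine ⟨.infer _ hΘ R h d, ?_⟩
    rintro R' (hR' | hR')
    · exact hR' ▸ hR
    · obtain ⟨Θ', h', hR'⟩ := Set.mem_iUnion₂.1 hR'
      exact hd _ _ _ hR'

/-- The restriction on the rules of an `r`-deduction. -/
def Rule.Ok (B : Fm L 2) (r : Ordinal.{0}) (R : Rule L) : Prop :=
  match R.name with
  | .Cut => rk B R.main < r
  | .CutFr => rk B R.main < 0
  | .Fr => r ≤ rk B R.main
  | .H => r ≤ rk B R.main

/-- The restriction on the rules of an `r⁺`-deduction. -/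
def Rule.OkPlus (B : Fm L 2) (r : Ordinal.{0}) (R : Rule L) : Prop :=
  match R.name with
  | .Cut => rk B R.main < r
  | .CutFr => rk B R.main = r
  | .Fr => r < rk B R.main
  | .H => r ≤ rk B R.main

/-- The sequents on `r`-paths. -/
inductive Reach (B : Fm L 2) (Cr : List (Crit L)) (r : Ordinal.{0}) : Sequent L → Prop
  | empty : Reach B Cr r Sequent.empty
  | step {Θ Θ' : Sequent L} (h : Reach B Cr r Θ) (R : Rule L) (hR : R.Ok B r)
      (ha : R.Applies B Cr Θ) (hp : Θ' ∈ R.premises B Θ) (hΘ' : Θ'.IsSequent B) : Reach B Cr r Θ'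

theorem Reach.isSequent {Θ : Sequent L} (h : Reach B Cr r Θ) : Θ.IsSequent B := by
  cases h with
  | empty => exact .empty
  | step _ _ _ _ _ hΘ' => exact hΘ'

theorem Reach.of_isPath {𝒮 : Set (Sequent L)} {Θ₀ Θ : Sequent L} (d : Deduction B Cr 𝒮 Θ₀)
    (hd : d.IsR r) (h₀ : Reach B Cr r Θ₀) {l : List (Sequent L)} (hl : d.IsPath l)
    (hΘ : l.getLast? = some Θ) : Reach B Cr r Θ := by
  induction d generalizing l with
  | leaf Θ₀ _ _ => cases hl; cases hΘ; exact h₀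
  | ax Θ₀ _ _ => cases hl; cases hΘ; exact h₀
  | infer Θ₀ _ R hR ds ih =>
    rcases hl with rfl | ⟨Θ', h', l', rfl, hl'⟩
    · cases hΘ; exact h₀
    · refine ih Θ' h' (fun R' hR' => hd R' (Or.inr (Set.mem_iUnion₂.2 ⟨Θ', h', hR'⟩)))
        (h₀.step R (hd R (Or.inl rfl)) hR h' (ds Θ' h').isSequent) hl' ?_
      cases l' with
      | nil =>
        exfalso
        generalize ds Θ' h' = d' at hl'
        cases d' <;> simp [Deduction.IsPath] at hl'
      | cons a l' => simpa using hΘ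

theorem HasRPath.reach {Θ : Sequent L} (h : HasRPath B Cr r Θ) : Reach B Cr r Θ := by
  obtain ⟨l, ⟨𝒮, d, hd, hl⟩, hΘ⟩ := h
  exact Reach.of_isPath d hd .empty hl hΘ

/-- The only rules that pruning introduces are `Fr`s replacing `CutFr`s; these have rank `r`, which
the bound `≥ r` admits. -/
theorem Deduction.IsRPlus.prune {𝒮 : Set (Sequent L)} {Θ : Sequent L} {d : Deduction B Cr 𝒮 Θ}
    (h : d.IsRPlus r) : d.prune.IsR r := by
  have key : ∀ R ∈ d.prune.rules, ∃ R' ∈ d.rules, R = R'.prune := by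
    clear h
    induction d with
    | leaf => exact fun R hR => hR.elim
    | ax => exact fun R hR => hR.elim
    | infer Θ hΘ R hR ds ih =>
      rintro R' (hR' | hR')
      · exact ⟨R, Or.inl rfl, hR'⟩
      · obtain ⟨Θ', h', hR'⟩ := Set.mem_iUnion₂.1 hR'
        obtain ⟨R'', h1, h2⟩ := ih _ _ R' hR'
        exact ⟨R'', Or.inr (Set.mem_iUnion₂.2 ⟨Θ', Rule.premises_prune h', h1⟩), h2⟩
  intro R hR
  obtain ⟨R', hR', rfl⟩ := key R hR
  have h1 := h R' hR'
  cases R' with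
  | cutFr e => exact h1.ge
  | cutFrTerm e => exact h1.ge
  | fr e => exact h1.le
  | _ => exact h1

end Der

/-! ## Comparison of sequents -/

section Compare

variable {B : Fm L 2} {Cr : List (Crit L)} {r s : Ordinal.{0}} {Θ Θ' Ξ Ξ' Ψ Ψ' : Sequent L}
  {e : CExpr L} {u : Val} {f : Option Bool}

-- Updates of a sequent at a single expression

open Classical in
/-- `Θ'` is obtained from `Θ` by giving values to a single expression. -/
structure Sequent.Upd (Θ Θ' : Sequent L) (e : CExpr L) (u : Val) (f : Option Bool) : Prop where
  S : Θ'.S = Function.update Θ.S e (some u)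
  P : Θ'.P = Θ.P
  V : Θ'.V = Θ.V
  F : Θ'.F = Function.update Θ.F e f

theorem Sequent.upd_addUnk (i : Bool) : Θ.Upd (Θ.addUnk e i) e .unk (some i) :=
  ⟨rfl, rfl, rfl, rfl⟩

theorem Sequent.upd_addNumF (k : ℕ) (i : Bool) : Θ.Upd (Θ.addNumF e k i) e (.num k) (some i) :=
  ⟨rfl, rfl, rfl, rfl⟩

open Classical in
theorem Sequent.upd_addNum (hΘ : Θ.IsSequent B) (he : Θ.S e = none) (k : ℕ) :
    Θ.Upd (Θ.addNum e k) e (.num k) none :=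
  ⟨rfl, rfl, rfl, by rw [← hΘ.F_eq_none he, Function.update_eq_self]; rfl⟩

theorem Sequent.Upd.S_self (h : Θ.Upd Θ' e u f) : Θ'.S e = some u := by simp [h.S]

theorem Sequent.Upd.S_ne (h : Θ.Upd Θ' e u f) {x : CExpr L} (hx : x ≠ e) : Θ'.S x = Θ.S x := by
  simp [h.S, hx]

theorem Sequent.Upd.F_self (h : Θ.Upd Θ' e u f) : Θ'.F e = f := by simp [h.F]

theorem Sequent.Upd.F_ne (h : Θ.Upd Θ' e u f) {x : CExpr L} (hx : x ≠ e) : Θ'.F x = Θ.F x := by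
  simp [h.F, hx]

theorem Sequent.Upd.le (h : Θ.Upd Θ' e u f) (he : Θ.S e = none) : Θ.S.Le Θ'.S := by
  intro x w hx
  have : x ≠ e := by rintro rfl; simp [he] at hx
  rw [h.S_ne this, hx]

variable [L.Structure ℕ]

-- Invariants along paths and derivations

/-- No value of rank `< s` is frozen as `t`; if `Ω < s` then `P` is admissible and only finitely many
`c_n` have the value `?` while `n ∈ I` has none. -/
structure Good (B : Fm L 2) (s : Ordinal.{0}) (Θ : Sequent L) : Prop where
  F_lt : ∀ x, rk B x < s → Θ.F x ≠ some true
  adm : Om < s → Admissible B Θ.P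
  fin : Om < s → {n | Θ.S (cTerm B n) = some .unk ∧ Θ.S (.mem n) = none}.Finite

theorem Good.empty : Good B s (Sequent.empty : Sequent L) where
  F_lt := by simp [Sequent.empty]
  adm := by simp [Sequent.empty, Admissible]
  fin := by simp [Sequent.empty]

theorem Good.mono (h : Good B s Θ) (hr : r ≤ s) : Good B r Θ where
  F_lt x hx := h.F_lt x (hx.trans_le hr)
  adm hx := h.adm (hx.trans_le hr)
  fin hx := h.fin (hx.trans_le hr)

theorem Good.upd (h : Good B s Θ) (hu : Θ.Upd Θ' e u f) (he : Θ.S e = none)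
    (hf : rk B e < s → f ≠ some true) : Good B s Θ' where
  F_lt x hx := by
    by_cases hxe : x = e
    · subst hxe; rw [hu.F_self]; exact hf hx
    · rw [hu.F_ne hxe]; exact h.F_lt x hx
  adm hs := hu.P ▸ h.adm hs
  fin hs := by
    -- An update enlarges the exceptional set by at most the one `n` with `c_n = e`.
    have h1 : {n | cTerm B n = e}.Subsingleton := by
      intro m hm n hn
      have : cTerm B m = cTerm B n := hm.trans hn.symm
      simp only [cTerm, CExpr.term.injEq, heq_eq_eq, true_and] at this
      exact congrFun this 0
    refine ((h.fin hs).union h1.finite).subset ?_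
    rintro n ⟨h2, h3⟩
    by_cases hn : cTerm B n = e
    · exact Or.inr hn
    · refine Or.inl ⟨by rw [← hu.S_ne hn, h2], ?_⟩
      by_cases hn' : .mem n = e
      · exact hn' ▸ he
      · rw [← hu.S_ne hn', h3]

theorem Good.addForms (h : Good B s Θ) {n : ℕ} {Pe : List ℕ} {Ve : ℕ → Option (Subst L)}
    (hP : Proper B n Θ Pe) : Good B s (Θ.addForms Pe Ve false) where
  F_lt x hx := by
    cases x with
    | term φ a => exact h.F_lt _ hx
    | mem m =>
      simp only [Sequent.addForms]
      split_ifs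
      · simp
      · exact h.F_lt _ hx
  adm _ := hP.admissible
  fin hs := by
    refine (h.fin hs).subset ?_
    rintro m ⟨h2, h3⟩
    refine ⟨h2, ?_⟩
    simp only [Sequent.addForms] at h3
    split_ifs at h3
    exact h3

theorem Good.hStep (h : Good B s Θ) (hΘ : Θ.IsSequent B) {v : Val} (he : s ≤ rk B e) :
    Good B s (hStep B Θ e v) where
  F_lt x hx := by
    rw [hStep_F_of_eq hΘ (hSubst_of_rk_lt (hx.trans_le he))]
    exact h.F_lt x hx
  adm hs := by
    show Admissible B (hSeq B Θ e)
    rw [hSeq_of_gt (hs.trans_le he)]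
    exact h.adm hs
  fin hs := by
    have h1 : rk B (.mem 0) < rk B e := hs.trans_le he
    refine (h.fin hs).subset ?_
    rintro m ⟨h2, h3⟩
    change hSubst B Θ e v _ = _ at h2 h3
    rw [hSubst_of_rk_lt (by rwa [rk_cTerm])] at h2
    rw [hSubst_of_rk_lt (by exact h1)] at h3
    exact ⟨h2, h3⟩

/-- A `Cut` freezes with `f`, at whatever rank. The rules that freeze with `t` or rearrange the
substitution have rank at least `s` and leave lower ranks alone. -/
theorem Good.step (h : Good B s Θ) (hΘ : Θ.IsSequent B) {R : Rule L}
    (hR : R.name = .Cut ∨ s ≤ rk B R.main) (ha : R.Applies B Cr Θ)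
    (hp : Θ' ∈ R.premises B Θ) : Good B s Θ' := by
  cases R with
  | cut e =>
    rcases hp with rfl | ⟨k, hk, rfl⟩
    · exact h.upd (Sequent.upd_addUnk _) ha.2.2.2 (by simp)
    · exact h.upd (Sequent.upd_addNum hΘ ha.2.2.2 _) ha.2.2.2 (by simp)
  | cutTerm e =>
    rcases hp with rfl | ⟨k, hk, rfl⟩
    · exact h.upd (Sequent.upd_addUnk _) ha.2.2.2 (by simp)
    · exact h.upd (Sequent.upd_addNumF _ _) ha.2.2.2 (by simp)
  | cutFr e =>
    have hR : s ≤ rk B e := hR.resolve_left (by simp [Rule.name])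
    rcases hp with rfl | ⟨k, hk, rfl⟩
    · exact h.upd (Sequent.upd_addUnk _) ha.2.2.2 fun h => absurd hR h.not_ge
    · exact h.upd (Sequent.upd_addNum hΘ ha.2.2.2 _) ha.2.2.2 (by simp)
  | cutFrTerm e =>
    have hR : s ≤ rk B e := hR.resolve_left (by simp [Rule.name])
    rcases hp with rfl | ⟨k, hk, rfl⟩
    · exact h.upd (Sequent.upd_addUnk _) ha.2.2.2 fun h => absurd hR h.not_ge
    · exact h.upd (Sequent.upd_addNumF _ _) ha.2.2.2 (by simp)
  | cutForm n =>
    rcases hp with rfl | ⟨Pe, Ve, hP, hV, rfl⟩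
    · exact h.upd (Sequent.upd_addUnk _) ha (by simp)
    · exact h.addForms hP
  | fr e =>
    have hR : s ≤ rk B e := hR.resolve_left (by simp [Rule.name])
    cases hp
    exact h.upd (Sequent.upd_addUnk _) ha.2 fun h => absurd hR h.not_ge
  | h e v =>
    have hR : s ≤ rk B e := hR.resolve_left (by simp [Rule.name])
    cases hp
    exact h.hStep hΘ hR

theorem Reach.good (h : Reach B Cr r Θ) : Good B r Θ := by
  induction h with
  | empty => exact Good.empty
  | step h R hR ha hp hΘ' ih =>
    refine ih.step h.isSequent ?_ ha hp
    cases R with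
    | cutFr e => exact absurd hR (not_lt_of_ge bot_le)
    | cutFrTerm e => exact absurd hR (not_lt_of_ge bot_le)
    | fr e => exact Or.inr hR
    | h e v => exact Or.inr hR
    | _ => exact Or.inl rfl

-- Weakening by values of low rank

/-- The part of rank `≤ r` of `Θ` is contained in `Ψ`. -/
structure Base (B : Fm L 2) (r : Ordinal.{0}) (Θ Ψ : Sequent L) : Prop where
  sub : ∀ x u, rk B x ≤ r → Θ.S x = some u → Ψ.S x = some u
  -- Below `r` flags need not be compared: `Good.F_lt` already excludes `t` there.
  F_eq : ∀ x, rk B x = r → Θ.F x = some false → Ψ.F x = some false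
  P : Om < r → Θ.P <+: Ψ.P
  V : Om < r → ∀ m W, Θ.V m = some W → Ψ.V m = some W

omit [L.Structure ℕ] in
theorem Base.refl (Θ : Sequent L) : Base B r Θ Θ :=
  ⟨fun _ _ _ h => h, fun _ _ h => h, fun _ => List.prefix_rfl, fun _ _ _ h => h⟩

/-- `Ψ` is `Ξ` with further correct values of rank `≤ r`. -/
structure Wk (B : Fm L 2) (r : Ordinal.{0}) (Ξ Ψ : Sequent L) : Prop extends Base B r Ξ Ψ where
  seq : Ψ.IsSequent B
  good : Good B r Ψ
  S_gt : ∀ x, r < rk B x → Ψ.S x = Ξ.S x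
  F_gt : ∀ x, r < rk B x → Ψ.F x = Ξ.F x
  P_eq : r < Om → Ψ.P = Ξ.P
  V_eq : r < Om → Ψ.V = Ξ.V
  -- Required of `Ψ.S` itself and not just of its extension by `?`, since `HApplies` asks for these
  -- conditions to be decided in the substitution.
  new : ∀ x u, x.IsTerm → Ξ.S x = none → Ψ.S x = some u → Models Ψ.S (justif B x u)

theorem Wk.le (w : Wk B r Ξ Ψ) : Ξ.S.Le Ψ.S := by
  intro x u hx
  rcases le_or_gt (rk B x) r with h | h
  · exact w.sub x u h hx
  · rw [w.S_gt x h, hx]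

theorem Wk.prefix (hr : r ≠ Om) (w : Wk B r Ξ Ψ) : Ξ.P <+: Ψ.P := by
  rcases hr.lt_or_gt with h | h
  · rw [w.P_eq h]
  · exact w.P h

theorem Wk.upd (w : Wk B r Ξ Ψ) (h : Ξ.Upd Ξ' e u f) (h' : Ψ.Upd Ψ' e u f) (he : Ψ.S e = none)
    (hΨ' : Ψ'.IsSequent B) (hf : rk B e < r → f ≠ some true) : Wk B r Ξ' Ψ' where
  sub x u' hx hxu := by
    by_cases hxe : x = e
    · subst hxe; rw [h'.S_self, ← hxu, h.S_self]
    · rw [h'.S_ne hxe, w.sub x u' hx (by rw [← h.S_ne hxe, hxu])]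
  F_eq x hx hxf := by
    by_cases hxe : x = e
    · subst hxe; rw [h'.F_self, ← hxf, h.F_self]
    · rw [h'.F_ne hxe, w.F_eq x hx (by rw [← h.F_ne hxe, hxf])]
  P hr := by rw [h.P, h'.P]; exact w.P hr
  V hr := by rw [h.V, h'.V]; exact w.V hr
  seq := hΨ'
  good := w.good.upd h' he hf
  S_gt x hx := by
    by_cases hxe : x = e
    · subst hxe; rw [h'.S_self, h.S_self]
    · rw [h'.S_ne hxe, h.S_ne hxe, w.S_gt x hx]
  F_gt x hx := by
    by_cases hxe : x = e
    · subst hxe; rw [h'.F_self, h.F_self]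
    · rw [h'.F_ne hxe, h.F_ne hxe, w.F_gt x hx]
  P_eq hr := by rw [h.P, h'.P]; exact w.P_eq hr
  V_eq hr := by rw [h.V, h'.V]; exact w.V_eq hr
  new x u' hx hn hxu := by
    have hxe : x ≠ e := by rintro rfl; simp [h.S_self] at hn
    rw [h.S_ne hxe] at hn
    rw [h'.S_ne hxe] at hxu
    exact (w.new x u' hx hn hxu).mono (h'.le he)

/-- Serves a cut on an expression that `Ψ` already evaluates: the premise agreeing with `Ψ` is the
one to follow. -/
theorem Wk.upd_left (w : Wk B r Ξ Ψ) (h : Ξ.Upd Ξ' e u f) (he : Ψ.S e = some u)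
    (her : rk B e ≤ r) (hf : rk B e = r → f = some false → Ψ.F e = some false) :
    Wk B r Ξ' Ψ where
  sub x u' hx hxu := by
    by_cases hxe : x = e
    · subst hxe; rw [he, ← hxu, h.S_self]
    · exact w.sub x u' hx (by rw [← h.S_ne hxe, hxu])
  F_eq x hx hxf := by
    by_cases hxe : x = e
    · subst hxe; exact hf hx (by rw [← h.F_self, hxf])
    · exact w.F_eq x hx (by rw [← h.F_ne hxe, hxf])
  P hr := by rw [h.P]; exact w.P hr
  V hr := by rw [h.V]; exact w.V hr
  seq := w.seq
  good := w.good
  S_gt x hx := by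
    have hxe : x ≠ e := by rintro rfl; exact hx.not_ge her
    rw [h.S_ne hxe, w.S_gt x hx]
  F_gt x hx := by
    have hxe : x ≠ e := by rintro rfl; exact hx.not_ge her
    rw [h.F_ne hxe, w.F_gt x hx]
  P_eq hr := by rw [h.P]; exact w.P_eq hr
  V_eq hr := by rw [h.V]; exact w.V_eq hr
  new x u' hx hn hxu := by
    have hxe : x ≠ e := by rintro rfl; simp [h.S_self] at hn
    exact w.new x u' hx (by rw [← h.S_ne hxe, hn]) hxu

/-- Further formulas `n ∈ I` may be evaluated in a weakening of rank `r > Ω`. -/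
theorem Wk.right (hr : Om < r) (w : Wk B r Ξ Ψ) (hΨ' : Ψ'.IsSequent B) (hg : Good B r Ψ')
    (hS : ∀ x, x.IsTerm → Ψ'.S x = Ψ.S x) (hF : ∀ x, x.IsTerm → Ψ'.F x = Ψ.F x)
    (hle : Ψ.S.Le Ψ'.S) (hP : Ψ.P <+: Ψ'.P) (hV : ∀ m W, Ψ.V m = some W → Ψ'.V m = some W) :
    Wk B r Ξ Ψ' where
  sub x u hx hxu := hle _ _ (w.sub x u hx hxu)
  F_eq x hx hxf := by
    rw [hF x (isTerm_of_rk_ne (B := B) (by rw [hx]; exact hr.ne'))]; exact w.F_eq x hx hxf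
  P _ := (w.P hr).trans hP
  V _ m W h := hV _ _ (w.V hr m W h)
  seq := hΨ'
  good := hg
  S_gt x hx := by
    rw [hS x (isTerm_of_rk_ne (B := B) (hr.trans hx).ne')]; exact w.S_gt x hx
  F_gt x hx := by
    rw [hF x (isTerm_of_rk_ne (B := B) (hr.trans hx).ne')]; exact w.F_gt x hx
  P_eq h := absurd hr h.not_gt
  V_eq h := absurd hr h.not_gt
  new x u hx hn hxu := (w.new x u hx hn (by rw [← hS x hx, hxu])).mono hle

theorem Wk.right_unk (hr : Om < r) (w : Wk B r Ξ Ψ) {n : ℕ} (hn : Ψ.S (.mem n) = none) :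
    Wk B r Ξ (Ψ.addUnk (.mem n) false) := by
  have hu : Ψ.Upd (Ψ.addUnk (.mem n) false) (.mem n) .unk (some false) := Sequent.upd_addUnk _
  have hne : ∀ x : CExpr L, x.IsTerm → x ≠ .mem n := by rintro x hx rfl; exact hx
  exact w.right hr (w.seq.addUnk hn trivial _) (w.good.upd hu hn (by simp))
    (fun x hx => hu.S_ne (hne x hx)) (fun x hx => hu.F_ne (hne x hx)) (hu.le hn)
    List.prefix_rfl (fun _ _ h => h)

theorem Wk.right_forms (hr : Om < r) (w : Wk B r Ξ Ψ) {n : ℕ} {Pe : List ℕ}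
    {Ve : ℕ → Option (Subst L)} (hP : Proper B n Ψ Pe) (hV : IsHist B Pe Ve) :
    Wk B r Ξ (Ψ.addForms Pe Ve false) := by
  refine w.right hr (w.seq.addForms hP hV _) (w.good.addForms hP) ?_ ?_ ?_
    (List.prefix_append _ _) ?_
  · rintro (x | x) hx
    · rfl
    · exact hx.elim
  · rintro (x | x) hx
    · rfl
    · exact hx.elim
  · rintro (x | m) u hu
    · exact hu
    · have : m ∉ Pe := fun h => by rw [hP.fresh m h] at hu; cases hu
      simpa [Sequent.addForms, this] using hu
  · intro m W h
    have : m ∉ Pe := fun hm => hP.disjoint m hm ((w.seq.dom_V m).1 (by simp [h]))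
    simpa [Sequent.addForms, this] using h

-- Serves a cut on `n ∈ I` when `Ψ` already makes it true: the missing segment of `Ψ.P` is added to
-- `Ξ` with the histories that `Ψ` assigns to it.
open Classical in
theorem Wk.left_forms (hr : Om < r) (w : Wk B r Ξ Ψ) {Q : List ℕ} (hQ : Ξ.P ++ Q <+: Ψ.P) :
    Wk B r (Ξ.addForms Q (fun m => if m ∈ Q then Ψ.V m else none) false) Ψ where
  sub x u hx hxu := by
    rcases x with x | m
    · exact w.sub _ u hx hxu
    · simp only [Sequent.addForms] at hxu
      split_ifs at hxu with hm
      · rw [← hxu]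
        exact (w.seq.mem_P m).1 (hQ.subset (List.mem_append_right _ hm))
      · exact w.sub _ u hx hxu
  F_eq x hx hxf := by
    rcases x with x | m
    · exact w.F_eq _ hx hxf
    · exact absurd hx hr.ne
  P _ := hQ
  V _ m W h := by
    simp only [Sequent.addForms] at h
    split_ifs at h
    · exact h
    · exact w.V hr m W h
  seq := w.seq
  good := w.good
  S_gt x hx := by
    rcases x with x | m
    · exact w.S_gt _ hx
    · exact absurd hx hr.not_gt
  F_gt x hx := by
    rcases x with x | m
    · exact w.F_gt _ hx
    · exact absurd hx hr.not_gt
  P_eq h := absurd hr h.not_gt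
  V_eq h := absurd hr h.not_gt
  new x u hx hn hxu := by
    rcases x with x | m
    · exact w.new _ u hx hn hxu
    · exact hx.elim

/-- Initial segments of admissible sequences are admissible. A numerical value of `c_m` in `Ξ` would
make `Ψ` computationally inconsistent, and a value of `m ∈ I` in `Ξ` would have to be `⊤`, so that
`m` would occur twice in `Ψ.P`. -/
theorem Wk.proper (hr : Om < r) (hΞ : Ξ.IsSequent B) (w : Wk B r Ξ Ψ)
    (hF : ¬ CompInconsistent B Ψ.S) {Q : List ℕ} (hQ : Ξ.P ++ Q <+: Ψ.P) {n : ℕ}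
    (hn : Q.getLast? = some n) : Proper B n Ξ Q := by
  have hnd : (Ξ.P ++ Q).Nodup := w.seq.nodup.sublist hQ.sublist
  have htop : ∀ m ∈ Q, Ψ.S (.mem m) = some .top := fun m hm =>
    (w.seq.mem_P m).1 (hQ.subset (List.mem_append_right _ hm))
  have hdisj : ∀ m ∈ Q, m ∉ Ξ.P := fun m hm hm' =>
    (List.nodup_append.1 hnd).2.2 m hm' m hm rfl
  refine ⟨(List.nodup_append.1 hnd).2.1, fun m hm u hu => ?_, ?_, hn, hdisj, fun m hm => ?_⟩
  · have hu' := w.le _ _ hu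
    rcases (w.seq.isSubst _ _ hu').2.term_cases trivial with rfl | ⟨k, -, rfl⟩
    · rfl
    · exact absurd (Or.inr ⟨m, k, hu', htop m hm⟩) hF
  · obtain ⟨T, hT⟩ := hQ
    intro P₁ k P₂ h
    exact w.good.adm hr P₁ k (P₂ ++ T) (by rw [← hT, h]; simp)
  · cases h : Ξ.S (.mem m) with
    | none => rfl
    | some u =>
      have h' := w.le _ _ h
      rw [htop m hm] at h'
      cases h'
      exact absurd ((hΞ.mem_P m).2 h) (hdisj m hm)

/-- The `H`-step that applies to `Ξ` also applies to its weakening. -/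
theorem HApplies.wk (hB : B.SkolemFree) (hBpos : B.OnlySign true) (hr : r ≠ Om)
    (w : Wk B r Ξ Ψ) {v : Val} (h : HApplies B Cr Ξ e v) (hF : ¬ CompInconsistent B Ψ.S)
    (hunk : rk B e = Om → Om < r →
      ∀ n, Ψ.S (cTerm B n) = some .unk → (Ψ.S (.mem n)).isSome) :
    HApplies B Cr Ψ e v where
  correct x u hx := by
    cases x with
    | mem n =>
      rcases (w.seq.isSubst _ _ hx).2.mem_cases with rfl | rfl
      · exact ⟨trivial, trivial⟩
      -- For `r < Ω` nothing of rank `Ω` is new, and `A(n, I)` depends on that rank only. For `r >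
      -- Ω` the formula `n ∈ I` may be new, and admissibility of `Ψ.P` justifies it.
      · rcases hr.lt_or_gt with hr | hr
        · refine models_formA_congr hB (fun y hy => ?_)
            (h.correct (.mem n) .top (by rw [← w.S_gt (.mem n) hr, hx]))
          unfold Subst.ext
          rw [w.S_gt y (hy ▸ hr)]
        · exact (w.good.adm hr).models_formA hB hBpos w.seq.isSubst w.seq.mem_P hF hx
    | term φ a =>
      cases hΞ : Ξ.S (.term φ a) with
      | none => exact (w.new (.term φ a) u trivial hΞ hx).mono (Subst.le_ext _)
      | some u' =>
        have := w.le _ _ hΞ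
        rw [hx] at this
        cases this
        exact (((h.decides_justif (.term φ a) u trivial hΞ).models_of_le (Subst.le_ext _)
          (h.correct _ u hΞ)).mono w.le).mono (Subst.le_ext _)
  decides_crit c hc := (h.decides_crit c hc).mono w.le
  computes c hc hneg := by
    obtain ⟨e', v', h'⟩ := h.computes c hc ((h.decides_crit c hc).elim
      (fun h => absurd hneg (h.mono w.le).not_neg) id)
    exact ⟨e', v', h'.mono w.le (w.prefix hr)⟩
  selected := by
    obtain ⟨i, h1, h2, h3⟩ := h.selected
    refine ⟨i, h1.mono w.le, h2.mono w.le (w.prefix hr), fun j e' v' hneg hp => ?_⟩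
    have hj : Cr.get j ∈ Cr := List.get_mem _ _
    have hneg' := (h.decides_crit _ hj).elim (fun h => absurd hneg (h.mono w.le).not_neg) id
    obtain ⟨e'', v'', h'⟩ := h.computes _ hj hneg'
    obtain ⟨rfl, rfl⟩ := (h'.mono w.le (w.prefix hr)).unique hp
    exact h3 j _ _ hneg' h'
  decides_justif x u hx hxu := by
    cases hΞ : Ξ.S x with
    | none => exact (w.new _ u hx hΞ hxu).decides
    | some u' =>
      have := w.le _ _ hΞ
      rw [hxu] at this
      cases this
      exact (h.decides_justif x u hx hΞ).mono w.le
  decides_new := h.decides_new.mono w.le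
  unk := w.le _ _ h.unk
  mem_dom n hn := w.le.ne_none (h.mem_dom n hn)
  cTerm_dom n hn := w.le.ne_none (h.cTerm_dom n hn)
  mem_dom_of_unk ht he n hn := by
    rcases hr.lt_or_gt with hlt | hlt
    · exact w.le.ne_none (h.mem_dom_of_unk ht he n
        (by rw [← w.S_gt _ (by rwa [rk_cTerm]), hn]))
    · exact hunk he hlt n hn

/-- An `H`-step of rank `≥ r` treats ranks above `r` alike on both sides and keeps all values of
rank `≤ r` except that of `e`. The added values stay justified because `F(x, u)` is evaluated at
ranks below `r`, which are untouched. -/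
theorem Wk.hStep (hB : B.SkolemFree) (hBI : B.HasI) (hr : r ≠ Om) (w : Wk B r Ξ Ψ)
    (hΞ : Ξ.IsSequent B) {v : Val} (h : HApplies B Cr Ψ e v) (her : r ≤ rk B e)
    (hΞ' : (hStep B Ξ e v).IsSequent B) :
    Wk B r (hStep B Ξ e v) (hStep B Ψ e v) := by
  obtain ⟨hv, hvu⟩ := h.fits w.seq.isSubst
  have hgt : ∀ x, r < rk B x → hSubst B Ψ e v x = hSubst B Ξ e v x := fun x hx =>
    hSubst_congr hr her w.S_gt w.P_eq w.V_eq hx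
  have hseq : (EpsID1.hStep B Ψ e v).IsSequent B := by
    refine hStep_isSequent w.seq hv h.unk hvu ?_
    rintro n rfl
    -- As `r < Ω`, both sides store the same history, so its finiteness can be read off the sequent
    -- `hStep B Ξ e v`.
    have hlt : r < Om := lt_of_le_of_ne her hr
    rw [negPart_congr (fun x hx => w.S_gt x (hx ▸ hlt))]
    exact (hΞ'.val_V n (negPart B Ξ.S) (by simp [EpsID1.hStep, hHist])).2.1
  refine ⟨⟨?_, ?_, ?_, ?_⟩, hseq, w.good.hStep w.seq her, hgt, ?_, ?_, ?_, ?_⟩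
  · intro x u hx hxu
    change hSubst B _ e v x = _ at hxu ⊢
    by_cases hxe : x = e
    · subst hxe; rwa [hSubst_self] at hxu ⊢
    · rw [hSubst_of_rk_le hr her hx hxe] at hxu ⊢
      exact w.sub x u hx hxu
  · intro x hx hxf
    by_cases hxe : x = e
    · subst hxe
      rw [hStep_F_self (hx ▸ hr) hvu] at hxf
      cases hxf
    · rw [hStep_F_of_eq hΞ (hSubst_of_rk_le hr her hx.le hxe)] at hxf
      rw [hStep_F_of_eq w.seq (hSubst_of_rk_le hr her hx.le hxe)]
      exact w.F_eq x hx hxf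
  · intro hlt
    show hSeq B Ξ e <+: hSeq B Ψ e
    rw [hSeq_of_gt (hlt.trans_le her), hSeq_of_gt (hlt.trans_le her)]
    exact w.P hlt
  · intro hlt
    show ∀ m W, hHist B Ξ e m = some W → hHist B Ψ e m = some W
    rw [hHist_of_gt hΞ (hlt.trans_le her), hHist_of_gt w.seq (hlt.trans_le her)]
    exact w.V hlt
  · intro x hx
    unfold EpsID1.hStep
    dsimp only
    rw [hgt x hx, w.S_gt x hx, w.F_gt x hx]
  · intro hlt
    exact hSeq_congr (w.P_eq hlt)
  · intro hlt
    exact hHist_congr (fun x hx => w.S_gt x (hx ▸ hlt)) (w.P_eq hlt) (w.V_eq hlt)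
  · intro x u hx hn hxu
    change hSubst B _ e v x = _ at hn hxu
    have hxe : x ≠ e := by rintro rfl; simp at hn
    have hxr : rk B x ≤ r := by
      by_contra hlt
      rw [hgt x (not_le.1 hlt), hn] at hxu
      cases hxu
    rw [hSubst_of_rk_le hr her hxr hxe] at hn hxu
    exact models_justif_congr hB hBI hr
      (fun y hy => (hSubst_of_rk_lt (hy.trans_le her)).symm) hx hxr (w.new x u hx hn hxu)

end Compare

/-! ## Weakening -/

section Weakening

variable {B : Fm L 2} {Cr : List (Crit L)} {r : Ordinal.{0}} {Θ Θ' Ξ Ψ K : Sequent L}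
  {e x : CExpr L} {u v : Val} {f : Option Bool}

theorem Sequent.IsSequent.F_eq_false (hΘ : Θ.IsSequent B) (hx : Θ.S x = some .unk)
    (h : Θ.F x ≠ some true) : Θ.F x = some false := by
  obtain ⟨b, hb⟩ := Option.isSome_iff_exists.1 ((hΘ.dom_F x).2 (Or.inl hx))
  cases b
  · exact hb
  · exact absurd hb h

theorem Active.eq_of_rk_ne (he : rk B e ≠ Om) (h : Active B Θ e v x) : x = e := by
  by_contra hx
  apply h.2.2
  rw [hSubst_of_rk_ne he hx, if_pos h.2.1.le]

theorem active_self (he : Θ.S e = some .unk) (hv : v ≠ .unk) : Active B Θ e v e := by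
  refine ⟨by simp [he], rfl, ?_⟩
  rw [hSubst_self, he]
  simpa using hv

variable [L.Structure ℕ]

theorem Wk.active_iff (hr : r ≠ Om) (w : Wk B r Ξ Ψ) (he : r ≤ rk B e) (hx : r < rk B x) :
    Active B Ψ e v x ↔ Active B Ξ e v x := by
  unfold Active
  rw [w.S_gt x hx, hSubst_congr hr he w.S_gt w.P_eq w.V_eq hx]

/-- If `rk e < r`, the flag of `e` is `f` because `t` is excluded. If `rk e > r`, the active witness
and its flag are unchanged. At rank `r ≠ Ω` the witness is `e` itself, and `Base` transports its
flag `f`. -/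
theorem Wk.axH (hr : r ≠ Om) (w : Wk B r Ξ Ψ) (h : AxH B Cr e v Ξ) (hΨ : HApplies B Cr Ψ e v) :
    AxH B Cr e v Ψ := by
  obtain ⟨-, x, hx, hxf⟩ := h
  have hself := active_self (B := B) hΨ.unk (hΨ.fits w.seq.isSubst).2
  have hlt : rk B e < r → AxH B Cr e v Ψ := fun h =>
    ⟨hΨ, e, hself, w.seq.F_eq_false hΨ.unk (w.good.F_lt e h)⟩
  by_cases he : rk B e = Om
  · rcases hr.lt_or_gt with h | h
    · have hxr : r < rk B x := by rw [hx.2.1, he]; exact h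
      exact ⟨hΨ, x, (w.active_iff hr (he ▸ h.le) hxr).2 hx, by rw [w.F_gt x hxr, hxf]⟩
    · exact hlt (he ▸ h)
  · cases hx.eq_of_rk_ne he
    rcases lt_trichotomy (rk B e) r with h | h | h
    · exact hlt h
    · exact ⟨hΨ, e, hself, w.F_eq e h hxf⟩
    · exact ⟨hΨ, e, hself, by rw [w.F_gt e h, hxf]⟩

/-- An instance of `AxH` can be weakened, after the missing formulas `n ∈ I` have been cut. -/
theorem AxH.weaken (hB : B.SkolemFree) (hBpos : B.OnlySign true) (hr : r ≠ Om)
    (h : AxH B Cr e v Ξ) (w : Wk B r Ξ Ψ) : Der B Cr (Rule.OkPlus B r) Ψ := by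
  by_cases hcase : rk B e = Om ∧ Om < r
  · obtain ⟨he, hlt⟩ := hcase
    -- For an axiom of rank `Ω < r`, the weakening may contain `(c_n, ?)` without a value of `n ∈
    -- I`, contrary to `mem_dom_of_unk`. There are finitely many such `n` by `Good.fin`; each cut on
    -- `n ∈ I` lowers their number, since no term receives a value.
    obtain ⟨k, hk⟩ : ∃ k,
        {n | Ψ.S (cTerm B n) = some .unk ∧ Ψ.S (.mem n) = none}.ncard = k := ⟨_, rfl⟩
    induction k using Nat.strong_induction_on generalizing Ψ with
    | _ k ih =>
      by_cases hF : CompInconsistent B Ψ.S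
      · exact .ax w.seq (Or.inl hF)
      by_cases hn : ∃ n, Ψ.S (cTerm B n) = some .unk ∧ Ψ.S (.mem n) = none
      · obtain ⟨n, hn1, hn2⟩ := hn
        refine .infer w.seq (.cutForm n) hlt hn2 ?_
        have step : ∀ Ψ', Wk B r Ξ Ψ' → Ψ.S.Le Ψ'.S → (Ψ'.S (.mem n)).isSome →
            (∀ x, x.IsTerm → Ψ'.S x = Ψ.S x) → Der B Cr (Rule.OkPlus B r) Ψ' := by
          intro Ψ' w' hle hm hS
          refine ih _ ?_ w' rfl
          rw [← hk]
          refine Set.ncard_lt_ncard ⟨?_, fun hsub => ?_⟩ (w.good.fin hlt)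
          · rintro m ⟨h1, h2⟩
            refine ⟨by rw [← hS (cTerm B m) trivial, h1], ?_⟩
            cases h3 : Ψ.S (.mem m) with
            | none => rfl
            | some u => rw [hle _ _ h3] at h2; cases h2
          · have := (hsub ⟨hn1, hn2⟩).2
            simp [this] at hm
        rintro Ψ' (rfl | ⟨Pe, Ve, hP, hV, rfl⟩)
        · have hu : Ψ.Upd (Ψ.addUnk (.mem n) false) (.mem n) .unk (some false) :=
            Sequent.upd_addUnk _
          refine step _ (w.right_unk hlt hn2) (hu.le hn2) (by simp [hu.S_self]) fun x hx =>
            hu.S_ne ?_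
          rintro rfl
          exact hx
        · refine step _ (w.right_forms hlt hP hV) ?_ ?_ ?_
          · rintro (x | m) u hu
            · exact hu
            · have : m ∉ Pe := fun h => by rw [hP.fresh m h] at hu; cases hu
              simpa [Sequent.addForms, this] using hu
          · have : n ∈ Pe := List.mem_of_getLast? hP.last
            simp [Sequent.addForms, this]
          · rintro (x | m) hx
            · rfl
            · exact hx.elim
      · refine .ax w.seq (Or.inr (Or.inr ⟨e, v, w.axH hr h (h.1.wk hB hBpos hr w hF ?_)⟩))
        intro _ _ n hn1
        by_contra hn2
        exact hn ⟨n, hn1, by simpa using hn2⟩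
  · by_cases hF : CompInconsistent B Ψ.S
    · exact .ax w.seq (Or.inl hF)
    · exact .ax w.seq (Or.inr (Or.inr ⟨e, v, w.axH hr h
        (h.1.wk hB hBpos hr w hF fun h1 h2 => absurd ⟨h1, h2⟩ hcase)⟩))

/-- Induction on the derivation of `Ξ`. A cut on an expression that `Ψ` evaluates collapses to the
matching premise, and rules of rank above `r` concern a part on which `Ξ` and `Ψ` agree. Whenever
`Ψ` becomes computationally inconsistent, `AxF` ends the branch. -/
theorem Der.weaken (hB : B.SkolemFree) (hBI : B.HasI) (hBpos : B.OnlySign true) (hr : r ≠ Om)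
    (h : Der B Cr (Rule.OkPlus B r) Ξ) (w : Wk B r Ξ Ψ) : Der B Cr (Rule.OkPlus B r) Ψ := by
  induction h generalizing Ψ with
  | ax hΞ h =>
    rcases h with h | h | ⟨e, v, h⟩
    · exact .ax w.seq (Or.inl (CompInconsistent.mono w.le h))
    · exact .ax w.seq (Or.inr (Or.inl fun c hc => (h c hc).mono w.le))
    · exact h.weaken hB hBpos hr w
  | @infer Ξ hΞ R hR ha ds ih =>
    by_cases hF : CompInconsistent B Ψ.S
    · exact .ax w.seq (Or.inl hF)
    cases R with
    | cut e =>
      have her : rk B e < r := hR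
      obtain ⟨ht, hL, hne, heΞ⟩ := ha
      cases he : Ψ.S e with
      | none =>
        refine .infer w.seq (.cut e) hR ⟨ht, hL, hne, he⟩ ?_
        rintro Ψ' (rfl | ⟨k, hk, rfl⟩)
        · exact ih _ (Or.inl rfl) (w.upd (Sequent.upd_addUnk _) (Sequent.upd_addUnk _) he
            (w.seq.addUnk he hL _) (by simp))
        · exact ih _ (Or.inr ⟨k, hk, rfl⟩) (w.upd (Sequent.upd_addNum hΞ heΞ k)
            (Sequent.upd_addNum w.seq he k) he (w.seq.addNum he hL hne hk) (by simp))
      | some u =>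
        rcases (w.seq.isSubst _ _ he).2.term_cases ht with rfl | ⟨k, hk, rfl⟩
        · exact ih _ (Or.inl rfl) (w.upd_left (Sequent.upd_addUnk _) he her.le
            fun h => absurd h her.ne)
        · exact ih _ (Or.inr ⟨k, hk, rfl⟩) (w.upd_left (Sequent.upd_addNum hΞ heΞ k) he her.le
            fun h => absurd h her.ne)
    | cutTerm e =>
      have her : rk B e < r := hR
      obtain ⟨ht, hL, hne, heΞ⟩ := ha
      cases he : Ψ.S e with
      | none =>
        refine .infer w.seq (.cutTerm e) hR ⟨ht, hL, hne, he⟩ ?_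
        rintro Ψ' (rfl | ⟨k, hk, rfl⟩)
        · exact ih _ (Or.inl rfl) (w.upd (Sequent.upd_addUnk _) (Sequent.upd_addUnk _) he
            (w.seq.addUnk he hL _) (by simp))
        · exact ih _ (Or.inr ⟨k, hk, rfl⟩) (w.upd (Sequent.upd_addNumF k _)
            (Sequent.upd_addNumF k _) he (w.seq.addNumF he hL ht hne hk _) (by simp))
      | some u =>
        rcases (w.seq.isSubst _ _ he).2.term_cases ht with rfl | ⟨k, hk, rfl⟩
        · exact ih _ (Or.inl rfl) (w.upd_left (Sequent.upd_addUnk _) he her.le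
            fun h => absurd h her.ne)
        · exact ih _ (Or.inr ⟨k, hk, rfl⟩) (w.upd_left (Sequent.upd_addNumF k _) he her.le
            fun h => absurd h her.ne)
    | cutFr e =>
      have her : rk B e = r := hR
      obtain ⟨ht, hL, hne, heΞ⟩ := ha
      cases he : Ψ.S e with
      | none =>
        refine .infer w.seq (.cutFr e) hR ⟨ht, hL, hne, he⟩ ?_
        rintro Ψ' (rfl | ⟨k, hk, rfl⟩)
        · exact ih _ (Or.inl rfl) (w.upd (Sequent.upd_addUnk _) (Sequent.upd_addUnk _) he
            (w.seq.addUnk he hL _) fun h => absurd her h.ne)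
        · exact ih _ (Or.inr ⟨k, hk, rfl⟩) (w.upd (Sequent.upd_addNum hΞ heΞ k)
            (Sequent.upd_addNum w.seq he k) he (w.seq.addNum he hL hne hk) (by simp))
      | some u =>
        rcases (w.seq.isSubst _ _ he).2.term_cases ht with rfl | ⟨k, hk, rfl⟩
        · exact ih _ (Or.inl rfl) (w.upd_left (Sequent.upd_addUnk _) he her.le (by simp))
        · exact ih _ (Or.inr ⟨k, hk, rfl⟩) (w.upd_left (Sequent.upd_addNum hΞ heΞ k) he her.le
            (by simp))
    | cutFrTerm e =>
      have her : rk B e = r := hR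
      exact absurd (her.symm.trans ha.2.2.1) hr
    | cutForm n =>
      have hlt : Om < r := hR
      have key : ∀ Ψ', Wk B r Ξ Ψ' → (Ψ'.S (.mem n)).isSome →
          Der B Cr (Rule.OkPlus B r) Ψ' := by
        intro Ψ w hn
        obtain ⟨u, hu⟩ := Option.isSome_iff_exists.1 hn
        by_cases hF : CompInconsistent B Ψ.S
        · exact .ax w.seq (Or.inl hF)
        rcases (w.seq.isSubst _ _ hu).2.mem_cases with rfl | rfl
        · exact ih _ (Or.inl rfl) (w.upd_left (Sequent.upd_addUnk _) hu hlt.le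
            fun h => absurd h hlt.ne)
        · obtain ⟨Q, hQ⟩ := w.P hlt
          have hnQ : n ∈ Q := by
            have : n ∈ Ξ.P ++ Q := hQ ▸ (w.seq.mem_P n).2 hu
            exact (List.mem_append.1 this).resolve_left (hΞ.notMem ha)
          -- The premise to follow adds the segment of `Ψ.P` that starts after `Ξ.P` and ends at
          -- `n`.
          obtain ⟨Q₁, Q₂, rfl⟩ := List.append_of_mem hnQ
          have hpre : Ξ.P ++ (Q₁ ++ [n]) <+: Ψ.P := ⟨Q₂, by rw [← hQ]; simp⟩
          refine ih _ (Or.inr ⟨Q₁ ++ [n], _, w.proper hlt hΞ hF hpre (by simp), ?_, rfl⟩)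
            (w.left_forms hlt hpre)
          have hsome : ∀ m ∈ Q₁ ++ [n], (Ψ.V m).isSome := fun m hm =>
            (w.seq.dom_V m).2 (hpre.subset (List.mem_append_right _ hm))
          refine ⟨fun m => ?_, fun m W h => ?_⟩
          · dsimp only
            by_cases hm : m ∈ Q₁ ++ [n]
            · rw [if_pos hm]; exact iff_of_true (hsome m hm) hm
            · rw [if_neg hm]; exact iff_of_false (by simp) hm
          · dsimp only at h
            split_ifs at h
            exact w.seq.val_V _ _ h
      cases hn : Ψ.S (.mem n) with
      | some u => exact key _ w (by simp [hn])
      | none =>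
        refine .infer w.seq (.cutForm n) hR hn ?_
        rintro Ψ' (rfl | ⟨Pe, Ve, hP, hV, rfl⟩)
        · exact key _ (w.right_unk hlt hn) (by simp [Sequent.addUnk])
        -- The segment to be added to `Ξ` also comprises what `Ψ.P` already had beyond `Ξ.P`, so it
        -- may be longer than `Pe`.
        · refine key _ (w.right_forms hlt hP hV) ?_
          have : n ∈ Pe := List.mem_of_getLast? hP.last
          simp [Sequent.addForms, this]
    | fr e =>
      have her : r < rk B e := hR
      have he : Ψ.S e = none := by rw [w.S_gt e her, ha.2]
      refine .infer w.seq (.fr e) hR ⟨ha.1, he⟩ ?_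
      rintro Ψ' rfl
      exact ih _ rfl (w.upd (Sequent.upd_addUnk _) (Sequent.upd_addUnk _) he
        (w.seq.addUnk he ha.1 _) fun h => absurd her h.not_gt)
    | h e v =>
      have her : r ≤ rk B e := hR
      obtain ⟨hH, hFe, hact⟩ := ha
      have hΨ : HApplies B Cr Ψ e v := hH.wk hB hBpos hr w hF fun h1 h2 =>
        absurd (h1 ▸ her) h2.not_ge
      by_cases hFΨ : Ψ.F e = some true
      · refine .infer w.seq (.h e v) hR ⟨hΨ, hFΨ, fun x hx => ?_⟩ ?_
        · by_cases he : rk B e = Om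
          · have hxr : r < rk B x := by
              rw [hx.2.1]; exact lt_of_le_of_ne her (he ▸ hr)
            rw [w.F_gt x hxr]
            exact hact x ((w.active_iff hr her hxr).1 hx)
          · rw [hx.eq_of_rk_ne he, hFΨ]
        · rintro Ψ' rfl
          exact ih _ rfl (w.hStep hB hBI hr hΞ hΨ her (ds _ rfl).isSequent)
      -- This occurs only for `rk e = r`: in `Ξ` the expression is frozen as `t` but in `Ψ` as `f`,
      -- and the inference turns into an axiom `AxH`.
      · exact .ax w.seq (Or.inr (Or.inr ⟨e, v, hΨ, e,
          active_self hΨ.unk (hΨ.fits w.seq.isSubst).2, w.seq.F_eq_false hΨ.unk hFΨ⟩))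

/-! ## Descending along a path -/

/-- `Θ` with its part of rank `≤ r` replaced by `K`. -/
def combine (B : Fm L 2) (r : Ordinal.{0}) (K Θ : Sequent L) : Sequent L := open Classical in
  { S := fun x => if rk B x ≤ r then K.S x else Θ.S x
    P := if Om < r then K.P else Θ.P
    V := if Om < r then K.V else Θ.V
    F := fun x => if rk B x ≤ r then K.F x else Θ.F x }

/-- All expressions of `K` have rank `≤ r`, and the values of terms are justified. -/
structure Kernel (B : Fm L 2) (r : Ordinal.{0}) (K : Sequent L) : Prop where
  seq : K.IsSequent B
  good : Good B r K
  S_gt : ∀ x, r < rk B x → K.S x = none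
  models : ∀ x u, x.IsTerm → K.S x = some u → Models K.S (justif B x u)

omit [L.Structure ℕ] in
theorem combine_S_le (h : rk B x ≤ r) : (combine B r K Θ).S x = K.S x := if_pos h

omit [L.Structure ℕ] in
theorem combine_S_gt (h : r < rk B x) : (combine B r K Θ).S x = Θ.S x := if_neg h.not_ge

omit [L.Structure ℕ] in
theorem combine_F_le (h : rk B x ≤ r) : (combine B r K Θ).F x = K.F x := if_pos h

omit [L.Structure ℕ] in
theorem combine_F_gt (h : r < rk B x) : (combine B r K Θ).F x = Θ.F x := if_neg h.not_ge

omit [L.Structure ℕ] in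
theorem combine_P_gt (h : Om < r) : (combine B r K Θ).P = K.P := if_pos h

omit [L.Structure ℕ] in
theorem combine_P_lt (h : r < Om) : (combine B r K Θ).P = Θ.P := if_neg h.not_gt

omit [L.Structure ℕ] in
theorem combine_V_gt (h : Om < r) : (combine B r K Θ).V = K.V := if_pos h

omit [L.Structure ℕ] in
theorem combine_V_lt (h : r < Om) : (combine B r K Θ).V = Θ.V := if_neg h.not_gt

omit [L.Structure ℕ] in
theorem combine_ext {Φ : Sequent L} (hr : r ≠ Om)
    (hSle : ∀ x, rk B x ≤ r → Φ.S x = K.S x) (hSgt : ∀ x, r < rk B x → Φ.S x = Θ.S x)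
    (hFle : ∀ x, rk B x ≤ r → Φ.F x = K.F x) (hFgt : ∀ x, r < rk B x → Φ.F x = Θ.F x)
    (hPgt : Om < r → Φ.P = K.P ∧ Φ.V = K.V) (hPlt : r < Om → Φ.P = Θ.P ∧ Φ.V = Θ.V) :
    Φ = combine B r K Θ := by
  obtain ⟨S, P, V, F⟩ := Φ
  unfold combine
  congr 1
  · funext x
    split_ifs with h
    · exact hSle x h
    · exact hSgt x (not_le.1 h)
  · split_ifs with h
    · exact (hPgt h).1
    · exact (hPlt (lt_of_le_of_ne (not_lt.1 h) hr)).1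
  · split_ifs with h
    · exact (hPgt h).2
    · exact (hPlt (lt_of_le_of_ne (not_lt.1 h) hr)).2
  · funext x
    split_ifs with h
    · exact hFle x h
    · exact hFgt x (not_le.1 h)

omit [L.Structure ℕ] in
theorem combine_isSequent (hr : r ≠ Om) (hK : K.IsSequent B) (hΘ : Θ.IsSequent B) :
    (combine B r K Θ).IsSequent B := by
  have hx : ∀ x, (rk B x ≤ r ∧ (combine B r K Θ).S x = K.S x ∧ (combine B r K Θ).F x = K.F x) ∨
      (r < rk B x ∧ (combine B r K Θ).S x = Θ.S x ∧ (combine B r K Θ).F x = Θ.F x) := fun x =>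
    (le_or_gt (rk B x) r).imp (fun h => ⟨h, combine_S_le h, combine_F_le h⟩)
      fun h => ⟨h, combine_S_gt h, combine_F_gt h⟩
  have hS : IsSubst (combine B r K Θ).S := fun x u h => by
    rcases hx x with ⟨-, h1, -⟩ | ⟨-, h1, -⟩
    · exact hK.isSubst _ _ (h1 ▸ h)
    · exact hΘ.isSubst _ _ (h1 ▸ h)
  have hF : ∀ x, ((combine B r K Θ).F x).isSome ↔ (combine B r K Θ).S x = some .unk ∨
      (((combine B r K Θ).S x).isSome ∧ rk B x = Om) := fun x => by
    rcases hx x with ⟨-, h1, h2⟩ | ⟨-, h1, h2⟩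
    · rw [h1, h2, hK.dom_F]
    · rw [h1, h2, hΘ.dom_F]
  rcases hr.lt_or_gt with h | h
  · have hP : (combine B r K Θ).P = Θ.P := combine_P_lt h
    have hV : (combine B r K Θ).V = Θ.V := combine_V_lt h
    exact ⟨hS, hP ▸ hΘ.nodup, fun n => by rw [hP, combine_S_gt (by exact h), hΘ.mem_P],
      fun n => by rw [hP, hV, hΘ.dom_V], hV ▸ hΘ.val_V, hF⟩
  · have hP : (combine B r K Θ).P = K.P := combine_P_gt h
    have hV : (combine B r K Θ).V = K.V := combine_V_gt h
    exact ⟨hS, hP ▸ hK.nodup, fun n => by rw [hP, combine_S_le (by exact h.le), hK.mem_P],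
      fun n => by rw [hP, hV, hK.dom_V], hV ▸ hK.val_V, hF⟩

theorem combine_wk (hr : r ≠ Om) (hK : Kernel B r K) (hΘ : Θ.IsSequent B) (hb : Base B r Θ K) :
    Wk B r Θ (combine B r K Θ) := by
  refine ⟨⟨?_, ?_, ?_, ?_⟩, combine_isSequent hr hK.seq hΘ, ⟨?_, ?_, ?_⟩,
    fun x hx => combine_S_gt hx, fun x hx => combine_F_gt hx, combine_P_lt, combine_V_lt, ?_⟩
  · intro x u hx hxu
    rw [combine_S_le hx]; exact hb.sub x u hx hxu
  · intro x hx hxf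
    rw [combine_F_le hx.le]; exact hb.F_eq x hx hxf
  · intro h
    rw [combine_P_gt h]; exact hb.P h
  · intro h
    rw [combine_V_gt h]; exact hb.V h
  · intro x hx
    rw [combine_F_le hx.le]; exact hK.good.F_lt x hx
  · intro h
    rw [combine_P_gt h]; exact hK.good.adm h
  · intro h
    have h1 : ∀ n, rk B (cTerm B n) ≤ r := fun n => by rw [rk_cTerm]; exact h.le
    have h2 : ∀ n, rk B (.mem n) ≤ r := fun n => h.le
    simp only [combine_S_le (h1 _), combine_S_le (h2 _)]
    exact hK.good.fin h
  · intro x u hx hn hxu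
    have hxr : rk B x ≤ r := by
      by_contra hlt
      rw [combine_S_gt (not_le.1 hlt), hn] at hxu
      cases hxu
    rw [combine_S_le hxr] at hxu
    refine (hK.models x u hx hxu).mono fun y w hy => ?_
    have hyr : rk B y ≤ r := by
      by_contra hlt
      rw [hK.S_gt y (not_le.1 hlt)] at hy
      cases hy
    rw [combine_S_le hyr, hy]

theorem combine_empty (hr : r ≠ Om) (hK : Kernel B r K) : combine B r K Sequent.empty = K := by
  refine (combine_ext hr (fun _ _ => rfl) hK.S_gt (fun _ _ => rfl)
    (fun x hx => hK.seq.F_eq_none (hK.S_gt x hx)) (fun _ => ⟨rfl, rfl⟩) fun h => ?_).symm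
  have hP : ∀ n, n ∉ K.P := fun n => hK.seq.notMem (hK.S_gt _ h)
  refine ⟨List.eq_nil_iff_forall_not_mem.2 hP, ?_⟩
  funext n
  have := mt (hK.seq.dom_V n).1 (hP n)
  exact (by simpa using this : K.V n = none)

-- The reason why `Cut`s of rank `≤ r` on a path cost nothing: what they add is overwritten by `K`.
omit [L.Structure ℕ] in
theorem combine_upd_le (hu : Θ.Upd Θ' e u f) (he : rk B e ≤ r) :
    combine B r K Θ' = combine B r K Θ := by
  unfold combine
  rw [hu.P, hu.V]
  congr 1 <;>
  · funext x
    split_ifs with h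
    · rfl
    · have hx : x ≠ e := by rintro rfl; exact h he
      first | exact hu.S_ne hx | exact hu.F_ne hx

omit [L.Structure ℕ] in
theorem Base.of_upd (hΘ : Θ.IsSequent B) (hu : Θ.Upd Θ' e u f) (he : Θ.S e = none)
    (hb : Base B r Θ' K) : Base B r Θ K where
  sub x w hx hxw := hb.sub x w hx (hu.le he x w hxw)
  F_eq x hx hxf := hb.F_eq x hx (by
    rw [hu.F_ne, hxf]
    rintro rfl
    rw [hΘ.F_eq_none he] at hxf
    cases hxf)
  P h := hu.P ▸ hb.P h
  V h := hu.V ▸ hb.V h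

/-- A derivation of `Θ` with its part of rank `≤ r` replaced by `K` gives one of `K`, by following a
path for `Θ`. -/
theorem Reach.der_kernel (hB : B.SkolemFree) (hBpos : B.OnlySign true) (hr : r ≠ Om)
    (h : Reach B Cr (r + 1) Θ) (hK : Kernel B r K) (hb : Base B r Θ K)
    (hd : Der B Cr (Rule.OkPlus B r) (combine B r K Θ)) : Der B Cr (Rule.OkPlus B r) K := by
  induction h with
  | empty => rwa [combine_empty hr hK] at hd
  | @step Θ Θ' h R hR ha hp hΘ' ih =>
    have hΘ := h.isSequent
    have hupd : ∀ {e u f}, Θ.Upd Θ' e u f → Θ.S e = none → rk B e < r + 1 →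
        Der B Cr (Rule.OkPlus B r) K := fun hu he her =>
      ih (hb.of_upd hΘ hu he) (by rwa [← combine_upd_le hu (Order.lt_add_one_iff.1 her)])
    cases R with
    | cut e =>
      rcases hp with rfl | ⟨k, hk, rfl⟩
      · exact hupd (Sequent.upd_addUnk _) ha.2.2.2 hR
      · exact hupd (Sequent.upd_addNum hΘ ha.2.2.2 k) ha.2.2.2 hR
    | cutTerm e =>
      rcases hp with rfl | ⟨k, hk, rfl⟩
      · exact hupd (Sequent.upd_addUnk _) ha.2.2.2 hR
      · exact hupd (Sequent.upd_addNumF k _) ha.2.2.2 hR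
    | cutFr e => exact absurd hR (not_lt_of_ge bot_le)
    | cutFrTerm e => exact absurd hR (not_lt_of_ge bot_le)
    | cutForm n =>
      have hle : Om ≤ r := Order.lt_add_one_iff.1 hR
      have hlt : Om < r := lt_of_le_of_ne hle hr.symm
      rcases hp with rfl | ⟨Pe, Ve, hP, hV, rfl⟩
      · exact hupd (Sequent.upd_addUnk _) ha hR
      · refine ih ⟨?_, ?_, ?_, ?_⟩ ?_
        · rintro (x | m) w hx hxw
          · exact hb.sub _ w hx hxw
          · refine hb.sub _ w hx ?_
            have : m ∉ Pe := fun h => by rw [hP.fresh m h] at hxw; cases hxw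
            simpa [Sequent.addForms, this] using hxw
        · rintro (x | m) hx hxf
          · exact hb.F_eq _ hx hxf
          · exact absurd hx.symm hr
        · exact fun h => (List.prefix_append _ _).trans (hb.P h)
        · intro h m W hm
          refine hb.V h m W ?_
          have : m ∉ Pe := fun h => hP.disjoint m h ((hΘ.dom_V m).1 (by simp [hm]))
          simpa [Sequent.addForms, this] using hm
        · convert hd using 1
          refine combine_ext hr (fun x hx => combine_S_le hx) ?_ (fun x hx => combine_F_le hx) ?_
            (fun h => ⟨combine_P_gt h, combine_V_gt h⟩) fun h => absurd hlt h.not_gt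
          · rintro (x | m) hx
            · exact combine_S_gt hx
            · exact absurd hx hlt.not_gt
          · rintro (x | m) hx
            · exact combine_F_gt hx
            · exact absurd hx hlt.not_gt
    | fr e =>
      have her : r < rk B e := Order.add_one_le_iff.1 hR
      cases hp
      have hu : Θ.Upd (Θ.addUnk e true) e .unk (some true) := Sequent.upd_addUnk _
      have hb' := hb.of_upd hΘ hu ha.2
      have he : (combine B r K Θ).S e = none := by rw [combine_S_gt her, ha.2]
      -- The same `Fr`, of rank above `r`, is applied with the low part `K`.
      refine ih hb' (.infer (combine_isSequent hr hK.seq hΘ) (.fr e) her ⟨ha.1, he⟩ ?_)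
      rintro _ rfl
      have hu' : (combine B r K Θ).Upd ((combine B r K Θ).addUnk e true) e .unk (some true) :=
        Sequent.upd_addUnk _
      convert hd using 1
      have hle : ∀ x, rk B x ≤ r → x ≠ e := by rintro x hx rfl; exact her.not_ge hx
      refine combine_ext hr (fun x hx => ?_) (fun x hx => ?_) (fun x hx => ?_) (fun x hx => ?_)
        (fun h => ⟨combine_P_gt (B := B) h, combine_V_gt (B := B) h⟩)
        (fun h => ⟨combine_P_lt (B := B) h, combine_V_lt (B := B) h⟩)
      · rw [hu'.S_ne (hle x hx), combine_S_le hx]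
      · by_cases hxe : x = e
        · subst hxe; rw [hu'.S_self, hu.S_self]
        · rw [hu'.S_ne hxe, hu.S_ne hxe, combine_S_gt hx]
      · rw [hu'.F_ne (hle x hx), combine_F_le hx]
      · by_cases hxe : x = e
        · subst hxe; rw [hu'.F_self, hu.F_self]
        · rw [hu'.F_ne hxe, hu.F_ne hxe, combine_F_gt hx]
    | h e v =>
      have her : r < rk B e := Order.add_one_le_iff.1 hR
      cases hp
      have hle : ∀ (Φ : Sequent L) x, rk B x ≤ r → hSubst B Φ e v x = Φ.S x := fun Φ x hx =>
        hSubst_of_rk_lt (hx.trans_lt her)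
      -- An `H`-step of rank `> r` keeps everything of rank `≤ r`, so containment in `K` passes from
      -- its result back to `Θ`.
      have hb' : Base B r Θ K := by
        refine ⟨fun x w hx hxw => hb.sub x w hx ?_, fun x hx hxf => hb.F_eq x hx ?_, fun h => ?_,
          fun h => ?_⟩
        · show hSubst B Θ e v x = _
          rw [hle Θ x hx, hxw]
        · rw [hStep_F_of_eq hΘ (hle Θ x hx.le), hxf]
        · have := hb.P h
          change hSeq B Θ e <+: _ at this
          rwa [hSeq_of_gt (h.trans her)] at this
        · have := hb.V h
          change ∀ m W, hHist B Θ e m = some W → _ at this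
          rwa [hHist_of_gt hΘ (h.trans her)] at this
      have w := combine_wk hr hK hΘ hb'
      refine ih hb' ?_
      by_cases hF : CompInconsistent B (combine B r K Θ).S
      · exact .ax w.seq (Or.inl hF)
      obtain ⟨hH, hFe, hact⟩ := ha
      -- Replacing the low part by `K` only adds justified values, so the `H`-step of the path can
      -- be repeated.
      have hH' : HApplies B Cr (combine B r K Θ) e v := hH.wk hB hBpos hr w hF
        fun h1 h2 => absurd (h1 ▸ her) h2.not_gt
      refine .infer w.seq (.h e v) her.le ⟨hH', by rw [w.F_gt e her, hFe], fun x hx => ?_⟩ ?_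
      · have hxr : r < rk B x := by rw [hx.2.1]; exact her
        rw [w.F_gt x hxr]
        exact hact x ((w.active_iff hr her.le hxr).1 hx)
      rintro _ rfl
      convert hd using 1
      have hgt : ∀ x, r < rk B x →
          hSubst B (combine B r K Θ) e v x = hSubst B Θ e v x := fun x hx =>
        hSubst_congr hr her.le w.S_gt w.P_eq w.V_eq hx
      refine combine_ext hr (fun x hx => ?_) hgt (fun x hx => ?_) (fun x hx => ?_)
        (fun h => ⟨?_, ?_⟩) (fun h => ⟨?_, ?_⟩)
      · exact (hle _ x hx).trans (combine_S_le hx)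
      · rw [hStep_F_of_eq w.seq (hle _ x hx), combine_F_le hx]
      · unfold hStep
        dsimp only
        rw [hgt x hx, w.S_gt x hx, w.F_gt x hx]
      · exact (hSeq_of_gt (h.trans her)).trans (combine_P_gt h)
      · exact (hHist_of_gt w.seq (h.trans her)).trans (combine_V_gt h)
      · exact hSeq_congr (w.P_eq h)
      · exact hHist_congr (fun x hx => w.S_gt x (hx ▸ h)) (w.P_eq h) (w.V_eq h)

end Weakening

/-! ## Cut reduction -/

section CutReduction

variable {B : Fm L 2} {Cr : List (Crit L)} {r : Ordinal.{0}} {Θ Θ₀ Ξ Ξ' : Sequent L}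
  {e x : CExpr L} {u v : Val} {f : Option Bool}

open Classical in
/-- The value of `e` is frozen as `t`. -/
def Sequent.setT (e : CExpr L) (Θ : Sequent L) : Sequent L :=
  { Θ with F := Function.update Θ.F e (some true) }

theorem Sequent.setT_F_self : (Ξ.setT e).F e = some true := by simp [Sequent.setT]

theorem Sequent.setT_F_ne (hx : x ≠ e) : (Ξ.setT e).F x = Ξ.F x := by simp [Sequent.setT, hx]

theorem Sequent.setT_addUnk (e : CExpr L) (i : Bool) :
    (Θ.addUnk e i).setT e = Θ.addUnk e true := by
  simp [Sequent.setT, Sequent.addUnk]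

theorem Sequent.IsSequent.setT (hΞ : Ξ.IsSequent B) (he : Ξ.S e = some .unk) :
    (Ξ.setT e).IsSequent B := by
  refine ⟨hΞ.isSubst, hΞ.nodup, hΞ.mem_P, hΞ.dom_V, hΞ.val_V, fun x => ?_⟩
  by_cases hx : x = e
  · subst hx
    rw [Sequent.setT_F_self]
    exact iff_of_true rfl (Or.inl he)
  · rw [Sequent.setT_F_ne hx]
    exact hΞ.dom_F x

theorem Base.upd_right (hΞ : Ξ.IsSequent B) (hb : Base B r Θ₀ Ξ) (hu : Ξ.Upd Ξ' e u f)
    (he : Ξ.S e = none) : Base B r Θ₀ Ξ' where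
  sub x w hx hxw := hu.le he _ _ (hb.sub x w hx hxw)
  F_eq x hx hxf := by
    have h := hb.F_eq x hx hxf
    rw [hu.F_ne, h]
    rintro rfl
    rw [hΞ.F_eq_none he] at h
    cases h
  P h := hu.P ▸ hb.P h
  V h := hu.V ▸ hb.V h

theorem Base.hStep_right (hr : r ≠ Om) (hΞ : Ξ.IsSequent B) (hb : Base B r Θ₀ Ξ)
    (her : r ≤ rk B e) (hS : Θ₀.S e = none) (hF : Θ₀.F e = none) :
    Base B r Θ₀ (hStep B Ξ e v) where
  sub x w hx hxw := by
    have hxe : x ≠ e := by rintro rfl; rw [hS] at hxw; cases hxw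
    exact (hSubst_of_rk_le hr her hx hxe).trans (hb.sub x w hx hxw)
  F_eq x hx hxf := by
    have hxe : x ≠ e := by rintro rfl; rw [hF] at hxf; cases hxf
    rw [hStep_F_of_eq hΞ (hSubst_of_rk_le hr her hx.le hxe), hb.F_eq x hx hxf]
  P h := by
    show _ <+: hSeq B Ξ e
    rw [hSeq_of_gt (h.trans_le her)]
    exact hb.P h
  V h := by
    show ∀ m W, _ → hHist B Ξ e m = some W
    rw [hHist_of_gt hΞ (h.trans_le her)]
    exact hb.V h

variable [L.Structure ℕ]

/-- The low part of `Θ₀` is never destroyed higher up. Only an `H`-step of rank `r` could do so, and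
it needs `(e, ?)` with flag `t`, whereas every `?` of rank `r` in `Θ₀` carries the flag `f`. -/
theorem Base.step (hr : r ≠ Om) (hΘ₀ : Θ₀.IsSequent B)
    (hF : ∀ x, rk B x ≤ r → Θ₀.F x ≠ some true) (hΞ : Ξ.IsSequent B) (hb : Base B r Θ₀ Ξ)
    {R : Rule L} (hR : R.OkPlus B r) (ha : R.Applies B Cr Ξ) (hp : Ξ' ∈ R.premises B Ξ) :
    Base B r Θ₀ Ξ' := by
  cases R with
  | cut e =>
    rcases hp with rfl | ⟨k, hk, rfl⟩
    · exact hb.upd_right hΞ (Sequent.upd_addUnk _) ha.2.2.2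
    · exact hb.upd_right hΞ (Sequent.upd_addNum hΞ ha.2.2.2 k) ha.2.2.2
  | cutFr e =>
    rcases hp with rfl | ⟨k, hk, rfl⟩
    · exact hb.upd_right hΞ (Sequent.upd_addUnk _) ha.2.2.2
    · exact hb.upd_right hΞ (Sequent.upd_addNum hΞ ha.2.2.2 k) ha.2.2.2
  | cutTerm e =>
    rcases hp with rfl | ⟨k, hk, rfl⟩
    · exact hb.upd_right hΞ (Sequent.upd_addUnk _) ha.2.2.2
    · exact hb.upd_right hΞ (Sequent.upd_addNumF k _) ha.2.2.2
  | cutFrTerm e =>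
    rcases hp with rfl | ⟨k, hk, rfl⟩
    · exact hb.upd_right hΞ (Sequent.upd_addUnk _) ha.2.2.2
    · exact hb.upd_right hΞ (Sequent.upd_addNumF k _) ha.2.2.2
  | cutForm n =>
    rcases hp with rfl | ⟨Pe, Ve, hP, hV, rfl⟩
    · exact hb.upd_right hΞ (Sequent.upd_addUnk _) ha
    · refine ⟨?_, ?_, fun h => (hb.P h).trans (List.prefix_append _ _), ?_⟩
      · rintro (x | m) w hx hxw
        · exact hb.sub _ w hx hxw
        · have h := hb.sub _ w hx hxw
          have : m ∉ Pe := fun hm => by rw [hP.fresh m hm] at h; cases h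
          simpa [Sequent.addForms, this] using h
      · rintro (x | m) hx hxf
        · exact hb.F_eq _ hx hxf
        · exact absurd hx.symm hr
      · intro h m W hm
        have h2 := hb.V h m W hm
        have : m ∉ Pe := fun h => hP.disjoint m h ((hΞ.dom_V m).1 (by simp [h2]))
        simpa [Sequent.addForms, this] using h2
  | fr e =>
    cases hp
    exact hb.upd_right hΞ (Sequent.upd_addUnk _) ha.2
  | h e v =>
    have her : r ≤ rk B e := hR
    cases hp
    obtain ⟨hH, hFe, -⟩ := ha
    rcases her.lt_or_eq with hlt | heq
    · refine ⟨fun x w hx hxw => ?_, fun x hx hxf => ?_, fun h => ?_, fun h => ?_⟩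
      · exact (hSubst_of_rk_lt (hx.trans_lt hlt)).trans (hb.sub x w hx hxw)
      · rw [hStep_F_of_eq hΞ (hSubst_of_rk_lt (hx.trans_lt hlt)), hb.F_eq x hx hxf]
      · show _ <+: hSeq B Ξ e
        rw [hSeq_of_gt (h.trans hlt)]
        exact hb.P h
      · show ∀ m W, _ → hHist B Ξ e m = some W
        rw [hHist_of_gt hΞ (h.trans hlt)]
        exact hb.V h
    · have hSe : Θ₀.S e = none := by
        cases h : Θ₀.S e with
        | none => rfl
        | some w =>
          have h1 := hb.sub e w heq.ge h
          rw [hH.unk] at h1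
          cases h1
          have h2 := hb.F_eq e heq.symm (hΘ₀.F_eq_false h (hF e heq.ge))
          rw [hFe] at h2
          cases h2
      exact hb.hStep_right hr hΞ her hSe (hΘ₀.F_eq_none hSe)

open Classical in
/-- The rules applicable after `e` is frozen as `t`, and their premises. -/
theorem Rule.setT {R : Rule L} (hr : r ≠ Om) (hre : rk B e = r)
    (he : Ξ.S e = some .unk) (hFe : Ξ.F e = some false) (hR : R.OkPlus B r)
    (ha : R.Applies B Cr Ξ) : R.Applies B Cr (Ξ.setT e) ∧
      ∀ Ξ' ∈ R.premises B (Ξ.setT e), ∃ Ξ'' ∈ R.premises B Ξ, Ξ' = Ξ''.setT e := by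
  have hne : ∀ e₁, Ξ.S e₁ = none → e₁ ≠ e := by
    rintro e₁ h rfl
    rw [he] at h
    cases h
  have hUnk : ∀ e₁ i, e₁ ≠ e → (Ξ.setT e).addUnk e₁ i = (Ξ.addUnk e₁ i).setT e := by
    intro e₁ i h
    simp only [Sequent.setT, Sequent.addUnk, Function.update_comm h]
  have hNumF : ∀ e₁ k i, e₁ ≠ e → (Ξ.setT e).addNumF e₁ k i = (Ξ.addNumF e₁ k i).setT e := by
    intro e₁ k i h
    simp only [Sequent.setT, Sequent.addNumF, Function.update_comm h]
  cases R with
  | cut e₁ =>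
    refine ⟨ha, ?_⟩
    rintro _ (rfl | ⟨k, hk, rfl⟩)
    · exact ⟨_, Or.inl rfl, hUnk _ _ (hne _ ha.2.2.2)⟩
    · exact ⟨_, Or.inr ⟨k, hk, rfl⟩, rfl⟩
  | cutFr e₁ =>
    refine ⟨ha, ?_⟩
    rintro _ (rfl | ⟨k, hk, rfl⟩)
    · exact ⟨_, Or.inl rfl, hUnk _ _ (hne _ ha.2.2.2)⟩
    · exact ⟨_, Or.inr ⟨k, hk, rfl⟩, rfl⟩
  | cutTerm e₁ =>
    refine ⟨ha, ?_⟩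
    rintro _ (rfl | ⟨k, hk, rfl⟩)
    · exact ⟨_, Or.inl rfl, hUnk _ _ (hne _ ha.2.2.2)⟩
    · exact ⟨_, Or.inr ⟨k, hk, rfl⟩, hNumF _ _ _ (hne _ ha.2.2.2)⟩
  | cutFrTerm e₁ =>
    refine ⟨ha, ?_⟩
    rintro _ (rfl | ⟨k, hk, rfl⟩)
    · exact ⟨_, Or.inl rfl, hUnk _ _ (hne _ ha.2.2.2)⟩
    · exact ⟨_, Or.inr ⟨k, hk, rfl⟩, hNumF _ _ _ (hne _ ha.2.2.2)⟩
  | cutForm n =>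
    refine ⟨ha, ?_⟩
    rintro _ (rfl | ⟨Pe, Ve, hP, hV, rfl⟩)
    · exact ⟨_, Or.inl rfl, hUnk _ _ (hne _ ha)⟩
    · refine ⟨_, Or.inr ⟨Pe, Ve, ⟨hP.1, hP.2, hP.3, hP.4, hP.5, hP.6⟩, hV, rfl⟩, ?_⟩
      simp only [Sequent.setT, Sequent.addForms]
      congr 1
      funext x
      rcases x with x | m
      · by_cases hx : CExpr.term x ‹_› = e
        · subst hx; simp
        · simp [hx]
      · have hm : (CExpr.mem m : CExpr L) ≠ e := by rintro rfl; exact hr hre.symm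
        simp [hm]
  | fr e₁ =>
    refine ⟨ha, ?_⟩
    rintro _ rfl
    exact ⟨_, rfl, hUnk _ _ (hne _ ha.2)⟩
  | h e₁ v =>
    have her : r ≤ rk B e₁ := hR
    obtain ⟨hH, hF, hact⟩ := ha
    -- The main expression of an `H`-inference is frozen as `t`, but `e` was frozen as `f`.
    have hee : e₁ ≠ e := by
      rintro rfl
      rw [hFe] at hF
      cases hF
    refine ⟨⟨⟨hH.1, hH.2, hH.3, hH.4, hH.5, hH.6, hH.7, hH.8, hH.9, hH.10⟩,
      by rw [Sequent.setT_F_ne hee, hF], fun x hx => ?_⟩, ?_⟩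
    · by_cases hxe : x = e
      · rw [hxe, Sequent.setT_F_self]
      · rw [Sequent.setT_F_ne hxe]; exact hact x hx
    · rintro _ rfl
      refine ⟨_, rfl, ?_⟩
      -- The value `?` of `e` survives this `H`-step because `rk e = r ≠ Ω`; so its new flag `t`
      -- survives too.
      have h1 : hSubst B Ξ e₁ v e = some .unk := by
        rw [hSubst_of_rk_le hr her hre.le hee.symm, he]
      show Sequent.mk _ _ _ _ = Sequent.mk _ _ _ _
      congr 1
      funext x
      by_cases hxe : x = e
      · subst hxe
        have h2 : hSubst B (Ξ.setT x) e₁ v x = some .unk := h1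
        have h3 : ((Ξ.setT x).S x).isSome := by simp [Sequent.setT, he]
        rw [if_pos (Or.inl h2), if_pos h3, Sequent.setT_F_self, Function.update_self]
      · rw [Function.update_of_ne hxe, Sequent.setT_F_ne hxe]
        rfl

/-- From derivations of `(e, ?, f), Θ` and of all `(e, u), Θ` one of `(e, ?, t), Θ` is obtained: the
axioms `AxH` for `e` become `H`-inferences. -/
theorem Der.unfreeze (hB : B.SkolemFree) (hBI : B.HasI) (hBpos : B.OnlySign true)
    (hr : r ≠ Om) (hΘ : Reach B Cr (r + 1) Θ) (hre : rk B e = r) (hL : e.InLang)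
    (he : Θ.S e = none)
    (hu : ∀ k, 0 < k → Der B Cr (Rule.OkPlus B r) (Θ.addNum e k))
    (h : Der B Cr (Rule.OkPlus B r) Ξ) (hb : Base B r (Θ.addUnk e false) Ξ) (hg : Good B r Ξ) :
    Der B Cr (Rule.OkPlus B r) (Ξ.setT e) := by
  have hΘs := hΘ.isSequent
  have hupd : Θ.Upd (Θ.addUnk e false) e .unk (some false) := Sequent.upd_addUnk _
  have hΘ₀ : (Θ.addUnk e false).IsSequent B := hΘs.addUnk he hL _
  -- On an `(r+1)`-path no expression of rank `≤ r` is frozen as `t`; this protects the low part of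
  -- `(e, ?, f), Θ` in `Base.step`.
  have hF₀ : ∀ x, rk B x ≤ r → (Θ.addUnk e false).F x ≠ some true := fun x hx =>
    (hΘ.good.upd hupd he (by simp)).F_lt x (Order.lt_add_one_iff.2 hx)
  have hreΩ : rk B e ≠ Om := hre ▸ hr
  induction h with
  | @ax Ξ hΞ h =>
    have heΞ : Ξ.S e = some .unk := hb.sub e _ hre.le hupd.S_self
    have hΞT := hΞ.setT heΞ
    rcases h with h | h | ⟨e₁, v, hH, x, hx, hxf⟩
    · exact .ax hΞT (Or.inl h)
    · exact .ax hΞT (Or.inr (Or.inl h))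
    have hH' : HApplies B Cr (Ξ.setT e) e₁ v :=
      ⟨hH.1, hH.2, hH.3, hH.4, hH.5, hH.6, hH.7, hH.8, hH.9, hH.10⟩
    -- Only an `AxH` with `H`-expression `e` is lost. In it `e` is the sole active expression, so
    -- with flag `t` the rule `H` applies.
    by_cases hee : e₁ = e
    · subst hee
      have hact : ∀ x, Active B (Ξ.setT e₁) e₁ v x → (Ξ.setT e₁).F x = some true := fun x hx => by
        rw [hx.eq_of_rk_ne hreΩ, Sequent.setT_F_self]
      refine .infer hΞT (.h e₁ v) hre.ge ⟨hH', Sequent.setT_F_self, hact⟩ ?_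
      rintro _ rfl
      obtain ⟨hv, hvu⟩ := hH.fits hΞ.isSubst
      -- After the step `e` has a numerical value and rank `≠ Ω`, hence no flag; the changed flag
      -- leaves no trace.
      have heq : hStep B (Ξ.setT e₁) e₁ v = hStep B Ξ e₁ v := by
        show Sequent.mk _ _ _ _ = Sequent.mk _ _ _ _
        congr 1
        funext x
        by_cases hxe : x = e₁
        · subst hxe
          exact (hStep_F_self (Θ := Ξ.setT x) hreΩ hvu).trans
            (hStep_F_self (Θ := Ξ) hreΩ hvu).symm
        · rw [Sequent.setT_F_ne hxe]
          rfl
      rw [heq]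
      set K := hStep B Ξ e₁ v with hK
      have hKseq : K.IsSequent B := hStep_isSequent hΞ hv hH.unk hvu fun n hn =>
        absurd (hn ▸ rfl) hreΩ
      by_cases hF : CompInconsistent B K.S
      · exact .ax hKseq (Or.inl hF)
      have hKS : ∀ x, rk B x ≤ r → x ≠ e₁ → K.S x = Ξ.S x := fun x hx hxe =>
        hSubst_of_rk_le hr hre.ge hx hxe
      have hKe : K.S e₁ = some v := hSubst_self
      have hKgt : ∀ x, r < rk B x → K.S x = none := fun x hx => by
        have hxe : x ≠ e₁ := fun h => hx.ne' (h ▸ hre)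
        exact (hSubst_of_rk_ne hreΩ hxe).trans (if_neg (by rw [hre]; exact hx.not_ge))
      -- `HApplies` makes `Ξ` decide all the conditions `F(x, w)`. They are evaluated below rank
      -- `r`, where `K` and `Ξ` agree, so `K` decides them too; being computationally consistent, it
      -- models them.
      have hker : Kernel B r K := by
        refine ⟨hKseq, hg.hStep hΞ hre.ge, hKgt, fun x w hx hxw => ?_⟩
        have hxr : rk B x ≤ r := by
          by_contra hlt
          rw [hKgt x (not_le.1 hlt)] at hxw
          cases hxw
        have hdec : Decides Ξ.S (justif B x w) := by
          by_cases hxe : x = e₁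
          · subst hxe
            rw [hKe] at hxw
            cases hxw
            exact hH.decides_new
          · exact hH.decides_justif x w hx (by rw [← hKS x hxr hxe, hxw])
        have hdec' : Decides K.S (justif B x w) := by
          rw [decides_iff] at hdec ⊢
          have hlt : ∀ y, rk B y < r → K.S y = Ξ.S y := fun y hy =>
            hSubst_of_rk_lt (hre.symm ▸ hy)
          rwa [reduce_justif_congr hB hBI hr hlt hx hxr w]
        exact hdec'.resolve_right fun h => hF (Or.inl ⟨x, w, hxw, h⟩)
      have hb' : Base B r Θ Ξ := hb.of_upd hΘs hupd he
      have hbK : Base B r Θ K :=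
        hb'.hStep_right hr hΞ hre.ge he (hΘs.F_eq_none he)
      -- The `H`-value is a positive numeral, so `(e, v), Θ` is one of the premises of the original
      -- cut. Its derivation is weakened to `combine B r K Θ` and carried down the path.
      obtain ⟨k, hk, rfl⟩ :=
        (hv.term_cases (isTerm_of_rk_ne hreΩ)).resolve_left hvu
      refine hΘ.der_kernel hB hBpos hr hker hbK ((hu k hk).weaken hB hBI hBpos hr ?_)
      exact (combine_wk hr hker hΘs hbK).upd_left (Sequent.upd_addNum hΘs he k)
        (by rw [combine_S_le hre.le, hKe]) hre.le (by simp)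
    -- If `e` were active for `e₁`, both would have rank `r ≠ Ω`, and then `e₁ = e`.
    · have hxe : x ≠ e := by
        rintro rfl
        have h1 : rk B e₁ ≠ Om := by rw [← hx.2.1]; exact hreΩ
        exact hee (hx.eq_of_rk_ne h1).symm
      exact .ax hΞT (Or.inr (Or.inr ⟨e₁, v, hH', x, hx, by rw [Sequent.setT_F_ne hxe, hxf]⟩))
  | @infer Ξ hΞ R hR ha ds ih =>
    have heΞ : Ξ.S e = some .unk := hb.sub e _ hre.le hupd.S_self
    obtain ⟨ha', hp⟩ := Rule.setT hr hre heΞ (hb.F_eq e hre hupd.F_self) hR ha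
    refine .infer (hΞ.setT heΞ) R hR ha' fun Ξ' hΞ' => ?_
    obtain ⟨Ξ'', h1, rfl⟩ := hp Ξ' hΞ'
    refine ih Ξ'' h1 (hb.step hr hΘ₀ hF₀ hΞ hR ha h1) (hg.step hΞ ?_ ha h1)
    cases R with
    | cutFr e => exact Or.inr (Eq.ge hR)
    | cutFrTerm e => exact Or.inr (Eq.ge hR)
    | fr e => exact Or.inr (le_of_lt hR)
    | h e v => exact Or.inr hR
    | _ => exact Or.inl rfl

/-- Only cuts of rank exactly `r` are altered; in particular those of rank `Ω` already lie strictly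
below `r`. `Fr` and `H` of rank `≥ r + 1` satisfy the bounds for `r⁺` at once. Reachability is
carried along, as `Der.unfreeze` needs a path to each cut. -/
theorem Der.cut_reduction (hB : B.SkolemFree) (hBI : B.HasI) (hBpos : B.OnlySign true)
    (hr : r ≠ Om) (h : Der B Cr (Rule.Ok B (r + 1)) Θ) (hΘ : Reach B Cr (r + 1) Θ) :
    Der B Cr (Rule.OkPlus B r) Θ := by
  induction h with
  | ax hΘs h => exact .ax hΘs h
  | @infer Θ hΘs R hR ha ds ih =>
    have hreach : ∀ Θ' ∈ R.premises B Θ, Reach B Cr (r + 1) Θ' := fun Θ' h' =>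
      hΘ.step R hR ha h' (ds Θ' h').isSequent
    have ih' := fun Θ' h' => ih Θ' h' (hreach Θ' h')
    cases R with
    | cut e =>
      have her : rk B e ≤ r := Order.lt_add_one_iff.1 hR
      rcases her.lt_or_eq with hlt | heq
      · exact .infer hΘs (.cut e) hlt ha ih'
      · refine .infer hΘs (.cutFr e) heq ha ?_
        rintro _ (rfl | ⟨k, hk, rfl⟩)
        · have h0 : Θ.addUnk e false ∈ Rule.premises B (.cut e) Θ := Or.inl rfl
          rw [← Sequent.setT_addUnk e false]
          exact Der.unfreeze hB hBI hBpos hr hΘ heq ha.2.1 ha.2.2.2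
            (fun k hk => ih' _ (Or.inr ⟨k, hk, rfl⟩)) (ih' _ h0) (Base.refl _)
            ((hreach _ h0).good.mono (Order.lt_add_one_iff.2 le_rfl).le)
        · exact ih' _ (Or.inr ⟨k, hk, rfl⟩)
    | cutTerm e =>
      have her : rk B e ≤ r := Order.lt_add_one_iff.1 hR
      have hlt : rk B e < r := lt_of_le_of_ne her fun h => hr (h ▸ ha.2.2.1)
      exact .infer hΘs (.cutTerm e) hlt ha ih'
    | cutForm n =>
      have her : Om ≤ r := Order.lt_add_one_iff.1 hR
      exact .infer hΘs (.cutForm n) (lt_of_le_of_ne her hr.symm) ha ih'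
    | cutFr e => exact absurd hR (not_lt_of_ge bot_le)
    | cutFrTerm e => exact absurd hR (not_lt_of_ge bot_le)
    | fr e => exact .infer hΘs (.fr e) (Order.add_one_le_iff.1 hR) ha ih'
    | h e v => exact .infer hΘs (.h e v) (Order.add_one_le_iff.1 hR).le ha ih'

end CutReduction

end EpsID1

end

-- Predicative cut reduction

open EpsID1
theorem mainTheorem4 {L : FirstOrder.Language.{0, 0}} [L.Structure ℕ]
    (B : Fm L 2) (hB : B.SkolemFree) (hBsimple : B.Simple) (hBI : B.HasI)
    (hBpos : B.OnlySign true)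
    (Cr : List (Crit L)) (hCr : ∀ c ∈ Cr, c.InLang)
    (r : Ordinal.{0}) (hr : r ≠ Om) (Θ : Sequent L)
    (d : EpsID1.Derivation B Cr Θ) (hd : d.IsR (r + 1)) (hΘ : HasRPath B Cr (r + 1) Θ) :
    ∃ d' : EpsID1.Derivation B Cr Θ, d'.IsRPlus r ∧ d'.prune.IsR r := by
  obtain ⟨d', hd'⟩ := (Der.cut_reduction hB hBI hBpos hr (d.der hd) hΘ.reach).exists_derivation
  have h : d'.IsRPlus r := hd'
  exact ⟨d', h, h.prune⟩
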